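/- Let $K$ be an algebraically closed field of characteristic zero, let $Q$ be a finite quiver with vertex set $I$, and let $\overline{Q}$ be its double, obtained by adjoining a reverse arrow $a^*$ for each arrow $a$ of $Q$. Write $h(a)$, $t(a)$ for the head and tail of an arrow $a$. For $\alpha\in\mathbb{N}^I$ put $\alpha\cdot\alpha=\sum_{i\in I}\alpha_i^2$, $q(\alpha)=\sum_{i\in I}\alpha_i^2-\sum_{a\in Q}\alpha_{h(a)}\alpha_{t(a)}$ and $p(\alpha)=1-q(\alpha)$. Let $\mathrm{Rep}(\overline{Q},\alpha)=\bigoplus_{a\in\overline{Q}}\mathrm{Mat}(\alpha_{h(a)}\times\alpha_{t(a)},K)$, on which $\mathrm{GL}(\alpha)=\prod_{i\in I}\mathrm{GL}(\alpha_i,K)$ acts by conjugation, and let $\mu_\alpha:\mathrm{Rep}(\overline{Q},\alpha)\to\prod_{i\in I}\mathrm{Mat}(\alpha_i,K)$ be the map $$\mu_\alpha(x)_i=\sum_{a\in Q,\ h(a)=i}x_ax_{a^*}-\sum_{a\in Q,\ t(a)=i}x_{a^*}x_a .$$ The points of $\mu_\alpha^{-1}(0)$ are the representations of dimension vector $\alpha$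 of the preprojective algebra $\Pi=\Pi^0$ of $Q$. Let $\pi:\mu_\alpha^{-1}(0)\to N_Q(0,\alpha)=\mu_\alpha^{-1}(0)/\!\!/\mathrm{GL}(\alpha)$ be the affine quotient map, where $N_Q(0,\alpha)$ is the affine variety whose coordinate ring consists of the $\mathrm{GL}(\alpha)$-invariant regular functions on the variety $\mu_\alpha^{-1}(0)$; its points classify the isomorphism classes of semisimple representations of $\Pi$ of dimension vector $\alpha$. A point $x\in N_Q(0,\alpha)$ has representation type $(k_1,\beta^{(1)};\dots;k_r,\beta^{(r)})$ if there is $y\in\pi^{-1}(x)$ whose representation is isomorphic to $T_1^{k_1}\oplus\dots\oplus T_r^{k_r}$ with all $k_t\ge 1$ and with $T_1,\dots,T_r$ pairwise non-isomorphic simple representations of $\Pi$ of dimension vectors $\beta^{(1)},\dots,\beta^{(r)}$; the stratum of this type is the set of all such points $x$. (1) If $x\in N_Q(0,\alpha)$ has representation type $(k_1,\beta^{(1)};\dots;k_r,\beta^{(r)})$, then $$\dim\pi^{-1}(x)\le\alpha\cdot\alpha-1+p(\alpha)-\sum_{t=1}^r p(\beta^{(t)}).$$ (2) The inverse image in $\mu_\alpha^{-1}(0)$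 of the stratum of representation type $(k_1,\beta^{(1)};\dots;k_r,\beta^{(r)})$ has dimension at most $$\alpha\cdot\alpha-1+p(\alpha)+\sum_{t=1}^r p(\beta^{(t)}).$$ Here the dimension of a subset of $\mathrm{Rep}(\overline{Q},\alpha)$ is that of its Zariski closure, and the empty set has dimension $-\infty$. -/

import Mathlib

universe u v w w'

namespace QuiverReduction

section Forms

variable {I : Type u} [Fintype I] [Quiver.{v} I] [∀ i j : I, Fintype (i ⟶ j)]

/-- The quadratic form `q(a) = ∑ i, a i ^ 2 - ∑ (arrows e : i ⟶ j), a i * a j` of the quiver. -/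
def q (a : I → ℤ) : ℤ :=
  ∑ i, a i ^ 2 - ∑ i, ∑ j, ∑ _e : (i ⟶ j), a j * a i

/-- `p(a) = 1 - q(a)`, for a dimension vector `a`. -/
def p (a : I → ℕ) : ℤ := 1 - q fun i => (a i : ℤ)

/-- `a · a = ∑ i, a i ^ 2`. -/
def dotSelf (a : I → ℕ) : ℤ := ∑ i, (a i : ℤ) * (a i : ℤ)

end Forms

section Double

variable {I : Type u} [Quiver.{v} I]

/-- Arrows `i ⟶ j` of the double of the quiver: `Sum.inl e` is an arrow `e : i ⟶ j` of the quiver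
itself, and `Sum.inr e` is the reverse `e*` of an arrow `e : j ⟶ i` (so every loop also gets
a separate reverse). -/
abbrev DArrow (i j : I) : Type v := (i ⟶ j) ⊕ (j ⟶ i)

variable (K : Type w) [Field K]

/-- Representations of the double quiver on given vector spaces `V i`. -/
abbrev LinRep (V : I → Type w') [∀ i, AddCommGroup (V i)] [∀ i, Module K (V i)] :
    Type (max u v w') :=
  ∀ i j : I, DArrow i j → (V i →ₗ[K] V j)

variable {K}

namespace LinRep

variable {V W : I → Type w'} [∀ i, AddCommGroup (V i)] [∀ i, Module K (V i)]
  [∀ i, AddCommGroup (W i)] [∀ i, Module K (W i)]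

/-- Isomorphism of representations. -/
def Iso (x : LinRep K V) (y : LinRep K W) : Prop :=
  ∃ f : ∀ i, V i ≃ₗ[K] W i, ∀ (i j : I) (e : DArrow i j) (v : V i),
    f j (x i j e v) = y i j e (f i v)

/-- A simple representation: it is nonzero, and its only subrepresentations are `0` and itself. -/
def IsSimple (x : LinRep K V) : Prop :=
  (∃ i, Nontrivial (V i)) ∧
    ∀ U : ∀ i, Submodule K (V i),
      (∀ (i j : I) (e : DArrow i j), ∀ v ∈ U i, x i j e v ∈ U j) →
        (∀ i, U i = ⊥) ∨ (∀ i, U i = ⊤)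

/-- The direct sum `⨁ t, (T t)^(k t)`. -/
def sumPow {r : ℕ} (k : Fin r → ℕ) {V : Fin r → I → Type w'}
    [∀ t i, AddCommGroup (V t i)] [∀ t i, Module K (V t i)] (T : ∀ t, LinRep K (V t)) :
    LinRep K (fun i => (t : Fin r) → Fin (k t) → V t i) :=
  fun i j e => LinearMap.piMap fun t => LinearMap.piMap fun _ => T t i j e

end LinRep

variable (K)

/-- The affine space `Rep(Q̄, α)` of representations of the double quiver by matrices. -/
abbrev DRep (α : I → ℕ) : Type (max u v w) :=
  ∀ i j : I, DArrow i j → Matrix (Fin (α j)) (Fin (α i)) K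

/-- The group `GL(α) = ∏ i, GL(α i, K)`. -/
abbrev GLProd (α : I → ℕ) : Type (max u w) := ∀ i : I, GL (Fin (α i)) K

variable {K}

/-- The conjugation action of `GL(α)`: `(g x)_a = g_{h(a)} x_a g_{t(a)}⁻¹`. -/
def conj {α : I → ℕ} (g : GLProd K α) (x : DRep K α) : DRep K α :=
  fun i j e => (g j).1 * x i j e * (g i)⁻¹.1

/-- The representation on the column spaces `K^(α i)` given by a point of `Rep(Q̄, α)`. -/
def toLinRep {α : I → ℕ} (x : DRep K α) : LinRep K (fun i => Fin (α i) → K) :=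
  fun i j e => (x i j e).mulVecLin

/-- The coordinates on the affine space `Rep(Q̄, α)`: an arrow of the double, with a row and
a column index. -/
abbrev Coord (α : I → ℕ) : Type (max u v) :=
  Σ (i : I) (j : I) (_ : DArrow i j), Fin (α j) × Fin (α i)

/-- The coordinate vector of a point of `Rep(Q̄, α)`. -/
def coords {α : I → ℕ} (x : DRep K α) : Coord α → K :=
  fun c => x c.1 c.2.1 c.2.2.1 c.2.2.2.1 c.2.2.2.2

/-- The dimension of a (constructible) subset `S` of the affine space `Rep(Q̄, α)`:
the Krull dimension of the coordinate ring of the Zariski closure of `S`. It is `⊥` if `S = ∅`. -/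
noncomputable def dim {α : I → ℕ} (S : Set (DRep K α)) : WithBot ℕ∞ :=
  ringKrullDim (MvPolynomial (Coord α) K ⧸ MvPolynomial.vanishingIdeal K (coords '' S))

/-- The dimension of `S` is at most the integer `b`. -/
def DimLE {α : I → ℕ} (S : Set (DRep K α)) (b : ℤ) : Prop :=
  ∀ n : ℕ, (n : WithBot ℕ∞) ≤ dim S → (n : ℤ) ≤ b

end Double

section Moment

variable {I : Type u} [Fintype I] [Quiver.{v} I] [∀ i j : I, Fintype (i ⟶ j)]
variable {K : Type w} [Field K]

/-- The moment map `μ_α`, with `i`-th component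
`∑_{a, h(a) = i} x_a x_{a*} - ∑_{a, t(a) = i} x_{a*} x_a`. -/
def moment {α : I → ℕ} (x : DRep K α) (i : I) : Matrix (Fin (α i)) (Fin (α i)) K :=
  ∑ j, ∑ e : (j ⟶ i), x j i (Sum.inl e) * x i j (Sum.inr e) -
    ∑ j, ∑ e : (i ⟶ j), x j i (Sum.inr e) * x i j (Sum.inl e)

variable (K)

/-- The fibre `μ_α⁻¹(0)`; its points are the representations of dimension vector `α` of
the preprojective algebra. -/
def zeroFibre (α : I → ℕ) : Set (DRep K α) := {x | ∀ i, moment x i = 0}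

/-- The coordinate ring of the variety `μ_α⁻¹(0)`, as the algebra of its polynomial functions. -/
noncomputable def coordRing (α : I → ℕ) : Subalgebra K (zeroFibre K α → K) :=
  (MvPolynomial.aeval (R := K) fun (c : Coord α) (x : zeroFibre K α) => coords x.1 c).range

/-- The algebra of `GL(α)`-invariant polynomial functions on `μ_α⁻¹(0)`. -/
noncomputable def invRing (α : I → ℕ) : Subalgebra K (zeroFibre K α → K) where
  carrier := {f | f ∈ coordRing K α ∧
    ∀ (g : GLProd K α) (x y : zeroFibre K α), y.1 = conj g x.1 → f y = f x}
  mul_mem' := by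
    rintro a b ⟨ha, ha'⟩ ⟨hb, hb'⟩
    refine ⟨mul_mem ha hb, fun g x y h => ?_⟩
    simp only [Pi.mul_apply, ha' g x y h, hb' g x y h]
  add_mem' := by
    rintro a b ⟨ha, ha'⟩ ⟨hb, hb'⟩
    refine ⟨add_mem ha hb, fun g x y h => ?_⟩
    simp only [Pi.add_apply, ha' g x y h, hb' g x y h]
  algebraMap_mem' c := ⟨Subalgebra.algebraMap_mem _ c, fun _ _ _ _ => rfl⟩

/-- The (closed) points of the affine quotient variety `N_Q(0, α) = μ_α⁻¹(0) // GL(α)`, the affine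
variety whose coordinate ring is the algebra of invariants. -/
abbrev NQ (α : I → ℕ) : Type (max u v w) := invRing K α →ₐ[K] K

variable {K}

/-- The quotient map `π : μ_α⁻¹(0) → N_Q(0, α)`: a point is sent to evaluation of invariants
at that point. -/
noncomputable def quotMap {α : I → ℕ} (x : zeroFibre K α) : NQ K α :=
  (Pi.evalAlgHom K (fun _ : zeroFibre K α => K) x).comp (invRing K α).val

/-- The inverse image in `μ_α⁻¹(0)`, under the quotient map, of a set of points of `N_Q(0, α)`,
regarded as a subset of `Rep(Q̄, α)`. -/
def preimage {α : I → ℕ} (S : Set (NQ K α)) : Set (DRep K α) :=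
  Subtype.val '' (quotMap ⁻¹' S)

/-- `y` is a semisimple representation of the preprojective algebra isomorphic to
`⨁ t, (T t)^(k t)`, with multiplicities `k t > 0` and pairwise non-isomorphic simple
representations `T t` of the preprojective algebra, of dimension vectors `β t`. -/
def IsSemisimpleOfType {α : I → ℕ} (y : zeroFibre K α) {r : ℕ} (k : Fin r → ℕ)
    (β : Fin r → I → ℕ) : Prop :=
  (∀ t, 0 < k t) ∧
    ∃ T : ∀ t, DRep K (β t),
      (∀ t, T t ∈ zeroFibre K (β t)) ∧
      (∀ t, (toLinRep (T t)).IsSimple) ∧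
      (∀ s t, s ≠ t → ¬ (toLinRep (T s)).Iso (toLinRep (T t))) ∧
      (toLinRep y.1).Iso (LinRep.sumPow k fun t => toLinRep (T t))

/-- The stratum of representation type `(k_1, β_1; …; k_r, β_r)`: the points of `N_Q(0, α)`
whose corresponding semisimple representation has that type. -/
def stratum (α : I → ℕ) {r : ℕ} (k : Fin r → ℕ) (β : Fin r → I → ℕ) : Set (NQ K α) :=
  {ξ | ∃ y : zeroFibre K α, quotMap y = ξ ∧ IsSemisimpleOfType y k β}

end Moment

end QuiverReduction

universe ww

/-! Dimensions are counted as transcendence degrees. If a set of representations has dimension at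
least `n`, the germ of its tautological family, over some ultrapower `L` of `K`, has entries of
transcendence degree at least `n` over `K` (`exists_isUltrapower_of_le_dim`). The algebraic
properties needed of the points pass to this germ, so both claims become bounds on the transcendence
degree of one representation `M` over `L`.

A point of a fibre of the quotient map has the same trace functions as the semisimple point below
it, so its composition factors are the `T t`. Splitting off all homomorphisms to one `T t` at a
time, from the top, gives a filtration (`exists_topFilt`). Only finitely many types of filtration
occur for given dimension vectors, and an ultrafilter selects one.

A layer `0 → N → M → S ^ m → 0` with `S` of dimension `β` costs `m * (β·α - m)` parameters for the
span of the projections, a point of a Grassmannian, and `m` cocycles in the kernel of `dMoment N S`.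
By trace duality the cokernel of `dMoment N S` is dual to the homomorphisms from `N` to `S`. These
have dimension at most the next multiplicity of `S` in the filtration, and vanish when `p(β) = 0`,
since `S` is then rigid. A quadratic inequality (`defect_step`) sums the layers to the bound of (1).

In (2) the simples vary, each with at most `2 p(β) + β·β - 1` parameters. The part `β·β - 1` comes
from conjugation, which does not change `M`. Comparing the simples with generic conjugates and using
submodularity of the transcendence degree removes it (`TopFilt.trRk_le_of_varying`). What remains is
`2 p(β)` for each simple, turning `- ∑ p` into `+ ∑ p`. -/

namespace QuiverReduction

/-! ### Ultrapowers of the base field as a source of generic points -/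

section Ultrapower

/-- `L` is the ultrapower of `K` along `U`, with `π` sending a family to its germ. -/
structure IsUltrapower {K : Type*} [Field K] {Ω : Type*} (U : Ultrafilter Ω) {L : Type*} [Field L]
    [Algebra K L] (π : (Ω → K) →ₐ[K] L) : Prop where
  surj : Function.Surjective π
  eq_zero_iff : ∀ f, π f = 0 ↔ ∀ᶠ ω in (U : Filter Ω), f ω = 0

theorem exists_isUltrapower (K : Type w) [Field K] {Ω : Type w'} (U : Ultrafilter Ω) :
    ∃ (L : Type (max w w')) (_ : Field L) (_ : Algebra K L) (π : (Ω → K) →ₐ[K] L),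
      IsUltrapower U π := by
  let φ : (Ω → K) →+* Filter.Germ (U : Filter Ω) K := Filter.Germ.coeRingHom (U : Filter Ω)
  let _ : Algebra K (Filter.Germ (U : Filter Ω) K) :=
    (φ.comp (algebraMap K (Ω → K))).toAlgebra
  refine ⟨Filter.Germ (U : Filter Ω) K, inferInstance, inferInstance,
    { φ with commutes' := fun c => rfl }, ?_, ?_⟩
  · intro g
    induction g using Filter.Germ.inductionOn with
    | h f => exact ⟨f, rfl⟩
  · intro f
    exact Filter.Germ.coe_eq

/-- The sets where a nonzero polynomial in the `f j` does not vanish are nonempty by independence,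
and products of polynomials show that they form a filter basis. An ultrafilter containing them all
keeps every such polynomial nonzero in the ultrapower. -/
theorem AlgebraicIndependent.exists_isUltrapower {K : Type w} [Field K] {Ω : Type w'} {J : Type*}
    {f : J → Ω → K} (hf : AlgebraicIndependent K f) :
    ∃ (U : Ultrafilter Ω) (L : Type (max w w')) (_ : Field L) (_ : Algebra K L)
      (π : (Ω → K) →ₐ[K] L), IsUltrapower U π ∧ AlgebraicIndependent K (fun j => π (f j)) := by
  have key : ∀ (g : MvPolynomial J K), g ≠ 0 → ∃ ω, MvPolynomial.aeval f g ω ≠ 0 := by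
    intro g hg
    by_contra! h
    exact hg ((injective_iff_map_eq_zero _).1 hf g (funext h))
  let B : FilterBasis Ω :=
    { sets := {A | ∃ g : MvPolynomial J K, g ≠ 0 ∧ A = {ω | MvPolynomial.aeval f g ω ≠ 0}}
      nonempty := ⟨_, 1, one_ne_zero, rfl⟩
      inter_sets := by
        rintro _ _ ⟨g, hg, rfl⟩ ⟨h, hh, rfl⟩
        refine ⟨_, ⟨g * h, mul_ne_zero hg hh, rfl⟩, ?_⟩
        intro ω hω
        simpa [not_or] using hω }
  have hB : B.filter.NeBot := by
    rw [B.hasBasis.neBot_iff]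
    rintro _ ⟨g, hg, rfl⟩
    exact key g hg
  let U := Ultrafilter.of B.filter
  obtain ⟨L, iL, iA, π, hπ⟩ := QuiverReduction.exists_isUltrapower K U
  refine ⟨U, L, iL, iA, π, hπ, ?_⟩
  rw [AlgebraicIndependent, injective_iff_map_eq_zero]
  intro g hg
  by_contra hne
  have h1 : π (MvPolynomial.aeval f g) = 0 := by
    rw [← hg, MvPolynomial.comp_aeval_apply]
  rw [hπ.eq_zero_iff] at h1
  have h2 : ∀ᶠ ω in (U : Filter Ω), MvPolynomial.aeval f g ω ≠ 0 :=
    Ultrafilter.of_le B.filter (B.mem_filter_of_mem ⟨g, hne, rfl⟩)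
  obtain ⟨ω, h, h'⟩ := (h1.and h2).exists
  exact h' h

end Ultrapower

/-! ### Transcendence degree as a matroid rank -/

section Rank

variable {K L : Type*} [Field K] [Field L] [Algebra K L]

/-- The transcendence degree over `K` of the field generated by a subset of `L`. -/
noncomputable abbrev trRk (K : Type*) {L : Type*} [Field K] [Field L] [Algebra K L] (X : Set L) :
    ℕ∞ :=
  (AlgebraicIndependent.matroid K L).eRk X

theorem mem_closure_of_mem_adjoin {X : Set L} {a : L} (ha : a ∈ IntermediateField.adjoin K X) :
    a ∈ (AlgebraicIndependent.matroid K L).closure X := by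
  rw [AlgebraicIndependent.matroid_closure_eq]
  rw [IntermediateField.mem_adjoin_iff_div] at ha
  obtain ⟨r, hr, s, hs, rfl⟩ := ha
  rw [SetLike.mem_coe, Subalgebra.mem_algebraicClosure]
  rw [div_eq_mul_inv]
  exact (isAlgebraic_algebraMap (⟨r, hr⟩ : Algebra.adjoin K X)).mul
    (isAlgebraic_algebraMap (⟨s, hs⟩ : Algebra.adjoin K X)).inv

theorem le_trRk_of_algebraicIndependent {n : ℕ} {f : Fin n → L} (hf : AlgebraicIndependent K f)
    {X : Set L} (h : ∀ j, f j ∈ (AlgebraicIndependent.matroid K L).closure X) :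
    (n : ℕ∞) ≤ trRk K X := by
  have h2 := (AlgebraicIndependent.matroid K L).eRk_mono (Set.range_subset_iff.2 h)
  rw [Matroid.eRk_closure_eq] at h2
  refine le_trans ?_ h2
  have hI : (AlgebraicIndependent.matroid K L).Indep (Set.range f) :=
    AlgebraicIndependent.matroid_indep_iff.2 hf.to_subtype_range
  rw [hI.eRk_eq_encard, ← Set.image_univ, hf.injective.encard_image]
  simp

end Rank

/-! ### From Krull dimension to the transcendence degree of a germ -/

section KrullDim

/-- Noether normalization makes `R` integral over a polynomial ring in `s` variables. By
incomparability, contraction of primes is strictly monotone, so `n ≤ s` and `n` of the variables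
serve. -/
theorem exists_algebraicIndependent_of_le_ringKrullDim {K R : Type*} [Field K] [CommRing R]
    [Algebra K R] [Algebra.FiniteType K R] {n : ℕ} (hn : (n : WithBot ℕ∞) ≤ ringKrullDim R) :
    ∃ f : Fin n → R, AlgebraicIndependent K f := by
  have : Nontrivial R := by
    by_contra h
    rw [not_nontrivial_iff_subsingleton] at h
    rw [ringKrullDim_eq_bot_of_subsingleton] at hn
    simp at hn
  obtain ⟨s, g, hg, hint⟩ := exists_integral_inj_algHom_of_fg K R
  have hle : ringKrullDim R ≤ s := by
    have h1 : ringKrullDim R ≤ ringKrullDim (MvPolynomial (Fin s) K) := by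
      let _ := g.toRingHom.toAlgebra
      have : Algebra.IsIntegral (MvPolynomial (Fin s) K) R := ⟨hint⟩
      refine Order.krullDim_le_of_strictMono
        (PrimeSpectrum.comap (algebraMap (MvPolynomial (Fin s) K) R)) ?_
      intro p q hpq
      exact Ideal.IsIntegral.comap_lt_comap hpq
    refine h1.trans ?_
    rw [MvPolynomial.ringKrullDim_of_isNoetherianRing]
    simp
  have hns : n ≤ s := by exact_mod_cast hn.trans hle
  refine ⟨fun i => g (MvPolynomial.X (Fin.castLE hns i)), ?_⟩
  have := (MvPolynomial.algebraicIndependent_X (Fin s) K).map' hg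
  exact this.comp _ (Fin.castLE_injective hns)

variable {I : Type u} [Fintype I] [Quiver.{v} I] [∀ i j : I, Fintype (i ⟶ j)]
  {K : Type w} [Field K]

/-- The coordinate ring of the closure of `S` embeds in the functions on `S`, so `n` independent
elements of it stay independent as functions, and then as germs for a suitable ultrafilter. These
germs are polynomials in the entries of the germ of the tautological family, which thus acts as a
generic point of `S`, closed or not. -/
theorem exists_isUltrapower_of_le_dim {α : I → ℕ} {S : Set (DRep K α)} {n : ℕ}
    (hn : (n : WithBot ℕ∞) ≤ dim S) :
    ∃ (U : Ultrafilter S) (L : Type (max u v w)) (_ : Field L) (_ : Algebra K L)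
      (π : (S → K) →ₐ[K] L), IsUltrapower U π ∧
      (n : ℕ∞) ≤ trRk K
        (Set.range fun c : Coord α => π fun s => coords s.1 c) := by
  classical
  let J := MvPolynomial.vanishingIdeal K (coords '' S)
  let ev : MvPolynomial (Coord α) K →ₐ[K] (S → K) :=
    MvPolynomial.aeval fun (c : Coord α) (s : S) => coords s.1 c
  have hev : ∀ g s, ev g s = MvPolynomial.aeval (coords s.1) g := by
    intro g s
    exact MvPolynomial.comp_aeval_apply (fun (c : Coord α) (s : S) => coords s.1 c)
      (Pi.evalAlgHom K (fun _ : S => K) s) g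
  have hker : ∀ g, g ∈ J ↔ ev g = 0 := by
    intro g
    simp only [J, MvPolynomial.mem_vanishingIdeal_iff, funext_iff, hev, Set.forall_mem_image,
      Subtype.forall, Pi.zero_apply]
  let evq : (MvPolynomial (Coord α) K ⧸ J) →ₐ[K] (S → K) :=
    Ideal.Quotient.liftₐ J ev fun g hg => (hker g).1 hg
  have hinj : Function.Injective evq := by
    rw [injective_iff_map_eq_zero]
    intro g hg
    obtain ⟨g, rfl⟩ := Ideal.Quotient.mk_surjective g
    exact Ideal.Quotient.eq_zero_iff_mem.2 ((hker g).2 hg)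
  obtain ⟨f, hf⟩ := exists_algebraicIndependent_of_le_ringKrullDim (K := K) hn
  obtain ⟨U, L, iL, iA, π, hπ, hind⟩ :=
    AlgebraicIndependent.exists_isUltrapower (hf.map' (f := evq) hinj)
  refine ⟨U, L, iL, iA, π, hπ, ?_⟩
  set X := Set.range fun c : Coord α => π fun s => coords s.1 c
  refine le_trRk_of_algebraicIndependent hind fun j => ?_
  obtain ⟨g, hg⟩ := Ideal.Quotient.mk_surjective (f j)
  have h1 : π (evq (f j)) = MvPolynomial.aeval (fun c : Coord α => π fun s => coords s.1 c) g := by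
    rw [← hg]
    exact MvPolynomial.comp_aeval_apply (fun (c : Coord α) (s : S) => coords s.1 c) π g
  rw [Function.comp_apply, h1]
  refine mem_closure_of_mem_adjoin ?_
  rw [← IntermediateField.mem_toSubalgebra]
  refine IntermediateField.algebra_adjoin_le_adjoin K X ?_
  rw [Algebra.adjoin_range_eq_range_aeval]
  exact ⟨g, rfl⟩

end KrullDim

/-! ### Derivations, transcendence degree and echelon forms -/

section FieldLemma

variable {K L : Type*} [Field K] [Field L] [Algebra K L]

open scoped IntermediateField.algebraAdjoinAdjoin in
theorem mem_closure_of_isAlgebraic_adjoin {X : Set L} {a : L}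
    (ha : IsAlgebraic (IntermediateField.adjoin K X) a) :
    a ∈ (AlgebraicIndependent.matroid K L).closure X := by
  rw [AlgebraicIndependent.matroid_closure_eq, SetLike.mem_coe, Subalgebra.mem_algebraicClosure]
  exact (IsFractionRing.isAlgebraic_iff (Algebra.adjoin K X) (IntermediateField.adjoin K X) L).2 ha

/-- A subspace of a coordinate space is cut out injectively by as many coordinates
as its dimension. -/
theorem exists_finset_card_le_finrank {ι : Type*} [Finite ι] (V : Submodule L (ι → L)) :
    ∃ σ : Finset ι, σ.card ≤ Module.finrank L V ∧ ∀ v ∈ V, (∀ i ∈ σ, v i = 0) → v = 0 := by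
  classical
  let φ : ι → Module.Dual L V := fun i => (LinearMap.proj i).comp V.subtype
  obtain ⟨κ, a, ha, hsp, hli⟩ := exists_linearIndependent' L φ
  have : Finite κ := Finite.of_injective a ha
  have := Fintype.ofFinite κ
  refine ⟨Finset.univ.image a, ?_, ?_⟩
  · rw [Finset.card_image_of_injective _ ha, Finset.card_univ]
    have := hli.fintype_card_le_finrank
    rwa [Subspace.dual_finrank_eq] at this
  · intro v hv h
    ext i
    have hi : φ i ∈ Submodule.span L (Set.range (φ ∘ a)) := by
      rw [hsp]; exact Submodule.subset_span ⟨i, rfl⟩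
    have : ∀ f ∈ Submodule.span L (Set.range (φ ∘ a)), f ⟨v, hv⟩ = 0 := by
      intro f hf
      induction hf using Submodule.span_induction with
      | mem f hf =>
        obtain ⟨k, rfl⟩ := hf
        exact h (a k) (Finset.mem_image_of_mem _ (Finset.mem_univ k))
      | zero => rfl
      | add f g _ _ hf hg => simp [hf, hg]
      | smul c f _ hf => simp [hf]
    exact this _ hi

/-- A finitely generated field extension without derivations is algebraic. -/
theorem isAlgebraic_of_derivation_eq_zero {F : Type*} {E : Type*} [Field F] [Field E] [Algebra F E]
    [Algebra.EssFiniteType F E] (h : ∀ D : Derivation F E E, D = 0) : Algebra.IsAlgebraic F E := by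
  -- Functionals on the Kähler module are derivations, so the module is zero. The extension is then
  -- unramified, hence separable algebraic.
  have hs : Subsingleton (Ω[E⁄F]) := by
    refine subsingleton_of_forall_eq 0 fun w => ?_
    rw [← Module.forall_dual_apply_eq_zero_iff E]
    intro φ
    have : φ = 0 := (KaehlerDifferential.linearMapEquivDerivation F E).injective
      ((h _).trans (map_zero _).symm)
    rw [this]; rfl
  have : Algebra.FormallyUnramified F E := ⟨hs⟩
  have := Algebra.FormallyUnramified.isSeparable F E
  infer_instance

/-- The tangent space bound: the transcendence degree of `K(X, x)` over `K(X)` is at most the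
dimension of any space that contains all the vectors `D x`, with `D` a derivation vanishing
on `X`. -/
theorem trRk_union_range_le {ι : Type*} [Finite ι] (X : Set L) (x : ι → L)
    (V : Submodule L (ι → L))
    (hV : ∀ (E : IntermediateField K L) (D : Derivation K E L), X ⊆ E →
      (∀ a : E, (a : L) ∈ X → D a = 0) → ∀ x' : ι → E, (∀ i, (x' i : L) = x i) →
        (fun i => D (x' i)) ∈ V) :
    trRk K (X ∪ Set.range x) ≤ trRk K X + Module.finrank L V := by
  classical
  -- Only the coordinates in `σ`, at most `finrank V` of them, are adjoined to `X`. A derivation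
  -- killing these and `X` has its values on `x` in `V` with zero `σ`-coordinates, so it kills `x`;
  -- hence `x` is algebraic over what was adjoined.
  obtain ⟨σ, hσ, hσV⟩ := exists_finset_card_le_finrank V
  set X' := X ∪ x '' σ
  let E₀ := IntermediateField.adjoin K X'
  let E := IntermediateField.adjoin E₀ (Set.range x)
  have hx : ∀ i, x i ∈ E := fun i => IntermediateField.subset_adjoin _ _ ⟨i, rfl⟩
  have : Algebra.EssFiniteType E₀ E :=
    IntermediateField.essFiniteType_iff.2 (IntermediateField.fg_def.2 ⟨_, Set.finite_range x, rfl⟩)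
  have halg : Algebra.IsAlgebraic E₀ E := by
    refine isAlgebraic_of_derivation_eq_zero fun D => ?_
    have hD₀ : ∀ a : E, (a : L) ∈ E₀ → D a = 0 := fun a ha => D.map_algebraMap ⟨a, ha⟩
    have hDx : ∀ i, D ⟨x i, hx i⟩ = 0 := by
      have h1 := hV (E.restrictScalars K)
        (((Algebra.linearMap E L).compDer D).restrictScalars K)
        (fun a ha => E.algebraMap_mem
          ⟨a, IntermediateField.subset_adjoin _ _ (Set.mem_union_left _ ha)⟩)
        (fun a ha => by
          change algebraMap E L (D a) = 0
          rw [hD₀ a (IntermediateField.subset_adjoin _ _ (Set.mem_union_left _ ha)), map_zero])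
        (fun i => ⟨x i, hx i⟩) (fun i => rfl)
      have h2 := hσV _ h1 (fun i hi => by
        change algebraMap E L (D ⟨x i, hx i⟩) = 0
        rw [hD₀ _ (IntermediateField.subset_adjoin _ _
          (Set.mem_union_right _ (Set.mem_image_of_mem _ hi))), map_zero])
      intro i
      have h3 : algebraMap E L (D ⟨x i, hx i⟩) = 0 := congrFun h2 i
      exact (map_eq_zero _).1 h3
    ext ⟨a, ha⟩
    change (D ⟨a, ha⟩ : L) = 0
    rw [ZeroMemClass.coe_eq_zero]
    induction ha using IntermediateField.adjoin_induction with
    | mem a ha =>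
      obtain ⟨i, rfl⟩ := ha
      exact hDx i
    | algebraMap a => exact D.map_algebraMap a
    | add a b ha hb h1 h2 =>
      have := D.map_add ⟨a, ha⟩ ⟨b, hb⟩
      rw [h1, h2, add_zero] at this
      exact this
    | mul a b ha hb h1 h2 =>
      have := D.leibniz ⟨a, ha⟩ ⟨b, hb⟩
      rw [h1, h2, smul_zero, smul_zero, add_zero] at this
      exact this
    | inv a ha h1 =>
      have := D.leibniz_inv ⟨a, ha⟩
      rw [h1, smul_zero] at this
      exact this
  have hcl : X ∪ Set.range x ⊆ (AlgebraicIndependent.matroid K L).closure X' := by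
    rintro a (ha | ⟨i, rfl⟩)
    · exact mem_closure_of_mem_adjoin
        (IntermediateField.subset_adjoin _ _ (Set.mem_union_left _ ha))
    · refine mem_closure_of_isAlgebraic_adjoin ?_
      exact (halg.isAlgebraic ⟨x i, hx i⟩).algebraMap (A := L)
  calc trRk K (X ∪ Set.range x) ≤ trRk K X' := by
        refine ((AlgebraicIndependent.matroid K L).eRk_mono hcl).trans ?_
        rw [Matroid.eRk_closure_eq]
    _ ≤ trRk K X + (x '' σ).encard := Matroid.eRk_union_le_eRk_add_encard _ _ _
    _ ≤ trRk K X + Module.finrank L V := by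
        gcongr
        refine (Set.encard_image_le _ _).trans ?_
        rw [Set.encard_coe_eq_coe_finsetCard]
        exact_mod_cast hσ

/-- The entries which are not fixed by a choice of coordinates bound the transcendence degree. -/
theorem exists_mul_submatrix_eq_one {m : ℕ} {ι : Type*} [Fintype ι] [DecidableEq ι]
    (b : Fin m → ι → L) (hb : LinearIndependent L b) :
    ∃ (g h : Matrix (Fin m) (Fin m) L) (a : Fin m → ι), g * h = 1 ∧ h * g = 1 ∧
      Function.Injective a ∧
      ∀ i j, ∑ k, g i k * b k (a j) = if i = j then 1 else 0 := by
  let c : ι → Fin m → L := fun i k => b k i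
  obtain ⟨κ, a, ha, hsp, hli⟩ := exists_linearIndependent' L c
  have : Finite κ := Finite.of_injective a ha
  have := Fintype.ofFinite κ
  have hrank : Matrix.rank (Matrix.of b) = m := by
    rw [LinearIndependent.rank_matrix (M := Matrix.of b) hb, Fintype.card_fin]
  -- Column rank equals row rank, so a maximal independent set of columns has `m` members. Inverting
  -- that square block gives the echelon form.
  have hcard : Fintype.card κ = m := by
    have h1 := finrank_span_eq_card hli
    rw [hsp] at h1
    refine h1.symm.trans (Eq.trans ?_ hrank)
    rw [Matrix.rank_eq_finrank_span_cols]
    rfl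
  let e : Fin m ≃ κ := (Fintype.equivFinOfCardEq hcard).symm
  let h : Matrix (Fin m) (Fin m) L := Matrix.of fun k j => b k (a (e j))
  have hu : IsUnit h := by
    rw [← Matrix.isUnit_transpose, ← Matrix.linearIndependent_rows_iff_isUnit]
    exact hli.comp e e.injective
  obtain ⟨u, hu⟩ := hu
  refine ⟨(↑u⁻¹ : Matrix _ _ L), h, a ∘ e, ?_, ?_, ha.comp e.injective, ?_⟩
  · rw [← hu]; exact u.inv_mul
  · rw [← hu]; exact u.mul_inv
  · intro i j
    have : ((↑u⁻¹ : Matrix (Fin m) (Fin m) L) * h) i j =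
        (1 : Matrix (Fin m) (Fin m) L) i j := by
      rw [← hu]; exact congrFun (congrFun u.inv_mul i) j
    rw [Matrix.mul_apply, Matrix.one_apply] at this
    exact this

end FieldLemma

/-! ### The polarized moment map and trace duality -/

section Arrows

variable {I : Type u} [Quiver.{v} I]

/-- Families of vertex matrices. -/
abbrev VMat (L : Type w) (α β : I → ℕ) : Type (max u w) :=
  ∀ i : I, Matrix (Fin (α i)) (Fin (β i)) L

/-- Families of rectangular matrices attached to the arrows of the double quiver. -/
abbrev RArr (L : Type w) (α β : I → ℕ) : Type (max u v w) :=
  ∀ i j : I, DArrow i j → Matrix (Fin (α j)) (Fin (β i)) L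

/-- Coordinates on `RArr L α β`. -/
abbrev RCoord (α β : I → ℕ) : Type (max u v) :=
  Σ (i : I) (j : I) (_ : DArrow i j), Fin (α j) × Fin (β i)

/-- Coordinates on `VMat L α β`. -/
abbrev VCoord (α β : I → ℕ) : Type u := Σ i : I, Fin (α i) × Fin (β i)

/-- The entries of a family of arrow matrices. -/
def RArr.entries {L : Type w} {α β : I → ℕ} (x : RArr L α β) : RCoord α β → L :=
  fun c => x c.1 c.2.1 c.2.2.1 c.2.2.2.1 c.2.2.2.2

/-- The entries of a family of vertex matrices. -/
def VMat.entries {L : Type w} {α β : I → ℕ} (X : VMat L α β) : VCoord α β → L :=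
  fun c => X c.1 c.2.1 c.2.2

variable (L : Type w) [Field L]

/-- Taking entries is a linear equivalence. -/
def RArr.entriesEquiv (α β : I → ℕ) : RArr L α β ≃ₗ[L] (RCoord α β → L) where
  toFun := RArr.entries
  invFun f := fun i j e => Matrix.of fun a b => f ⟨i, j, e, a, b⟩
  map_add' _ _ := rfl
  map_smul' _ _ := rfl
  left_inv _ := rfl
  right_inv _ := rfl

/-- Taking entries is a linear equivalence. -/
def VMat.entriesEquiv (α β : I → ℕ) : VMat L α β ≃ₗ[L] (VCoord α β → L) where
  toFun := VMat.entries
  invFun f := fun i => Matrix.of fun a b => f ⟨i, a, b⟩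
  map_add' _ _ := rfl
  map_smul' _ _ := rfl
  left_inv _ := rfl
  right_inv _ := rfl

variable {L} {α β γ δ : I → ℕ}

/-- `X` is a homomorphism of representations from `M` to `S`. -/
def IsHom (M : DRep L α) (S : DRep L β) (X : VMat L β α) : Prop :=
  ∀ (i j : I) (e : DArrow i j), X j * M i j e = S i j e * X i

/-- The map whose kernel is the space of homomorphisms from `M` to `S`. -/
def homDefect (M : DRep L α) (S : DRep L β) : VMat L β α →ₗ[L] RArr L β α where
  toFun X := fun i j e => X j * M i j e - S i j e * X i
  map_add' X Y := by
    funext i j e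
    simp only [Pi.add_apply, Matrix.add_mul, Matrix.mul_add]
    abel
  map_smul' c X := by
    funext i j e
    simp only [Pi.smul_apply, Matrix.smul_mul, Matrix.mul_smul, RingHom.id_apply, smul_sub]

/-- The space of homomorphisms from `M` to `S`. -/
def homSpace (M : DRep L α) (S : DRep L β) : Submodule L (VMat L β α) :=
  LinearMap.ker (homDefect M S)

theorem mem_homSpace {M : DRep L α} {S : DRep L β} {X : VMat L β α} :
    X ∈ homSpace M S ↔ IsHom M S X := by
  simp only [homSpace, LinearMap.mem_ker, homDefect, LinearMap.coe_mk, AddHom.coe_mk, funext_iff,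
    Pi.zero_apply, sub_eq_zero, IsHom]

variable [Fintype I] [∀ i j : I, Fintype (i ⟶ j)]

/-- The polarized moment map. -/
def bimoment {R : Type w} [CommRing R] (x : RArr R α γ) (y : RArr R γ β) : VMat R α β := fun i =>
  ∑ j, ∑ e : (j ⟶ i), x j i (Sum.inl e) * y i j (Sum.inr e) -
    ∑ j, ∑ e : (i ⟶ j), x j i (Sum.inr e) * y i j (Sum.inl e)

theorem moment_eq_bimoment (x : DRep L α) (i : I) : moment x i = bimoment x x i := rfl

theorem bimoment_add_left (x x' : RArr L α γ) (y : RArr L γ β) :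
    bimoment (x + x') y = bimoment x y + bimoment x' y := by
  funext i
  simp only [bimoment, Pi.add_apply, Matrix.add_mul, Finset.sum_add_distrib]
  abel

theorem bimoment_add_right (x : RArr L α γ) (y y' : RArr L γ β) :
    bimoment x (y + y') = bimoment x y + bimoment x y' := by
  funext i
  simp only [bimoment, Pi.add_apply, Matrix.mul_add, Finset.sum_add_distrib]
  abel

theorem bimoment_smul_left (c : L) (x : RArr L α γ) (y : RArr L γ β) :
    bimoment (c • x) y = c • bimoment x y := by
  funext i
  simp only [bimoment, Pi.smul_apply, Matrix.smul_mul, ← Finset.smul_sum, smul_sub]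

theorem bimoment_smul_right (c : L) (x : RArr L α γ) (y : RArr L γ β) :
    bimoment x (c • y) = c • bimoment x y := by
  funext i
  simp only [bimoment, Pi.smul_apply, Matrix.mul_smul, ← Finset.smul_sum, smul_sub]

theorem bimoment_mul_left (X : VMat L δ α) (x : RArr L α γ) (y : RArr L γ β) (i : I) :
    bimoment (fun i j e => X j * x i j e) y i = X i * bimoment x y i := by
  simp only [bimoment, Matrix.mul_sub, Matrix.mul_sum, Matrix.mul_assoc]

theorem bimoment_mul_right (x : RArr L α γ) (y : RArr L γ β) (Y : VMat L β δ) (i : I) :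
    bimoment x (fun i j e => y i j e * Y i) i = bimoment x y i * Y i := by
  simp only [bimoment, Matrix.sub_mul, Matrix.sum_mul, Matrix.mul_assoc]

theorem bimoment_mul_middle (x : RArr L α γ) (X : VMat L γ δ) (y : RArr L δ β) :
    bimoment (fun i j e => x i j e * X i) y = bimoment x (fun i j e => X j * y i j e) := by
  funext i
  simp only [bimoment, Matrix.mul_assoc]

theorem bimoment_sub_left (x x' : RArr L α γ) (y : RArr L γ β) :
    bimoment (x - x') y = bimoment x y - bimoment x' y := by
  have := bimoment_add_left (x - x') x' y
  rw [sub_add_cancel] at this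
  rw [this, add_sub_cancel_right]

theorem bimoment_sub_right (x : RArr L α γ) (y y' : RArr L γ β) :
    bimoment x (y - y') = bimoment x y - bimoment x y' := by
  have := bimoment_add_right x (y - y') y'
  rw [sub_add_cancel] at this
  rw [this, add_sub_cancel_right]

/-- The derivative of the moment map at `N ⊕ S`, in the direction of extensions of `S` by `N`. -/
def dMoment (N : DRep L α) (S : DRep L β) : RArr L α β →ₗ[L] VMat L α β where
  toFun ζ := bimoment N ζ + bimoment ζ S
  map_add' x y := by
    rw [bimoment_add_left, bimoment_add_right]; abel
  map_smul' c x := by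
    rw [bimoment_smul_left, bimoment_smul_right, RingHom.id_apply, smul_add]

/-- The trace of the polarized moment map. -/
def trMoment (x : RArr L α β) (y : RArr L β α) : L := ∑ i, (bimoment x y i).trace

/-- Cyclicity of the trace exchanges the two sums in the moment map: this is the skew symmetry of
the symplectic form on the double. -/
theorem trMoment_comm (x : RArr L α β) (y : RArr L β α) : trMoment x y = - trMoment y x := by
  simp only [trMoment, bimoment, Matrix.trace_sub, Matrix.trace_sum, Finset.sum_sub_distrib,
    neg_sub]
  congr 1
  · rw [Finset.sum_comm]
    exact Finset.sum_congr rfl fun i _ => Finset.sum_congr rfl fun j _ =>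
      Finset.sum_congr rfl fun e _ => Matrix.trace_mul_comm _ _
  · rw [Finset.sum_comm]
    exact Finset.sum_congr rfl fun i _ => Finset.sum_congr rfl fun j _ =>
      Finset.sum_congr rfl fun e _ => Matrix.trace_mul_comm _ _

/-- `homDefect N S` is the transpose of `dMoment N S` for the trace pairings on vertices and arrows.
As the pairings are nondegenerate, the cokernel of `dMoment N S` is dual to the homomorphisms from
`N` to `S`. -/
theorem sum_trace_mul_dMoment (N : DRep L α) (S : DRep L β) (Y : VMat L β α) (ζ : RArr L α β) :
    ∑ i, (Y i * dMoment N S ζ i).trace = trMoment (homDefect N S Y) ζ := by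
  have h1 : homDefect N S Y = (fun i j e => Y j * N i j e) - (fun i j e => S i j e * Y i) := rfl
  have h2 : trMoment (fun i j e => S i j e * Y i) ζ =
      - ∑ i, (Y i * bimoment ζ S i).trace := by
    rw [trMoment, bimoment_mul_middle]
    change trMoment S (fun i j e => Y j * ζ i j e) = _
    rw [trMoment_comm]
    simp only [trMoment, bimoment_mul_left]
  have h3 : trMoment (fun i j e => Y j * N i j e) ζ = ∑ i, (Y i * bimoment N ζ i).trace := by
    simp only [trMoment, bimoment_mul_left]
  have h4 : trMoment (homDefect N S Y) ζ = trMoment (fun i j e => Y j * N i j e) ζ -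
      trMoment (fun i j e => S i j e * Y i) ζ := by
    rw [h1]
    simp only [trMoment, bimoment_sub_left, Pi.sub_apply, Matrix.trace_sub, Finset.sum_sub_distrib]
  rw [h4, h2, h3, sub_neg_eq_add, ← Finset.sum_add_distrib]
  refine Finset.sum_congr rfl fun i _ => ?_
  change (Y i * (bimoment N ζ i + bimoment ζ S i)).trace = _
  rw [Matrix.mul_add, Matrix.trace_add]

/-- A single matrix unit placed on the reverse of `e` reads off one entry of `x`, up to sign. -/
theorem eq_zero_of_trMoment_eq_zero (x : RArr L α β) (h : ∀ y, trMoment x y = 0) : x = 0 := by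
  classical
  funext i j e
  ext a b
  let A : Matrix (Fin (β i)) (Fin (α j)) L := Matrix.single b a 1
  let y : RArr L β α := Pi.single j (Pi.single i (Pi.single e.swap A))
  have hy1 : ∀ i', i' ≠ j → y i' = 0 := fun i' h' => Pi.single_eq_of_ne h' _
  have hy2 : ∀ j', j' ≠ i → y j j' = 0 := fun j' h' => by
    simp only [y, Pi.single_eq_same]; exact Pi.single_eq_of_ne h' _
  have hy3 : y j i = Pi.single e.swap A := by simp only [y, Pi.single_eq_same]
  have h1 := h y
  have hA : (x i j e * A).trace = x i j e a b := by simp [A, Matrix.trace_mul_single]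
  rw [trMoment, Finset.sum_eq_single j (fun i' _ h' => by simp [bimoment, hy1 i' h'])
    (fun h' => absurd (Finset.mem_univ j) h')] at h1
  have h2 : bimoment x y j = ∑ e : (i ⟶ j), x i j (Sum.inl e) * y j i (Sum.inr e) -
      ∑ e : (j ⟶ i), x i j (Sum.inr e) * y j i (Sum.inl e) := by
    rw [bimoment, Finset.sum_eq_single i (fun j' _ h' => by simp [hy2 j' h'])
      (fun h' => absurd (Finset.mem_univ i) h'),
      Finset.sum_eq_single i (fun j' _ h' => by simp [hy2 j' h'])
      (fun h' => absurd (Finset.mem_univ i) h')]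
  rw [h2, hy3] at h1
  rcases e with e | e
  · rw [Finset.sum_eq_single e (fun e' _ h' => by simp [h'])
      (fun h' => absurd (Finset.mem_univ e) h')] at h1
    simpa [hA] using h1
  · rw [Finset.sum_eq_single (a := e) (f := fun e' : (j ⟶ i) => x i j (Sum.inr e') * _)
      (fun e' _ h' => by simp [h']) (fun h' => absurd (Finset.mem_univ e) h')] at h1
    simpa [hA] using h1

/-- The number of coordinates of `RArr L α β`. -/
def arrDim (α β : I → ℕ) : ℕ := ∑ i, ∑ j, ∑ _e : DArrow i j, α j * β i

/-- The number of coordinates of `VMat L α β`. -/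
def vertDim (α β : I → ℕ) : ℕ := ∑ i, α i * β i

theorem finrank_rArr : Module.finrank L (RArr L α β) = arrDim α β := by
  simp only [Module.finrank_pi_fintype, Module.finrank_matrix, Fintype.card_fin,
    Module.finrank_self, mul_one, arrDim]

theorem finrank_vMat : Module.finrank L (VMat L α β) = vertDim α β := by
  simp only [Module.finrank_pi_fintype, Module.finrank_matrix, Fintype.card_fin,
    Module.finrank_self, mul_one, vertDim]

theorem vertDim_comm : vertDim α β = vertDim β α := by
  simp only [vertDim, mul_comm]

/-- The space of extensions cocycles is small, by trace duality. -/
theorem finrank_ker_dMoment_add_le (N : DRep L α) (S : DRep L β) :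
    Module.finrank L (LinearMap.ker (dMoment N S)) + vertDim α β ≤
      arrDim α β + Module.finrank L (homSpace N S) := by
  let PW : VMat L β α →ₗ[L] Module.Dual L (VMat L α β) := LinearMap.mk₂ L
    (fun Y w => ∑ i, (Y i * w i).trace)
    (fun _ _ _ => by simp [Matrix.add_mul, Finset.sum_add_distrib])
    (fun _ _ _ => by simp [Finset.mul_sum])
    (fun _ _ _ => by simp [Matrix.mul_add, Finset.sum_add_distrib])
    (fun _ _ _ => by simp [Finset.mul_sum])
  let PV : RArr L β α →ₗ[L] Module.Dual L (RArr L α β) := LinearMap.mk₂ L trMoment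
    (fun _ _ _ => by simp [trMoment, bimoment_add_left, Finset.sum_add_distrib])
    (fun _ _ _ => by simp [trMoment, bimoment_smul_left, Finset.mul_sum])
    (fun _ _ _ => by simp [trMoment, bimoment_add_right, Finset.sum_add_distrib])
    (fun _ _ _ => by simp [trMoment, bimoment_smul_right, Finset.mul_sum])
  have hPV : Function.Injective PV := by
    rw [injective_iff_map_eq_zero]
    intro x hx
    exact eq_zero_of_trMoment_eq_zero x fun y => LinearMap.congr_fun hx y
  -- Injectivity of `PV` is enough: it makes the rank of `homDefect` at most that of `dMoment`, and
  -- rank-nullity converts this to kernels.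
  have hcomp : (dMoment N S).dualMap.comp PW = PV.comp (homDefect N S) := by
    ext1 Y
    ext1 ζ
    exact sum_trace_mul_dMoment N S Y ζ
  have h1 : Module.finrank L (LinearMap.range (homDefect N S)) ≤
      Module.finrank L (LinearMap.range (dMoment N S)) := by
    have h2 : LinearMap.range ((dMoment N S).dualMap.comp PW) =
        (LinearMap.range (homDefect N S)).map PV := by
      rw [hcomp, LinearMap.range_comp]
    rw [← LinearMap.finrank_range_dualMap_eq_finrank_range (dMoment N S),
      (Submodule.equivMapOfInjective PV hPV _).finrank_eq, ← h2]
    exact Submodule.finrank_mono (LinearMap.range_comp_le_range _ _)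
  have h3 := LinearMap.finrank_range_add_finrank_ker (homDefect N S)
  have h4 := LinearMap.finrank_range_add_finrank_ker (dMoment N S)
  rw [finrank_vMat, vertDim_comm] at h3
  rw [finrank_rArr] at h4
  change _ + Module.finrank L (homSpace N S) = _ at h3
  omega

end Arrows

/-! ### Numerical identities for the quadratic form -/

section Numerics

variable {I : Type u} [Fintype I] [Quiver.{v} I] [∀ i j : I, Fintype (i ⟶ j)]

theorem arrDim_eq (α β : I → ℕ) :
    arrDim α β = ∑ i, ∑ j, ∑ _e : (i ⟶ j), (α j * β i + α i * β j) := by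
  have h : ∀ i j : I, ∑ _e : DArrow i j, α j * β i =
      ∑ _e : (i ⟶ j), α j * β i + ∑ _e : (j ⟶ i), α j * β i := fun i j =>
    Fintype.sum_sum_type _
  simp only [arrDim, h, Finset.sum_add_distrib]
  congr 1
  rw [Finset.sum_comm]

theorem arrDim_comm (α β : I → ℕ) : arrDim α β = arrDim β α := by
  rw [arrDim_eq, arrDim_eq]
  refine Finset.sum_congr rfl fun i _ => Finset.sum_congr rfl fun j _ =>
    Finset.sum_congr rfl fun e _ => by ring

theorem arrDim_add_left (α α' β : I → ℕ) :
    arrDim (fun i => α i + α' i) β = arrDim α β + arrDim α' β := by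
  simp only [arrDim, add_mul, Finset.sum_add_distrib]

theorem arrDim_mul_left (m : ℕ) (α β : I → ℕ) :
    arrDim (fun i => m * α i) β = m * arrDim α β := by
  simp only [arrDim, mul_assoc, Finset.mul_sum]

theorem arrDim_add_mul (m : ℕ) (α β : I → ℕ) :
    arrDim (fun i => α i + m * β i) (fun i => α i + m * β i) =
      arrDim α α + 2 * m * arrDim α β + m ^ 2 * arrDim β β := by
  rw [arrDim_add_left, arrDim_mul_left, arrDim_comm α, arrDim_comm β, arrDim_add_left,
    arrDim_add_left, arrDim_mul_left, arrDim_mul_left, arrDim_comm β α]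
  ring

/-- `arrDim` runs over the double, so each arrow of the quiver counts twice. Later counts bound `2 *
d` to avoid division. -/
theorem two_mul_dotSelf_sub_q (α : I → ℕ) :
    2 * (dotSelf α - q fun i => (α i : ℤ)) = arrDim α α := by
  rw [arrDim_eq, dotSelf, q]
  push_cast
  have : ∀ i j : I, ∑ _e : (i ⟶ j), ((α j : ℤ) * α i + α i * α j) =
      2 * ∑ _e : (i ⟶ j), (α j : ℤ) * α i := by
    intro i j
    rw [Finset.mul_sum]
    exact Finset.sum_congr rfl fun e _ => by ring
  simp only [this, ← Finset.mul_sum, ← sq]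
  ring

theorem dotSelf_eq_vertDim (α : I → ℕ) : dotSelf α = vertDim α α := by
  simp [dotSelf, vertDim]

theorem two_mul_p (α : I → ℕ) : 2 * p α = arrDim α α - 2 * vertDim α α + 2 := by
  rw [← two_mul_dotSelf_sub_q, ← dotSelf_eq_vertDim, p]
  ring

end Numerics

/-! ### Layers: extensions of a power of one representation -/

section Layers

variable {I : Type u} [Quiver.{v} I] {L : Type w} [Field L]

/-- An exact sequence `0 → N → M → S ^ m → 0` of representations, split on the vertices,
in which the components of `M → S ^ m` span the space of all homomorphisms from `M` to `S`. -/
structure Layer {α α' β : I → ℕ} (S : DRep L β) (m : ℕ) (M : DRep L α) (N : DRep L α') where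
  proj : Fin m → VMat L β α
  incl : VMat L α α'
  retr : VMat L α' α
  sect : Fin m → VMat L α β
  dim_eq : ∀ i, α i = α' i + m * β i
  retr_incl : ∀ i, retr i * incl i = 1
  proj_incl : ∀ k i, proj k i * incl i = 0
  retr_sect : ∀ k i, retr i * sect k i = 0
  proj_sect : ∀ k l i, proj k i * sect l i = if k = l then 1 else 0
  sum_eq : ∀ i, incl i * retr i + ∑ k, sect k i * proj k i = 1
  incl_hom : IsHom N M incl
  proj_hom : ∀ k, IsHom M S (proj k)
  full : ∀ X, IsHom M S X → ∃ c : Fin m → L, X = ∑ k, c k • proj k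

/-- `M` has a filtration with successive quotients `(S t) ^ m`, from the top down, for the
entries `(t, m)` of the list, in which each step splits off all homomorphisms to `S t`. -/
def TopFilt {r : ℕ} {β : Fin r → I → ℕ} (S : ∀ t, DRep L (β t)) :
    List (Fin r × ℕ) → ∀ α : I → ℕ, DRep L α → Prop
  | [], α, _ => ∀ i, α i = 0
  | (t, m) :: l, _, M => 0 < m ∧ ∃ (α' : I → ℕ) (N : DRep L α'),
      TopFilt S l α' N ∧ Nonempty (Layer (S t) m M N)

variable {α α' β : I → ℕ}

theorem IsHom.comp {γ : I → ℕ} {M : DRep L α} {N : DRep L β} {P : DRep L γ} {X : VMat L β α}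
    {Y : VMat L γ β} (hY : IsHom N P Y) (hX : IsHom M N X) :
    IsHom M P (fun i => Y i * X i) := by
  intro i j e
  rw [Matrix.mul_assoc, hX, ← Matrix.mul_assoc, hY, Matrix.mul_assoc]

namespace Layer

variable {S : DRep L β} {m : ℕ} {M : DRep L α} {N : DRep L α'} (Y : Layer S m M N)

/-- The component `S → N` of `M` along an arrow, on the `k`-th copy of `S`. -/
def cocycle (k : Fin m) : RArr L α' β := fun i j e => Y.retr j * M i j e * Y.sect k i

theorem retr_mul (i j : I) (e : DArrow i j) :
    Y.retr j * M i j e = N i j e * Y.retr i + ∑ k, Y.cocycle k i j e * Y.proj k i := by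
  calc Y.retr j * M i j e = Y.retr j * M i j e * (Y.incl i * Y.retr i +
        ∑ k, Y.sect k i * Y.proj k i) := by rw [Y.sum_eq, Matrix.mul_one]
    _ = Y.retr j * (M i j e * Y.incl i) * Y.retr i + ∑ k, Y.cocycle k i j e * Y.proj k i := by
        simp only [cocycle, Matrix.mul_add, Matrix.mul_sum, Matrix.mul_assoc]
    _ = _ := by
        rw [← Y.incl_hom, ← Matrix.mul_assoc, Y.retr_incl, Matrix.one_mul]

theorem mul_sect (i j : I) (e : DArrow i j) (k : Fin m) :
    M i j e * Y.sect k i = Y.incl j * Y.cocycle k i j e + Y.sect k j * S i j e := by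
  calc M i j e * Y.sect k i = (Y.incl j * Y.retr j + ∑ l, Y.sect l j * Y.proj l j) *
        (M i j e * Y.sect k i) := by rw [Y.sum_eq, Matrix.one_mul]
    _ = Y.incl j * Y.cocycle k i j e + ∑ l, Y.sect l j * (Y.proj l j * M i j e * Y.sect k i) := by
        simp only [cocycle, Matrix.add_mul, Matrix.sum_mul, Matrix.mul_assoc]
    _ = _ := by
        congr 1
        rw [Finset.sum_eq_single k]
        · rw [Y.proj_hom, Matrix.mul_assoc (S i j e), Y.proj_sect, if_pos rfl, Matrix.mul_one]
        · intro l _ hl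
          rw [Y.proj_hom, Matrix.mul_assoc (S i j e), Y.proj_sect, if_neg hl, Matrix.mul_zero,
            Matrix.mul_zero]
        · intro h; exact absurd (Finset.mem_univ k) h

/-- In the vertex splitting `M` is block triangular with diagonal blocks `N` and copies of `S`. So
`M` is polynomial in the splitting, `N`, `S` and the cocycles, and only these have to be counted. -/
theorem eq_sum (i j : I) (e : DArrow i j) :
    M i j e = Y.incl j * N i j e * Y.retr i +
      ∑ k, (Y.incl j * Y.cocycle k i j e + Y.sect k j * S i j e) * Y.proj k i := by
  calc M i j e = M i j e * (Y.incl i * Y.retr i + ∑ k, Y.sect k i * Y.proj k i) := by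
        rw [Y.sum_eq, Matrix.mul_one]
    _ = _ := by
        simp only [Matrix.mul_add, Matrix.mul_sum, ← Matrix.mul_assoc, Y.mul_sect]
        rw [← Y.incl_hom]

theorem eq_zero_of_mul_incl_of_mul_sect {γ : I → ℕ} {X : VMat L γ α} {i : I}
    (h1 : X i * Y.incl i = 0) (h2 : ∀ k, X i * Y.sect k i = 0) : X i = 0 := by
  calc X i = X i * (Y.incl i * Y.retr i + ∑ k, Y.sect k i * Y.proj k i) := by
        rw [Y.sum_eq, Matrix.mul_one]
    _ = 0 := by
        simp only [Matrix.mul_add, Matrix.mul_sum, ← Matrix.mul_assoc, h1, h2, Matrix.zero_mul,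
          Finset.sum_const_zero, add_zero]

/-- A homomorphism vanishing on `N` induces homomorphisms on the copies of `S`. -/
theorem isHom_mul_sect {γ : I → ℕ} {P : DRep L γ} {X : VMat L γ α} (hX : IsHom M P X)
    (h0 : ∀ i, X i * Y.incl i = 0) (k : Fin m) : IsHom S P (fun i => X i * Y.sect k i) := by
  intro i j e
  rw [← Matrix.mul_assoc, ← hX, Matrix.mul_assoc _ (M i j e), Y.mul_sect, Matrix.mul_add,
    ← Matrix.mul_assoc, h0, Matrix.zero_mul, zero_add, Matrix.mul_assoc]

section

variable [Fintype I] [∀ i j : I, Fintype (i ⟶ j)]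

theorem moment_sub (Y : Layer S m M N) (hM : ∀ i, moment M i = 0) (i : I) : moment N i = 0 := by
  have h : (fun i j e => Y.incl j * N i j e : RArr L α α') = fun i j e => M i j e * Y.incl i := by
    funext i j e; exact Y.incl_hom i j e
  have h1 : Y.incl i * moment N i = 0 := by
    rw [moment_eq_bimoment, ← bimoment_mul_left, h, bimoment_mul_middle, h, bimoment_mul_right,
      ← moment_eq_bimoment, hM, Matrix.zero_mul]
  calc moment N i = Y.retr i * Y.incl i * moment N i := by rw [Y.retr_incl, Matrix.one_mul]
    _ = 0 := by rw [Matrix.mul_assoc, h1, Matrix.mul_zero]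

/-- This is the off-diagonal block of `moment M = 0`, picked out by `retr` on the left and `sect` on
the right. -/
theorem dMoment_cocycle (hM : ∀ i, moment M i = 0) (k : Fin m) :
    dMoment N S (Y.cocycle k) = 0 := by
  have h : (fun i j e => M i j e * Y.sect k i : RArr L α β) =
      (fun i j e => Y.incl j * Y.cocycle k i j e) + fun i j e => Y.sect k j * S i j e := by
    funext i j e; exact Y.mul_sect i j e k
  have h' : (fun i j e => Y.incl j * N i j e : RArr L α α') = fun i j e => M i j e * Y.incl i := by
    funext i j e; exact Y.incl_hom i j e
  funext i
  have h2 : bimoment M (fun i j e => M i j e * Y.sect k i) i = 0 := by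
    rw [bimoment_mul_right, ← moment_eq_bimoment, hM, Matrix.zero_mul]
  rw [h, bimoment_add_right, ← bimoment_mul_middle, ← bimoment_mul_middle, ← h', h,
    bimoment_add_left, Pi.add_apply, Pi.add_apply, bimoment_mul_left, bimoment_mul_left,
    bimoment_mul_left, ← moment_eq_bimoment] at h2
  have h3 := congrArg (fun A => Y.retr i * A) h2
  simp only [Matrix.mul_add, ← Matrix.mul_assoc, Y.retr_incl, Y.retr_sect, Matrix.one_mul,
    Matrix.zero_mul, add_zero, Matrix.mul_zero] at h3
  exact h3

end

end Layer

end Layers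

/-! ### Orthogonal bricks, rigidity and homomorphisms to the top -/

section Bricks

variable {I : Type u} [Fintype I] [Quiver.{v} I] [∀ i j : I, Fintype (i ⟶ j)]
variable {L : Type w} [Field L]

/-- A family of pairwise orthogonal bricks that satisfy the preprojective relations. -/
structure OrthBricks {r : ℕ} {β : Fin r → I → ℕ} (S : ∀ t, DRep L (β t)) : Prop where
  moment_eq : ∀ t i, moment (S t) i = 0
  ne_zero : ∀ t, ∃ i, 0 < β t i
  hom_ne : ∀ s t, s ≠ t → ∀ X, IsHom (S s) (S t) X → X = 0
  hom_self : ∀ t X, IsHom (S t) (S t) X → ∃ c : L, X = fun _ => c • 1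

namespace OrthBricks

variable {r : ℕ} {β : Fin r → I → ℕ} {S : ∀ t, DRep L (β t)}

theorem finrank_homSpace_self_le (hS : OrthBricks S) (t : Fin r) :
    Module.finrank L (homSpace (S t) (S t)) ≤ 1 := by
  refine finrank_le_one (R := L)
    (⟨fun _ => 1, mem_homSpace.2 fun i j e => by rw [Matrix.one_mul, Matrix.mul_one]⟩) ?_
  rintro ⟨X, hX⟩
  obtain ⟨c, rfl⟩ := hS.hom_self t X (mem_homSpace.1 hX)
  exact ⟨c, rfl⟩

/-- Trace duality, with only scalar endomorphisms. In the bound, `dotSelf - 1` accounts for the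
orbit and `2 * p` for self-extensions. -/
theorem finrank_ker_dMoment_le (hS : OrthBricks S) (t : Fin r) :
    (Module.finrank L (LinearMap.ker (dMoment (S t) (S t))) : ℤ) ≤
      2 * p (β t) + dotSelf (β t) - 1 := by
  have h1 := finrank_ker_dMoment_add_le (S t) (S t)
  have h2 := hS.finrank_homSpace_self_le t
  have h3 := two_mul_p (β t)
  rw [dotSelf_eq_vertDim]
  omega

/-- Infinitesimal conjugation by `W` moves `S t` along its orbit, which stays in the zero fibre. -/
theorem dMoment_homDefect (hS : OrthBricks S) (t : Fin r) (W : VMat L (β t) (β t)) :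
    dMoment (S t) (S t) (homDefect (S t) (S t) W) = 0 := by
  have h1 : homDefect (S t) (S t) W =
      (fun i j e => W j * S t i j e) - (fun i j e => S t i j e * W i) := rfl
  funext i
  change bimoment (S t) (homDefect (S t) (S t) W) i +
    bimoment (homDefect (S t) (S t) W) (S t) i = 0
  rw [h1, bimoment_sub_left, bimoment_sub_right, Pi.sub_apply, Pi.sub_apply, bimoment_mul_left,
    bimoment_mul_right, bimoment_mul_middle, ← moment_eq_bimoment, hS.moment_eq]
  simp

theorem vertDim_le (hS : OrthBricks S) (t : Fin r) : (vertDim (β t) (β t) : ℤ) - 1 ≤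
      Module.finrank L (LinearMap.range (homDefect (S t) (S t))) := by
  have h1 := LinearMap.finrank_range_add_finrank_ker (homDefect (S t) (S t))
  have h2 := hS.finrank_homSpace_self_le t
  rw [finrank_vMat] at h1
  change _ + Module.finrank L (homSpace (S t) (S t)) = _ at h1
  omega

theorem range_le (hS : OrthBricks S) (t : Fin r) :
    LinearMap.range (homDefect (S t) (S t)) ≤ LinearMap.ker (dMoment (S t) (S t)) := by
  rintro _ ⟨W, rfl⟩
  exact hS.dMoment_homDefect t W

/-- The tangent space of the orbit has dimension at least `vertDim - 1` and lies in a kernel of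
dimension at most `2 * p + vertDim - 1`. -/
theorem p_nonneg (hS : OrthBricks S) (t : Fin r) : 0 ≤ p (β t) := by
  have h1 := hS.vertDim_le t
  have h2 := Submodule.finrank_mono (hS.range_le t)
  have h3 := hS.finrank_ker_dMoment_le t
  rw [dotSelf_eq_vertDim] at h3
  omega

/-- For `p = 0` the two bounds meet, so every self-extension cocycle is a coboundary: the brick is
rigid. -/
theorem range_eq_of_p_eq_zero (hS : OrthBricks S) (t : Fin r) (hp : p (β t) = 0) :
    LinearMap.range (homDefect (S t) (S t)) = LinearMap.ker (dMoment (S t) (S t)) := by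
  refine Submodule.eq_of_le_of_finrank_le (hS.range_le t) ?_
  have h1 := hS.vertDim_le t
  have h3 := hS.finrank_ker_dMoment_le t
  rw [dotSelf_eq_vertDim] at h3
  omega

/-- A rigid brick splits off completely in one step of a filtration. -/
theorem finrank_homSpace_eq_zero (hS : OrthBricks S) {α α' : I → ℕ} {t : Fin r}
    (hp : p (β t) = 0) {m : ℕ}
    {M : DRep L α} {N : DRep L α'} (Y : Layer (S t) m M N) (hM : ∀ i, moment M i = 0) :
    Module.finrank L (homSpace N (S t)) = 0 := by
  rw [Submodule.finrank_eq_zero, Submodule.eq_bot_iff]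
  intro X hX
  rw [mem_homSpace] at hX
  have hker : ∀ k, (fun i j e => X j * Y.cocycle k i j e : RArr L (β t) (β t)) ∈
      LinearMap.range (homDefect (S t) (S t)) := by
    intro k
    rw [hS.range_eq_of_p_eq_zero t hp, LinearMap.mem_ker]
    have hXe : (fun i j e => X j * N i j e : RArr L (β t) α') = fun i j e => S t i j e * X i := by
      funext i j e; exact hX i j e
    have h1 := Y.dMoment_cocycle hM k
    funext i
    have h2 : bimoment N (Y.cocycle k) i + bimoment (Y.cocycle k) (S t) i = 0 := congrFun h1 i
    change bimoment (S t) (fun i j e => X j * Y.cocycle k i j e) i +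
      bimoment (fun i j e => X j * Y.cocycle k i j e) (S t) i = 0
    rw [← bimoment_mul_middle, ← hXe, bimoment_mul_left, bimoment_mul_left, ← Matrix.mul_add, h2,
      Matrix.mul_zero]
  choose W hW using hker
  -- The cocycles pushed forward along `X` are self-extensions of `S t`, hence coboundaries of the
  -- `W k`. Correcting by these extends `X` from `N` to `M`, while by `full` every homomorphism from
  -- `M` vanishes on `N`.
  let X' : VMat L (β t) α := fun i => X i * Y.retr i - ∑ k, W k i * Y.proj k i
  have hX' : IsHom M (S t) X' := by
    intro i j e
    have hWk : ∀ k, X j * Y.cocycle k i j e = W k j * S t i j e - S t i j e * W k i := fun k =>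
      (congrFun (congrFun (congrFun (hW k) i) j) e).symm
    simp only [X', Matrix.sub_mul, Matrix.mul_sub, Matrix.sum_mul, Matrix.mul_sum]
    rw [Matrix.mul_assoc, Y.retr_mul, Matrix.mul_add, ← Matrix.mul_assoc, hX, Matrix.mul_sum]
    simp only [← Matrix.mul_assoc, hWk, Matrix.sub_mul, Finset.sum_sub_distrib]
    have hp : ∀ k, W k j * Y.proj k j * M i j e = W k j * S t i j e * Y.proj k i := fun k => by
      rw [Matrix.mul_assoc, Y.proj_hom, ← Matrix.mul_assoc]
    simp only [hp]
    abel
  obtain ⟨c, hc⟩ := Y.full X' hX'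
  funext i
  have h1 : X' i * Y.incl i = X i := by
    simp only [X', Matrix.sub_mul, Matrix.mul_assoc, Matrix.sum_mul, Y.retr_incl, Y.proj_incl,
      Matrix.mul_zero, Finset.sum_const_zero, sub_zero, Matrix.mul_one]
  rw [← h1, hc]
  simp [Finset.sum_apply, Matrix.sum_mul, Y.proj_incl]

end OrthBricks

/-- The multiplicity of the first entry with index `t`, or zero. -/
def firstMult {r : ℕ} (t : Fin r) : List (Fin r × ℕ) → ℕ
  | [] => 0
  | (s, m) :: l => if s = t then m else firstMult t l

/-- If the top layer belongs to `t`, the bound is fullness of the layer. If it belongs to another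
brick, restriction to `N` is injective by orthogonality, and the tail decides. -/
theorem TopFilt.finrank_homSpace_le {r : ℕ} {β : Fin r → I → ℕ} {S : ∀ t, DRep L (β t)}
    (hS : OrthBricks S) {l : List (Fin r × ℕ)} {α : I → ℕ} {M : DRep L α}
    (h : TopFilt S l α M) (t : Fin r) :
    Module.finrank L (homSpace M (S t)) ≤ firstMult t l := by
  induction l generalizing α with
  | nil =>
    have : ∀ i, IsEmpty (Fin (α i)) := fun i => by rw [h i]; infer_instance
    have h1 : Module.finrank L (VMat L (β t) α) = 0 := by
      rw [finrank_vMat, vertDim]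
      exact Finset.sum_eq_zero fun i _ => by rw [h i, mul_zero]
    exact (Submodule.finrank_le _).trans h1.le
  | cons a l ih =>
    obtain ⟨s, m⟩ := a
    obtain ⟨hm, α', N, hN, ⟨Y⟩⟩ := h
    by_cases hst : s = t
    · subst hst
      simp only [firstMult, if_true]
      have h1 : homSpace M (S s) ≤ Submodule.span L (Set.range Y.proj) := by
        intro X hX
        obtain ⟨c, rfl⟩ := Y.full X (mem_homSpace.1 hX)
        exact Submodule.sum_mem _ fun k _ => Submodule.smul_mem _ _
          (Submodule.subset_span ⟨k, rfl⟩)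
      refine (Submodule.finrank_mono h1).trans ?_
      refine (finrank_range_le_card _).trans ?_
      rw [Fintype.card_fin]
    · simp only [firstMult, if_neg hst]
      refine le_trans ?_ (ih hN)
      let f : VMat L (β t) α →ₗ[L] VMat L (β t) α' :=
        { toFun := fun X i => X i * Y.incl i
          map_add' := fun X X' => by funext i; simp [Matrix.add_mul]
          map_smul' := fun c X => by funext i; simp }
      let g : homSpace M (S t) →ₗ[L] homSpace N (S t) :=
        f.restrict fun X hX => mem_homSpace.2 ((mem_homSpace.1 hX).comp Y.incl_hom)
      refine LinearMap.finrank_le_finrank_of_injective (f := g) ?_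
      rw [injective_iff_map_eq_zero]
      rintro ⟨X, hX⟩ h0
      have h0' : ∀ i, X i * Y.incl i = 0 := fun i => congrFun (congrArg Subtype.val h0) i
      refine Subtype.ext (funext fun i => ?_)
      refine Y.eq_zero_of_mul_incl_of_mul_sect (h0' i) fun k => ?_
      exact congrFun (hS.hom_ne s t hst _ (Y.isHom_mul_sect (mem_homSpace.1 hX) h0' k)) i

end Bricks

/-! ### Splitting a surjective matrix -/

section Splitting

/-- A matrix with independent rows is a split surjection. -/
theorem exists_splitting {F : Type*} [Field F] {κ : Type*} [Fintype κ] [DecidableEq κ] {n a : ℕ}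
    (B : Matrix κ (Fin n) F) (hB : ∀ c : κ → F, Matrix.vecMul c B = 0 → c = 0)
    (hn : n = a + Fintype.card κ) :
    ∃ (C : Matrix (Fin n) (Fin a) F) (D : Matrix (Fin a) (Fin n) F) (E : Matrix (Fin n) κ F),
      D * C = 1 ∧ B * C = 0 ∧ D * E = 0 ∧ B * E = 1 ∧ C * D + E * B = 1 := by
  have hsurj : Function.Surjective B.mulVec := by
    have h1 : Function.Injective B.transpose.mulVecLin := by
      rw [injective_iff_map_eq_zero]
      intro c hc
      refine hB c ?_
      rw [← Matrix.mulVec_transpose]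
      exact hc
    have h2 : B.rank = Fintype.card κ := by
      rw [← Matrix.rank_transpose, Matrix.rank, LinearMap.finrank_range_of_inj h1,
        Module.finrank_fintype_fun_eq_card]
    have h3 : LinearMap.range B.mulVecLin = ⊤ := by
      refine Submodule.eq_top_of_finrank_eq ?_
      rw [Module.finrank_fintype_fun_eq_card]
      exact h2
    exact LinearMap.range_eq_top.1 h3
  obtain ⟨E, hE⟩ := Matrix.mulVec_surjective_iff_exists_right_inverse.1 hsurj
  -- `P` projects onto the kernel of `B` along the image of `E`. `C` is a basis of that kernel and
  -- `D` gives the coordinates of `P`, so `C * D = P`.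
  let P : Matrix (Fin n) (Fin n) F := 1 - E * B
  have hBP : B * P = 0 := by
    simp only [P, Matrix.mul_sub, Matrix.mul_one, ← Matrix.mul_assoc, hE, Matrix.one_mul, sub_self]
  have hPE : P * E = 0 := by
    simp only [P, Matrix.sub_mul, Matrix.one_mul, Matrix.mul_assoc, hE, Matrix.mul_one, sub_self]
  have hker : Module.finrank F (LinearMap.ker B.mulVecLin) = a := by
    have h1 := LinearMap.finrank_range_add_finrank_ker B.mulVecLin
    rw [LinearMap.range_eq_top.2 hsurj, finrank_top, Module.finrank_fintype_fun_eq_card,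
      Module.finrank_fintype_fun_eq_card, Fintype.card_fin] at h1
    omega
  let b := Module.finBasisOfFinrankEq F (LinearMap.ker B.mulVecLin) hker
  have hPmem : ∀ v, P.mulVec v ∈ LinearMap.ker B.mulVecLin := fun v => by
    rw [LinearMap.mem_ker, Matrix.mulVecLin_apply, Matrix.mulVec_mulVec, hBP, Matrix.zero_mulVec]
  let Pl : (Fin n → F) →ₗ[F] LinearMap.ker B.mulVecLin := P.mulVecLin.codRestrict _ hPmem
  let C : Matrix (Fin n) (Fin a) F := Matrix.of fun x k => (b k : Fin n → F) x
  let D : Matrix (Fin a) (Fin n) F := LinearMap.toMatrix' (b.equivFun.toLinearMap.comp Pl)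
  have hCv : ∀ v, C.mulVec v = (b.equivFun.symm v : Fin n → F) := by
    intro v
    funext x
    rw [Module.Basis.equivFun_symm_apply]
    simp [C, Matrix.mulVec, dotProduct, Finset.sum_apply, mul_comm]
  have hCD : C * D = P := by
    refine Matrix.toLin'.injective (LinearMap.ext fun v => ?_)
    rw [Matrix.toLin'_apply, Matrix.toLin'_apply, ← Matrix.mulVec_mulVec, hCv]
    have : D.mulVec v = b.equivFun (Pl v) := by
      rw [← Matrix.toLin'_apply]
      simp [D]
    rw [this, LinearEquiv.symm_apply_apply]
    rfl
  have hBC : B * C = 0 := by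
    refine Matrix.toLin'.injective (LinearMap.ext fun v => ?_)
    rw [Matrix.toLin'_apply, ← Matrix.mulVec_mulVec, hCv, map_zero, LinearMap.zero_apply]
    exact (b.equivFun.symm v).2
  have hCinj : ∀ (X Y : Matrix (Fin a) (Fin a) F), C * X = C * Y → X = Y := by
    intro X Y h
    ext i j
    have h1 : C.mulVec (fun i => X i j) = C.mulVec (fun i => Y i j) := by
      funext x
      exact congrFun (congrFun h x) j
    rw [hCv, hCv] at h1
    exact congrFun (b.equivFun.symm.injective (Subtype.ext h1)) i
  have hDC : D * C = 1 := by
    refine hCinj _ _ ?_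
    rw [← Matrix.mul_assoc, hCD, Matrix.mul_one]
    simp only [P, Matrix.sub_mul, Matrix.one_mul, Matrix.mul_assoc, hBC, Matrix.mul_zero, sub_zero]
  refine ⟨C, D, E, hDC, hBC, ?_, hE, ?_⟩
  · calc D * E = D * C * D * E := by rw [hDC, Matrix.one_mul]
      _ = 0 := by rw [Matrix.mul_assoc D, hCD, Matrix.mul_assoc, hPE, Matrix.mul_zero]
  · rw [hCD]
    simp only [P, sub_add_cancel]

end Splitting

/-! ### Changing the basis, the splitting and the middle term of a layer -/

section Relayer

theorem sum_smul_mul_sum_smul {F ι ι' k l n : Type*} [Field F] [Fintype ι] [Fintype ι'] [Fintype l]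
    (c : ι → F) (d : ι' → F) (A : ι → Matrix k l F) (B : ι' → Matrix l n F) :
    (∑ a, c a • A a) * (∑ b, d b • B b) = ∑ a, ∑ b, (c a * d b) • (A a * B b) := by
  rw [Matrix.sum_mul]
  refine Finset.sum_congr rfl fun a _ => ?_
  rw [Matrix.mul_sum]
  refine Finset.sum_congr rfl fun b _ => ?_
  rw [Matrix.smul_mul, Matrix.mul_smul, smul_smul]

variable {I : Type u} [Quiver.{v} I] {L : Type w} [Field L] {α α' β : I → ℕ}

namespace Layer

variable {S : DRep L β} {m : ℕ} {N : DRep L α'} {M : DRep L α}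

/-- Changing the basis of the homomorphism space of a layer. -/
def changeBasis (Y : Layer S m M N) {g h : Matrix (Fin m) (Fin m) L} (hgh : g * h = 1)
    (hhg : h * g = 1) : Layer S m M N where
  proj k := ∑ l, g k l • Y.proj l
  incl := Y.incl
  retr := Y.retr
  sect k := ∑ l, h l k • Y.sect l
  dim_eq := Y.dim_eq
  retr_incl := Y.retr_incl
  proj_incl k i := by
    simp [Finset.sum_apply, Matrix.sum_mul, Y.proj_incl]
  retr_sect k i := by
    simp [Finset.sum_apply, Matrix.mul_sum, Y.retr_sect]
  proj_sect k l i := by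
    have h1 : (g * h) k l = (1 : Matrix (Fin m) (Fin m) L) k l := by rw [hgh]
    rw [Matrix.mul_apply, Matrix.one_apply] at h1
    simp only [Finset.sum_apply, Pi.smul_apply]
    rw [sum_smul_mul_sum_smul]
    simp only [Y.proj_sect, smul_ite, smul_zero, Finset.sum_ite_eq, Finset.mem_univ, if_true]
    rw [← Finset.sum_smul, h1]
    split_ifs <;> simp
  sum_eq i := by
    have h1 : ∑ k, (∑ l, h l k • Y.sect l) i * (∑ l, g k l • Y.proj l) i =
        ∑ l, ∑ l', (h * g) l l' • (Y.sect l i * Y.proj l' i) := by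
      simp only [Finset.sum_apply, Pi.smul_apply, sum_smul_mul_sum_smul, Matrix.mul_apply,
        Finset.sum_smul]
      rw [Finset.sum_comm]
      refine Finset.sum_congr rfl fun l _ => ?_
      rw [Finset.sum_comm]
    rw [h1, hhg, ← Y.sum_eq i]
    simp [Matrix.one_apply]
  incl_hom := Y.incl_hom
  proj_hom k := by
    rw [← mem_homSpace]
    exact Submodule.sum_mem _ fun l _ => Submodule.smul_mem _ _ (mem_homSpace.2 (Y.proj_hom l))
  full X hX := by
    obtain ⟨c, rfl⟩ := Y.full X hX
    refine ⟨Matrix.vecMul c h, ?_⟩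
    have h1 : ∀ l, c l = Matrix.vecMul (Matrix.vecMul c h) g l := fun l => by
      rw [Matrix.vecMul_vecMul, hhg, Matrix.vecMul_one]
    simp only [Finset.smul_sum, smul_smul]
    rw [Finset.sum_comm]
    refine Finset.sum_congr rfl fun l _ => ?_
    rw [← Finset.sum_smul, h1 l]
    rfl

theorem linearIndependent_proj (Y : Layer S m M N) (hβ : ∃ i, 0 < β i) :
    LinearIndependent L Y.proj := by
  obtain ⟨i, hi⟩ := hβ
  rw [Fintype.linearIndependent_iff]
  intro c hc k
  have h1 : (∑ l, c l • Y.proj l) i * Y.sect k i = 0 := by rw [hc]; simp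
  simp only [Finset.sum_apply, Pi.smul_apply, Matrix.sum_mul, Matrix.smul_mul, Y.proj_sect,
    smul_ite, smul_zero, Finset.sum_ite_eq', Finset.mem_univ, if_true] at h1
  have h2 := congrFun (congrFun h1 ⟨0, hi⟩) ⟨0, hi⟩
  simpa using h2

variable {K : Type*} [Field K] [Algebra K L]

/-- Homomorphisms with independent rows spanning all homomorphisms are the projections of a layer,
with complements defined over any field containing their entries. -/
theorem exists_of_independent (F : IntermediateField K L) {P : Fin m → VMat L β α}
    (hF : ∀ k i b x, P k i b x ∈ F) (dim_eq : ∀ i, α i = α' i + m * β i)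
    (hind : ∀ i (c : Fin m → Fin (β i) → L), (∀ x, ∑ k, ∑ b, c k b * P k i b x = 0) →
      ∀ k b, c k b = 0) (hP : ∀ k, IsHom M S (P k))
    (full : ∀ X, IsHom M S X → ∃ c : Fin m → L, X = ∑ k, c k • P k) :
    ∃ (N' : DRep L α') (Y' : Layer S m M N'), Y'.proj = P ∧
      (∀ i x y, Y'.incl i x y ∈ F) ∧ (∀ i x y, Y'.retr i x y ∈ F) ∧
      (∀ k i x y, Y'.sect k i x y ∈ F) := by
  classical
  let B : ∀ i, Matrix (Fin m × Fin (β i)) (Fin (α i)) F := fun i =>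
    Matrix.of fun kb x => ⟨P kb.1 i kb.2 x, hF _ _ _ _⟩
  have hB : ∀ i (c : Fin m × Fin (β i) → F), Matrix.vecMul c (B i) = 0 → c = 0 := by
    intro i c hc
    have h1 : ∀ x, ∑ k, ∑ b, (c (k, b) : L) * P k i b x = 0 := by
      intro x
      have h2 := congrArg (algebraMap F L) (congrFun hc x)
      rw [Matrix.vecMul, dotProduct, map_sum, Fintype.sum_prod_type, Pi.zero_apply, map_zero] at h2
      exact h2
    funext ⟨k, b⟩
    exact (ZeroMemClass.coe_eq_zero (S' := F)).1 (hind i (fun k b => c (k, b)) h1 k b)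
  have hcard : ∀ i, α i = α' i + Fintype.card (Fin m × Fin (β i)) := fun i => by
    rw [dim_eq i]; simp
  choose C D E hDC hBC hDE hBE hsum using fun i => exists_splitting (B i) (hB i) (hcard i)
  let f : F →+* L := algebraMap F L
  let incl : VMat L α α' := fun i => (C i).map f
  let retr : VMat L α' α := fun i => (D i).map f
  let sect : Fin m → VMat L α β := fun k i => Matrix.of fun x b => f (E i x (k, b))
  have hBC' : ∀ k i, P k i * incl i = 0 := by
    intro k i
    ext b x
    have h1 := congrArg f (congrFun (congrFun (hBC i) (k, b)) x)
    rw [Matrix.mul_apply, map_sum] at h1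
    simp only [map_mul, Matrix.zero_apply, map_zero] at h1
    rw [Matrix.mul_apply]
    exact h1
  have hBE' : ∀ k l i, P k i * sect l i = if k = l then 1 else 0 := by
    intro k l i
    ext b x
    have h1 := congrArg f (congrFun (congrFun (hBE i) (k, b)) (l, x))
    rw [Matrix.mul_apply, map_sum] at h1
    simp only [map_mul] at h1
    rw [Matrix.mul_apply]
    refine h1.trans ?_
    simp only [Matrix.one_apply, Prod.mk.injEq, apply_ite f, map_one, map_zero]
    by_cases h2 : k = l <;> simp [h2, Matrix.one_apply]
  have hDE' : ∀ k i, retr i * sect k i = 0 := by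
    intro k i
    ext b x
    have h1 := congrArg f (congrFun (congrFun (hDE i) b) (k, x))
    rw [Matrix.mul_apply, map_sum] at h1
    simp only [map_mul, Matrix.zero_apply, map_zero] at h1
    rw [Matrix.mul_apply]
    exact h1
  have hDC' : ∀ i, retr i * incl i = 1 := by
    intro i
    simp only [incl, retr]
    rw [← Matrix.map_mul, hDC, Matrix.map_one f (map_zero f) (map_one f)]
  have hsum' : ∀ i, incl i * retr i + ∑ k, sect k i * P k i = 1 := by
    intro i
    ext x y
    have h1 := congrArg f (congrFun (congrFun (hsum i) x) y)
    rw [Matrix.add_apply, Matrix.mul_apply, Matrix.mul_apply, map_add, map_sum, map_sum,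
      Fintype.sum_prod_type, Matrix.one_apply, apply_ite f, map_one, map_zero] at h1
    simp only [map_mul] at h1
    rw [Matrix.add_apply, Matrix.mul_apply, Matrix.sum_apply, Matrix.one_apply]
    simp only [Matrix.mul_apply]
    exact h1
  -- Only the splitting is defined over `F`; `N'` also involves the entries of `M`.
  let N' : DRep L α' := fun i j e => retr j * M i j e * incl i
  refine ⟨N', ⟨P, incl, retr, sect, dim_eq, hDC', hBC', hDE', hBE', hsum', ?_, hP,
    full⟩, rfl, fun i x y => (C i x y).2, fun i x y => (D i x y).2,
    fun k i x y => (E i x (k, y)).2⟩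
  intro i j e
  have h1 : M i j e * incl i = (incl j * retr j + ∑ k, sect k j * P k j) *
      (M i j e * incl i) := by rw [hsum', Matrix.one_mul]
  have h2 : ∀ k, P k j * (M i j e * incl i) = 0 := fun k => by
    rw [← Matrix.mul_assoc, hP, Matrix.mul_assoc, hBC', Matrix.mul_zero]
  rw [h1]
  simp only [N', Matrix.add_mul, Matrix.sum_mul, Matrix.mul_assoc, h2, Matrix.mul_zero,
    Finset.sum_const_zero, add_zero]

/-- The complement in a layer can be chosen over any field of definition of the projections. -/
theorem exists_defined_over (Y : Layer S m M N) (F : IntermediateField K L)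
    (hF : ∀ k i b x, Y.proj k i b x ∈ F) :
    ∃ (N' : DRep L α') (Y' : Layer S m M N'), Y'.proj = Y.proj ∧
      (∀ i x y, Y'.incl i x y ∈ F) ∧ (∀ i x y, Y'.retr i x y ∈ F) ∧
      (∀ k i x y, Y'.sect k i x y ∈ F) := by
  refine exists_of_independent F hF Y.dim_eq (fun i c h1 k b => ?_) Y.proj_hom Y.full
  have h3 : ∑ x, (∑ k', ∑ b', c k' b' * Y.proj k' i b' x) * Y.sect k i x b =
      c k b := by
    have h4 : ∀ k' b', ∑ x, Y.proj k' i b' x * Y.sect k i x b =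
        if k' = k then (if b' = b then (1 : L) else 0) else 0 := by
      intro k' b'
      rw [← Matrix.mul_apply, Y.proj_sect]
      by_cases h5 : k' = k <;> simp [h5, Matrix.one_apply]
    simp only [Finset.sum_mul, mul_assoc]
    rw [Finset.sum_comm]
    simp only [Finset.sum_comm (s := (Finset.univ : Finset (Fin (α i)))), ← Finset.mul_sum, h4]
    simp
  simp only [h1, zero_mul, Finset.sum_const_zero] at h3
  exact h3.symm

/-- Transport of a layer along an isomorphism of its middle term. -/
theorem conj (Y : Layer S m M N) {M' : DRep L α} {G H : VMat L α α} (hHG : ∀ i, H i * G i = 1)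
    (hGH : ∀ i, G i * H i = 1) (hG : IsHom M M' G) (hH : IsHom M' M H) :
    Nonempty (Layer S m M' N) := by
  refine ⟨⟨fun k i => Y.proj k i * H i, fun i => G i * Y.incl i, fun i => Y.retr i * H i,
    fun k i => G i * Y.sect k i, Y.dim_eq, fun i => ?_, fun k i => ?_, fun k i => ?_,
    fun k l i => ?_, fun i => ?_, hG.comp Y.incl_hom, fun k => (Y.proj_hom k).comp hH, ?_⟩⟩
  · rw [Matrix.mul_assoc, ← Matrix.mul_assoc (H i), hHG, Matrix.one_mul, Y.retr_incl]
  · rw [Matrix.mul_assoc, ← Matrix.mul_assoc (H i), hHG, Matrix.one_mul, Y.proj_incl]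
  · rw [Matrix.mul_assoc, ← Matrix.mul_assoc (H i), hHG, Matrix.one_mul, Y.retr_sect]
  · rw [Matrix.mul_assoc, ← Matrix.mul_assoc (H i), hHG, Matrix.one_mul, Y.proj_sect]
  · have h1 : G i * (Y.incl i * Y.retr i + ∑ k, Y.sect k i * Y.proj k i) * H i = 1 := by
      rw [Y.sum_eq, Matrix.mul_one, hGH]
    simpa only [Matrix.mul_add, Matrix.add_mul, Matrix.mul_sum, Matrix.sum_mul,
      Matrix.mul_assoc] using h1
  · intro X hX
    obtain ⟨c, hc⟩ := Y.full _ (hX.comp hG)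
    refine ⟨c, funext fun i => ?_⟩
    have h1 : X i = X i * G i * H i := by rw [Matrix.mul_assoc, hGH, Matrix.mul_one]
    rw [h1, congrFun hc i]
    simp [Finset.sum_apply, Matrix.sum_mul]

end Layer

theorem TopFilt.conj {r : ℕ} {β : Fin r → I → ℕ} {S : ∀ t, DRep L (β t)} {l : List (Fin r × ℕ)}
    {M M' : DRep L α} (h : TopFilt S l α M) {G H : VMat L α α} (hHG : ∀ i, H i * G i = 1)
    (hGH : ∀ i, G i * H i = 1) (hG : IsHom M M' G) (hH : IsHom M' M H) : TopFilt S l α M' := by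
  cases l with
  | nil => exact h
  | cons a l =>
    obtain ⟨hm, α', N, hN, ⟨Y⟩⟩ := h
    exact ⟨hm, α', N, hN, Y.conj hHG hGH hG hH⟩

/-- The subrepresentation is the kernel of the projections, so they determine it up to the
isomorphism `retr * incl`, along which the filtration is carried. -/
theorem TopFilt.of_layers {r : ℕ} {β : Fin r → I → ℕ} {S : ∀ t, DRep L (β t)}
    {l : List (Fin r × ℕ)} {t : Fin r} {m : ℕ} {M : DRep L α} {N N' : DRep L α'}
    (h : TopFilt S l α' N) (Y : Layer (S t) m M N) (Y' : Layer (S t) m M N')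
    (hY : Y'.proj = Y.proj) : TopFilt S l α' N' := by
  have key : ∀ {N₁ N₂ : DRep L α'} (Y₁ : Layer (S t) m M N₁) (Y₂ : Layer (S t) m M N₂),
      Y₁.proj = Y₂.proj → (∀ i, Y₁.retr i * Y₂.incl i * (Y₂.retr i * Y₁.incl i) = 1) ∧
        IsHom N₂ N₁ (fun i => Y₁.retr i * Y₂.incl i) := by
    intro N₁ N₂ Y₁ Y₂ h12
    have h1 : ∀ i, Y₂.incl i * (Y₂.retr i * Y₁.incl i) = Y₁.incl i := by
      intro i
      have h2 := congrArg (fun A => A * Y₁.incl i) (Y₂.sum_eq i)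
      simpa only [Matrix.add_mul, Matrix.sum_mul, Matrix.mul_assoc, ← h12, Y₁.proj_incl,
        Matrix.mul_zero, Finset.sum_const_zero, add_zero, Matrix.one_mul] using h2
    refine ⟨fun i => by rw [Matrix.mul_assoc, h1, Y₁.retr_incl], fun i j e => ?_⟩
    rw [Matrix.mul_assoc, Y₂.incl_hom, ← Matrix.mul_assoc, Y₁.retr_mul, Matrix.add_mul,
      Matrix.sum_mul]
    simp only [Matrix.mul_assoc, h12, Y₂.proj_incl, Matrix.mul_zero, Finset.sum_const_zero,
      add_zero]
  exact h.conj (key Y Y' hY.symm).1 (key Y' Y hY).1 (key Y' Y hY).2 (key Y Y' hY.symm).2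

end Relayer

/-! ### Counting parameters in unions -/

section RankLemmas

variable {K L : Type*} [Field K] [Field L] [Algebra K L]

/-- The sets are added one after another, each counted over the earlier ones; hence the hypothesis
for every larger `X'`. -/
theorem trRk_union_iUnion_le {τ : Type*} [Fintype τ] (X : Set L) (Y : τ → Set L) (c : τ → ℕ)
    (h : ∀ t X', X ⊆ X' → trRk K (X' ∪ Y t) ≤ trRk K X' + c t) :
    trRk K (X ∪ ⋃ t, Y t) ≤ trRk K X + (∑ t, c t : ℕ) := by
  classical
  have key : ∀ s : Finset τ, trRk K (X ∪ ⋃ t ∈ s, Y t) ≤ trRk K X + (∑ t ∈ s, c t : ℕ) := by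
    intro s
    induction s using Finset.induction_on with
    | empty => simp
    | insert t s hts ih =>
      have h1 : X ∪ ⋃ t' ∈ insert t s, Y t' = (X ∪ ⋃ t' ∈ s, Y t') ∪ Y t := by
        rw [Finset.set_biUnion_insert, Set.union_assoc, Set.union_comm (Y t)]
      rw [h1, Finset.sum_insert hts]
      refine (h t _ Set.subset_union_left).trans ?_
      refine (add_le_add_left ih _).trans ?_
      push_cast
      rw [add_assoc, add_comm (c t : ℕ∞)]
  simpa using key Finset.univ

/-- A family of vectors in reduced echelon form depends on few parameters. -/
theorem trRk_union_echelon_le {ι : Type*} [Fintype ι] {m : ℕ} (X : Set L) (b : Fin m → ι → L)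
    (a : Fin m → ι) (ha : Function.Injective a)
    (hb : ∀ i j, b i (a j) = if i = j then 1 else 0) :
    trRk K (X ∪ ⋃ k, Set.range (b k)) ≤ trRk K X + (m * (Fintype.card ι - m) : ℕ) := by
  classical
  let T : Finset (Fin m × ι) := Finset.univ ×ˢ (Finset.univ.image a)ᶜ
  let f : Fin m × ι → L := fun c => b c.1 c.2
  have hT : T.card = m * (Fintype.card ι - m) := by
    rw [Finset.card_product, Finset.card_univ, Fintype.card_fin, Finset.card_compl,
      Finset.card_image_of_injective _ ha, Finset.card_univ, Fintype.card_fin]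
  have hcl : X ∪ ⋃ k, Set.range (b k) ⊆
      (AlgebraicIndependent.matroid K L).closure (X ∪ f '' T) := by
    have h1 : ∀ c ∈ X ∪ f '' T, c ∈ (AlgebraicIndependent.matroid K L).closure (X ∪ f '' T) :=
      fun c hc => mem_closure_of_mem_adjoin (IntermediateField.subset_adjoin _ _ hc)
    rintro c (hc | hc)
    · exact h1 c (Set.mem_union_left _ hc)
    · obtain ⟨k, i, rfl⟩ := Set.mem_iUnion.1 hc
      by_cases hi : ∃ j, a j = i
      · obtain ⟨j, rfl⟩ := hi
        rw [hb]
        refine mem_closure_of_mem_adjoin ?_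
        split_ifs
        · exact one_mem _
        · exact zero_mem _
      · refine h1 _ (Set.mem_union_right _ ⟨(k, i), ?_, rfl⟩)
        simpa [T] using hi
  calc trRk K (X ∪ ⋃ k, Set.range (b k)) ≤ trRk K (X ∪ f '' T) := by
        refine ((AlgebraicIndependent.matroid K L).eRk_mono hcl).trans ?_
        rw [Matroid.eRk_closure_eq]
    _ ≤ trRk K X + (f '' T).encard := Matroid.eRk_union_le_eRk_add_encard _ _ _
    _ ≤ _ := by
        gcongr
        refine (Set.encard_image_le _ _).trans ?_
        rw [Set.encard_coe_eq_coe_finsetCard, hT]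

theorem trRk_le_of_subset_adjoin {X Y : Set L}
    (h : Y ⊆ IntermediateField.adjoin K X) : trRk K Y ≤ trRk K X := by
  have h1 : Y ⊆ (AlgebraicIndependent.matroid K L).closure X :=
    fun y hy => mem_closure_of_mem_adjoin (h hy)
  refine ((AlgebraicIndependent.matroid K L).eRk_mono h1).trans ?_
  rw [Matroid.eRk_closure_eq]

theorem map_derivation_mul {E : IntermediateField K L} (D : Derivation K E L) {l m n : ℕ}
    (A : Matrix (Fin l) (Fin m) E) (B : Matrix (Fin m) (Fin n) E) :
    (A * B).map D = A.map (algebraMap E L) * B.map D + A.map D * B.map (algebraMap E L) := by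
  ext i j
  simp only [Matrix.map_apply, Matrix.mul_apply, Matrix.add_apply, map_sum, Derivation.leibniz,
    Finset.sum_add_distrib, Algebra.smul_def]
  congr 1
  exact Finset.sum_congr rfl fun x _ => mul_comm _ _

end RankLemmas

/-! ### Tangent space bounds for cocycles, zeros of the moment map and homomorphisms -/

section Tangent

variable {I : Type u} [Fintype I] [Quiver.{v} I] [∀ i j : I, Fintype (i ⟶ j)]
variable {K : Type*} {L : Type w} [Field K] [Field L] [Algebra K L] {α β γ : I → ℕ}

/-- Apply a function to all entries. -/
def RArr.map {R R' : Type*} (f : R → R') (x : RArr R α β) : RArr R' α β :=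
  fun i j e => (x i j e).map f

theorem bimoment_map_ringHom {R R' : Type*} [CommRing R] [CommRing R'] (f : R →+* R')
    (x : RArr R α γ) (y : RArr R γ β) (i : I) :
    (bimoment x y i).map f = bimoment (x.map f) (y.map f) i := by
  have h : ∀ {m n : ℕ} (A : Matrix (Fin m) (Fin n) R), A.map f = f.toAddMonoidHom.mapMatrix A :=
    fun _ => rfl
  simp only [bimoment, RArr.map, ← Matrix.map_mul]
  simp only [h, map_sub, map_sum]

theorem bimoment_map_derivation {E : IntermediateField K L} (D : Derivation K E L)
    (x : RArr E α γ) (y : RArr E γ β) (i : I) :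
    (bimoment x y i).map D =
      bimoment (x.map (algebraMap E L)) (y.map D) i +
        bimoment (x.map D) (y.map (algebraMap E L)) i := by
  have h : ∀ {m n : ℕ} (A : Matrix (Fin m) (Fin n) E),
      A.map D = D.toLinearMap.toAddMonoidHom.mapMatrix A := fun _ => rfl
  rw [bimoment, h]
  simp only [map_sub, map_sum]
  simp only [← h, map_derivation_mul, Finset.sum_add_distrib, bimoment, RArr.map]
  abel

/-- The parameters of a cocycle. -/
theorem trRk_union_cocycle_le (X : Set L) (N : DRep L α) (S : DRep L β)
    (hN : Set.range (RArr.entries N) ⊆ X) (hS : Set.range (RArr.entries S) ⊆ X) (ζ : RArr L α β)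
    (hζ : dMoment N S ζ = 0) :
    trRk K (X ∪ Set.range ζ.entries) ≤
      trRk K X + Module.finrank L (LinearMap.ker (dMoment N S)) := by
  have h := trRk_union_range_le (K := K) X ζ.entries
    ((LinearMap.ker (dMoment N S)).map (RArr.entriesEquiv L α β).toLinearMap) ?_
  · rwa [LinearEquiv.finrank_map_eq] at h
  intro E D hXE hD x' hx'
  let N' : DRep E α := fun i j e => Matrix.of fun a b =>
    ⟨N i j e a b, hXE (hN ⟨⟨i, j, e, a, b⟩, rfl⟩)⟩
  let S' : DRep E β := fun i j e => Matrix.of fun a b =>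
    ⟨S i j e a b, hXE (hS ⟨⟨i, j, e, a, b⟩, rfl⟩)⟩
  let ζ' : RArr E α β := fun i j e => Matrix.of fun a b => x' ⟨i, j, e, a, b⟩
  have eN : RArr.map (algebraMap E L) N' = N := rfl
  have eS : RArr.map (algebraMap E L) S' = S := rfl
  have eζ : RArr.map (algebraMap E L) ζ' = ζ := by
    funext i j e; ext a b; exact hx' ⟨i, j, e, a, b⟩
  have dN : RArr.map D N' = (0 : RArr L α α) := by
    funext i j e; ext a b; exact hD _ (hN ⟨⟨i, j, e, a, b⟩, rfl⟩)
  have dS : RArr.map D S' = (0 : RArr L β β) := by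
    funext i j e; ext a b; exact hD _ (hS ⟨⟨i, j, e, a, b⟩, rfl⟩)
  refine ⟨RArr.map D ζ', ?_, rfl⟩
  rw [SetLike.mem_coe, LinearMap.mem_ker]
  funext i
  have h1 : bimoment N' ζ' i + bimoment ζ' S' i = 0 := by
    have h2 : (bimoment N' ζ' i + bimoment ζ' S' i).map (algebraMap E L) = 0 := by
      rw [Matrix.map_add _ (map_add _), bimoment_map_ringHom, bimoment_map_ringHom, eN, eS, eζ]
      exact congrFun hζ i
    ext a b
    exact congrFun (congrFun h2 a) b
  -- The entries of `N` and `S` are constants for `D`, so differentiating the cocycle equation gives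
  -- the same linear equation for `D ζ`.
  have h3 : (bimoment N' ζ' i + bimoment ζ' S' i).map D = 0 := by
    rw [h1]; ext a b; exact map_zero D
  rw [Matrix.map_add _ (map_add D), bimoment_map_derivation, bimoment_map_derivation, eN, eS, eζ,
    dN, dS] at h3
  have h4 : bimoment (0 : RArr L α α) ζ = 0 := by
    have := bimoment_smul_left (0 : L) (0 : RArr L α α) ζ
    rwa [zero_smul, zero_smul] at this
  have h5 : bimoment ζ (0 : RArr L β β) = 0 := by
    have := bimoment_smul_right (0 : L) ζ (0 : RArr L β β)
    rwa [zero_smul, zero_smul] at this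
  rw [h4, h5] at h3
  simp only [Pi.zero_apply, add_zero, zero_add] at h3
  exact h3

/-- The tangent space bound for zeros of the moment map. -/
theorem trRk_union_moment_le (X : Set L) (S : DRep L β) (hS : ∀ i, moment S i = 0) :
    trRk K (X ∪ Set.range (RArr.entries S)) ≤
      trRk K X + Module.finrank L (LinearMap.ker (dMoment S S)) := by
  have h := trRk_union_range_le (K := K) X (RArr.entries S)
    ((LinearMap.ker (dMoment S S)).map (RArr.entriesEquiv L β β).toLinearMap) ?_
  · rwa [LinearEquiv.finrank_map_eq] at h
  intro E D hXE hD x' hx'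
  let S' : DRep E β := fun i j e => Matrix.of fun a b => x' ⟨i, j, e, a, b⟩
  have eS : RArr.map (algebraMap E L) S' = S := by
    funext i j e; ext a b; exact hx' ⟨i, j, e, a, b⟩
  refine ⟨RArr.map D S', ?_, rfl⟩
  rw [SetLike.mem_coe, LinearMap.mem_ker]
  funext i
  have h1 : bimoment S' S' i = 0 := by
    have h2 : (bimoment S' S' i).map (algebraMap E L) = 0 := by
      rw [bimoment_map_ringHom, eS]
      exact hS i
    ext a b
    exact congrFun (congrFun h2 a) b
  have h3 : (bimoment S' S' i).map D = 0 := by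
    rw [h1]; ext a b; exact map_zero D
  rw [bimoment_map_derivation, eS] at h3
  exact h3

/-- A homomorphism between representations defined over `X` has at most as many parameters as the
dimension of the homomorphism space. -/
theorem trRk_union_isHom_le (X : Set L) (M : DRep L α) (S : DRep L β)
    (hM : Set.range (RArr.entries M) ⊆ X) (hS : Set.range (RArr.entries S) ⊆ X) (g : VMat L β α)
    (hg : IsHom M S g) :
    trRk K (X ∪ Set.range (VMat.entries g)) ≤
      trRk K X + Module.finrank L (homSpace M S) := by
  have h := trRk_union_range_le (K := K) X (VMat.entries g)
    ((homSpace M S).map (VMat.entriesEquiv L β α).toLinearMap) ?_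
  · rwa [LinearEquiv.finrank_map_eq] at h
  intro E D hXE hD x' hx'
  let M' : DRep E α := fun i j e => Matrix.of fun a b =>
    ⟨M i j e a b, hXE (hM ⟨⟨i, j, e, a, b⟩, rfl⟩)⟩
  let S' : DRep E β := fun i j e => Matrix.of fun a b =>
    ⟨S i j e a b, hXE (hS ⟨⟨i, j, e, a, b⟩, rfl⟩)⟩
  let g' : VMat E β α := fun i => Matrix.of fun a b => x' ⟨i, a, b⟩
  have eg : ∀ i, (g' i).map (algebraMap E L) = g i := by
    intro i; ext a b; exact hx' ⟨i, a, b⟩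
  have dM : ∀ i j e, (M' i j e).map D = 0 := by
    intro i j e; ext a b; exact hD _ (hM ⟨⟨i, j, e, a, b⟩, rfl⟩)
  have dS : ∀ i j e, (S' i j e).map D = 0 := by
    intro i j e; ext a b; exact hD _ (hS ⟨⟨i, j, e, a, b⟩, rfl⟩)
  refine ⟨fun i => (g' i).map D, ?_, rfl⟩
  rw [SetLike.mem_coe, mem_homSpace]
  intro i j e
  have h1 : g' j * M' i j e = S' i j e * g' i := by
    have h2 : (g' j * M' i j e).map (algebraMap E L) = (S' i j e * g' i).map (algebraMap E L) := by
      rw [Matrix.map_mul, Matrix.map_mul, eg, eg]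
      exact hg i j e
    ext a b
    exact congrFun (congrFun h2 a) b
  have h3 := congrArg (fun A => A.map D) h1
  simp only [map_derivation_mul, dM, dS, Matrix.mul_zero, Matrix.zero_mul, zero_add,
    add_zero] at h3
  exact h3

end Tangent

/-! ### The parameter count for a filtration -/

section Core

variable {I : Type u} [Fintype I] [Quiver.{v} I] [∀ i j : I, Fintype (i ⟶ j)]
variable {K : Type*} {L : Type w} [Field K] [Field L] [Algebra K L]

theorem mul_mem_of_entries {F : IntermediateField K L} {l m n : ℕ} {A : Matrix (Fin l) (Fin m) L}
    {B : Matrix (Fin m) (Fin n) L} (hA : ∀ x y, A x y ∈ F) (hB : ∀ x y, B x y ∈ F) (x y) :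
    (A * B) x y ∈ F := by
  rw [Matrix.mul_apply]
  exact sum_mem fun z _ => mul_mem (hA x z) (hB z y)

/-- The parameter count for one step of a filtration. -/
theorem Layer.exists_trRk_le {α α' β : I → ℕ} {S : DRep L β} {m : ℕ} {M : DRep L α}
    {N : DRep L α'} (Y : Layer S m M N) (hβ : ∃ i, 0 < β i) (hM : ∀ i, moment M i = 0)
    (X : Set L) (hX : Set.range (RArr.entries S) ⊆ X) :
    ∃ (N' : DRep L α') (Y₁ : Layer S m M N) (Y₂ : Layer S m M N'), Y₂.proj = Y₁.proj ∧
      m ≤ vertDim β α ∧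
      trRk K (X ∪ Set.range (RArr.entries M)) ≤ trRk K (X ∪ Set.range (RArr.entries N')) +
        (m * (vertDim β α - m) + m * Module.finrank L (LinearMap.ker (dMoment N' S)) : ℕ) := by
  classical
  let b : Fin m → VCoord β α → L := fun k => VMat.entries (Y.proj k)
  have hb : LinearIndependent L b :=
    (Y.linearIndependent_proj hβ).map' (VMat.entriesEquiv L β α).toLinearMap
      (LinearEquiv.ker _)
  -- Only the span of the projections matters, so they may be put in echelon form; this leaves the
  -- parameters of a Grassmannian.
  obtain ⟨g, h, a, hgh, hhg, ha, hga⟩ := exists_mul_submatrix_eq_one b hb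
  let Y₁ := Y.changeBasis hgh hhg
  let b' : Fin m → VCoord β α → L := fun k => VMat.entries (Y₁.proj k)
  have hb' : ∀ i j, b' i (a j) = if i = j then 1 else 0 := by
    intro i j
    rw [← hga]
    simp [b', b, Y₁, Layer.changeBasis, VMat.entries, Finset.sum_apply, Matrix.sum_apply]
  -- The splitting is taken over the field generated by the projections, so it costs no further
  -- parameters.
  let F := IntermediateField.adjoin K (⋃ k, Set.range (b' k))
  obtain ⟨N', Y₂, hY, hincl, hretr, hsect⟩ := Y₁.exists_defined_over F (fun k i x y =>
    IntermediateField.subset_adjoin _ _ (Set.mem_iUnion.2 ⟨k, ⟨i, x, y⟩, rfl⟩))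
  have hcard : Fintype.card (VCoord β α) = vertDim β α := by
    rw [← finrank_vMat (L := L), (VMat.entriesEquiv L β α).finrank_eq,
      Module.finrank_fintype_fun_eq_card]
  refine ⟨N', Y₁, Y₂, hY, ?_, ?_⟩
  · have := Fintype.card_le_of_injective a ha
    rwa [Fintype.card_fin, hcard] at this
  set X₁ := X ∪ Set.range (RArr.entries N')
  set X₂ := X₁ ∪ ⋃ k, Set.range (b' k)
  set X₃ := X₂ ∪ ⋃ k, Set.range (Y₂.cocycle k).entries
  have h1 : trRk K X₂ ≤ trRk K X₁ + (m * (vertDim β α - m) : ℕ) := by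
    rw [← hcard]
    exact trRk_union_echelon_le X₁ b' a ha hb'
  have h2 : trRk K X₃ ≤ trRk K X₂ +
      (m * Module.finrank L (LinearMap.ker (dMoment N' S)) : ℕ) := by
    have h3 := trRk_union_iUnion_le (K := K) X₂ (fun k => Set.range (Y₂.cocycle k).entries)
      (fun _ => Module.finrank L (LinearMap.ker (dMoment N' S))) (fun k X' hX' =>
        trRk_union_cocycle_le X' N' S
          ((Set.subset_union_right.trans Set.subset_union_left).trans hX')
          ((hX.trans (Set.subset_union_left.trans Set.subset_union_left)).trans hX')
          (Y₂.cocycle k) (Y₂.dMoment_cocycle hM k))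
    simpa using h3
  have h3 : trRk K (X ∪ Set.range (RArr.entries M)) ≤ trRk K X₃ := by
    refine trRk_le_of_subset_adjoin ?_
    have hX₃ : X₃ ⊆ IntermediateField.adjoin K X₃ := IntermediateField.subset_adjoin _ _
    have hF : F ≤ IntermediateField.adjoin K X₃ :=
      IntermediateField.adjoin.mono _ _ _ (Set.subset_union_right.trans Set.subset_union_left)
    rintro c (hc | ⟨⟨i, j, e, x, y⟩, rfl⟩)
    · exact hX₃ (Set.mem_union_left _ (Set.mem_union_left _ (Set.mem_union_left _ hc)))
    · change M i j e x y ∈ _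
      rw [Y₂.eq_sum i j e, Matrix.add_apply, Matrix.sum_apply]
      refine add_mem ?_ (sum_mem fun k _ => ?_)
      · refine mul_mem_of_entries (mul_mem_of_entries (fun x y => hF (hincl _ _ _)) fun x y => ?_)
          (fun x y => hF (hretr _ _ _)) x y
        exact hX₃ (Set.mem_union_left _ (Set.mem_union_left _
          (Set.mem_union_right _ ⟨⟨i, j, e, x, y⟩, rfl⟩)))
      · refine mul_mem_of_entries (fun x y => ?_) (fun x y => ?_) x y
        · rw [Matrix.add_apply]
          refine add_mem (mul_mem_of_entries (fun x y => hF (hincl _ _ _)) (fun x y => ?_) x y)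
            (mul_mem_of_entries (fun x y => hF (hsect _ _ _ _)) (fun x y => ?_) x y)
          · exact hX₃ (Set.mem_union_right _ (Set.mem_iUnion.2 ⟨k, ⟨i, j, e, x, y⟩, rfl⟩))
          · exact hX₃ (Set.mem_union_left _ (Set.mem_union_left _ (Set.mem_union_left _
              (hX ⟨⟨i, j, e, x, y⟩, rfl⟩))))
        · rw [hY]
          exact hX₃ (Set.mem_union_left _ (Set.mem_union_right _
            (Set.mem_iUnion.2 ⟨k, ⟨i, x, y⟩, rfl⟩)))
  refine h3.trans (h2.trans ?_)
  rw [Nat.cast_add, ← add_assoc]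
  gcongr

/-- The defect of the parameter count of a filtration, at a brick with `p = c` whose topmost
multiplicity is `n`. -/
def defect (c : ℤ) (n : ℕ) : ℤ := if c = 0 ∨ n = 0 then 0 else -2 * c + 1 - n ^ 2

/-- Here `m` is the multiplicity of a layer, `l` the next multiplicity of the same brick, and `n`
the dimension of the homomorphisms from the rest to the brick. For `c ≥ 1` and `l > 0` the claim
reduces to `2 * m * l ≤ m ^ 2 + l ^ 2`. For `l = 0` it is `(2 * c - 1) * (m ^ 2 - 1) ≥ 0`, and the
constant in `defect` makes this an equality at `m = 1`. -/
theorem defect_step {c : ℤ} (hc : 0 ≤ c) {m n l : ℕ} (hm : 0 < m) (hn : n ≤ l)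
    (h0 : c = 0 → n = 0) :
    2 * m * n + defect c l ≤ 2 * c * m ^ 2 + defect c m := by
  unfold defect
  rcases eq_or_ne c 0 with rfl | hc0
  · simp [h0 rfl]
  have hc1 : 1 ≤ c := by omega
  have hm1 : (1 : ℤ) ≤ m := by exact_mod_cast hm
  rcases eq_or_ne l 0 with rfl | hl
  · obtain rfl : n = 0 := by omega
    simp only [hc0, hm.ne', or_self, or_true, if_true, if_false]
    have h1 : 0 ≤ (2 * c - 1) * ((m : ℤ) ^ 2 - 1) :=
      mul_nonneg (by omega) (by nlinarith)
    push_cast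
    nlinarith
  · simp only [hc0, hm.ne', hl, or_self, if_false]
    have h1 : (n : ℤ) ≤ l := by exact_mod_cast hn
    nlinarith [sq_nonneg ((m : ℤ) - l)]

theorem defect_le {c : ℤ} (hc : 0 ≤ c) {n : ℕ} (hn : 0 < n) : defect c n ≤ -2 * c := by
  unfold defect
  rcases eq_or_ne c 0 with rfl | hc0
  · simp
  · simp only [hc0, hn.ne', or_self, if_false]
    have : (1 : ℤ) ≤ n := by exact_mod_cast hn
    nlinarith

/-- Summed over the layers, the mixed terms assemble into `arrDim α α`. Each layer leaves `2 * m * n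
- 2 * p * m ^ 2`, with `n` the dimension of the homomorphisms from the rest to its brick, and
`defect` absorbs this while remembering only topmost multiplicities. -/
theorem TopFilt.exists_trRk_le {r : ℕ} {β : Fin r → I → ℕ} {S : ∀ t, DRep L (β t)}
    (hS : OrthBricks S) (X : Set L) (hX : ∀ t, Set.range (RArr.entries (S t)) ⊆ X)
    {l : List (Fin r × ℕ)} {α : I → ℕ} {M : DRep L α} (h : TopFilt S l α M)
    (hM : ∀ i, moment M i = 0) :
    ∃ d : ℕ, trRk K (X ∪ Set.range (RArr.entries M)) ≤ trRk K X + d ∧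
      2 * (d : ℤ) ≤ arrDim α α + ∑ t, defect (p (β t)) (firstMult t l) := by
  induction l generalizing α with
  | nil =>
    refine ⟨0, ?_, ?_⟩
    · have : ∀ i, IsEmpty (Fin (α i)) := fun i => by rw [h i]; infer_instance
      have : IsEmpty (RCoord α α) := ⟨fun c => (this _).elim c.2.2.2.1⟩
      rw [Set.range_eq_empty, Set.union_empty]
      simp
    · simp [firstMult, defect]
  | cons a l ih =>
    obtain ⟨t, m⟩ := a
    obtain ⟨hm, α', N, hN, ⟨Y⟩⟩ := h
    obtain ⟨N', Y₁, Y₂, hY, hmV, hle⟩ := Y.exists_trRk_le (K := K) (hS.ne_zero t) hM X (hX t)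
    have hN' : TopFilt S l α' N' := hN.of_layers Y₁ Y₂ hY
    obtain ⟨d, hd, hd2⟩ := ih hN' (Y₂.moment_sub hM)
    refine ⟨d + (m * (vertDim (β t) α - m) +
      m * Module.finrank L (LinearMap.ker (dMoment N' (S t)))), ?_, ?_⟩
    · refine hle.trans ((add_le_add_left hd _).trans ?_)
      rw [Nat.cast_add d, add_assoc]
    · have hα : α = fun i => α' i + m * β t i := funext Y₂.dim_eq
      have h1 := finrank_ker_dMoment_add_le N' (S t)
      have h2 := hN'.finrank_homSpace_le hS t
      have h3 : p (β t) = 0 → Module.finrank L (homSpace N' (S t)) = 0 := fun hp =>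
        hS.finrank_homSpace_eq_zero hp Y₂ hM
      have h4 := defect_step (hS.p_nonneg t) hm h2 h3
      have h5 : vertDim (β t) α = vertDim α' (β t) + m * vertDim (β t) (β t) := by
        rw [hα, vertDim_comm (α := α')]
        simp only [vertDim, mul_add, Finset.sum_add_distrib, Finset.mul_sum]
        congr 1
        exact Finset.sum_congr rfl fun i _ => by ring
      have h6 : arrDim α α = arrDim α' α' + 2 * m * arrDim α' (β t) +
          m ^ 2 * arrDim (β t) (β t) := by
        rw [hα, arrDim_add_mul]
      have h7 := two_mul_p (β t)
      have h8 : ∑ s, defect (p (β s)) (firstMult s ((t, m) :: l)) =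
          ∑ s, defect (p (β s)) (firstMult s l) - defect (p (β t)) (firstMult t l) +
            defect (p (β t)) m := by
        rw [← Finset.add_sum_erase _ _ (Finset.mem_univ t),
          ← Finset.add_sum_erase (a := t) (f := fun s => defect (p (β s)) (firstMult s l)) _
            (Finset.mem_univ t)]
        have : ∀ s ∈ Finset.univ.erase t, defect (p (β s)) (firstMult s ((t, m) :: l)) =
            defect (p (β s)) (firstMult s l) := by
          intro s hs
          simp only [firstMult, if_neg (Finset.ne_of_mem_erase hs).symm]
        rw [Finset.sum_congr rfl this]
        simp only [firstMult, if_true]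
        ring
      rw [h8, h6]
      zify [hmV] at h1 h5 ⊢
      rw [h5]
      have hm0 : (0 : ℤ) ≤ m := by positivity
      have h9 := mul_le_mul_of_nonneg_left h1 hm0
      have h10 : (m : ℤ) ^ 2 * (2 * p (β t)) =
        m ^ 2 * (arrDim (β t) (β t) - 2 * vertDim (β t) (β t) + 2) := by rw [h7]
      nlinarith [h9, h10, h4, hd2]

/-- The parameter count for filtered representations. -/
theorem TopFilt.trRk_le {r : ℕ} {β : Fin r → I → ℕ} {S : ∀ t, DRep L (β t)}
    (hS : OrthBricks S) (X : Set L) (hX : ∀ t, Set.range (RArr.entries (S t)) ⊆ X)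
    {l : List (Fin r × ℕ)} {α : I → ℕ} {M : DRep L α} (h : TopFilt S l α M)
    (hl : ∀ t, 0 < firstMult t l) (hM : ∀ i, moment M i = 0) :
    ∃ d : ℕ, trRk K (X ∪ Set.range (RArr.entries M)) ≤ trRk K X + d ∧
      (d : ℤ) ≤ dotSelf α - 1 + p α - ∑ t, p (β t) := by
  obtain ⟨d, hd, hd2⟩ := h.exists_trRk_le (K := K) hS X hX hM
  refine ⟨d, hd, ?_⟩
  have h1 : ∑ t, defect (p (β t)) (firstMult t l) ≤ ∑ t, (-2 * p (β t)) :=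
    Finset.sum_le_sum fun t _ => defect_le (hS.p_nonneg t) (hl t)
  rw [← Finset.mul_sum] at h1
  have h2 := two_mul_dotSelf_sub_q α
  rw [← h2] at hd2
  rw [p]
  linarith

end Core

/-! ### Germs of representations and transfer to the ultrapower -/

section Germs

variable {K : Type w} [Field K] {Ω : Type w'} {L : Type ww} [Field L] [Algebra K L]
  (π : (Ω → K) →ₐ[K] L)

/-- The germ of a family of matrices. -/
def matGerm {m n : ℕ} (A : Ω → Matrix (Fin m) (Fin n) K) : Matrix (Fin m) (Fin n) L :=
  Matrix.of fun a b => π fun ω => A ω a b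

theorem matGerm_mul {l m n : ℕ} (A : Ω → Matrix (Fin l) (Fin m) K)
    (B : Ω → Matrix (Fin m) (Fin n) K) :
    matGerm π (fun ω => A ω * B ω) = matGerm π A * matGerm π B := by
  ext a b
  simp only [matGerm, Matrix.of_apply, Matrix.mul_apply, ← map_mul, ← map_sum]
  congr 1
  funext ω
  simp

theorem matGerm_add {m n : ℕ} (A B : Ω → Matrix (Fin m) (Fin n) K) :
    matGerm π (fun ω => A ω + B ω) = matGerm π A + matGerm π B := by
  ext a b
  exact map_add π (fun ω => A ω a b) (fun ω => B ω a b)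

theorem matGerm_smul {m n : ℕ} (c : Ω → K) (A : Ω → Matrix (Fin m) (Fin n) K) :
    matGerm π (fun ω => c ω • A ω) = π c • matGerm π A := by
  ext a b
  exact map_mul π c (fun ω => A ω a b)

theorem matGerm_zero {m n : ℕ} :
    matGerm π (fun _ => (0 : Matrix (Fin m) (Fin n) K)) = 0 := by
  ext a b
  exact map_zero π

theorem matGerm_one {n : ℕ} :
    matGerm π (fun _ => (1 : Matrix (Fin n) (Fin n) K)) = 1 := by
  ext a b
  by_cases h : a = b
  · subst h
    simp only [matGerm, Matrix.of_apply, Matrix.one_apply_eq]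
    exact map_one π
  · simp only [matGerm, Matrix.of_apply, Matrix.one_apply_ne h]
    exact map_zero π

theorem matGerm_sum {τ : Type*} (s : Finset τ) {m n : ℕ} (A : τ → Ω → Matrix (Fin m) (Fin n) K) :
    matGerm π (fun ω => ∑ t ∈ s, A t ω) = ∑ t ∈ s, matGerm π (A t) := by
  classical
  induction s using Finset.induction_on with
  | empty => simp [matGerm_zero]
  | insert t s hts ih => simp only [Finset.sum_insert hts, matGerm_add, ih]

theorem matGerm_surjective (hπ : Function.Surjective π) {m n : ℕ} (A : Matrix (Fin m) (Fin n) L) :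
    ∃ B : Ω → Matrix (Fin m) (Fin n) K, matGerm π B = A := by
  choose f hf using hπ
  refine ⟨fun ω => Matrix.of fun a b => f (A a b) ω, ?_⟩
  ext a b
  exact hf _

variable {π} {U : Ultrafilter Ω}

theorem IsUltrapower.eq_iff (hπ : IsUltrapower U π) (f g : Ω → K) :
    π f = π g ↔ ∀ᶠ ω in (U : Filter Ω), f ω = g ω := by
  rw [← sub_eq_zero, ← map_sub, hπ.eq_zero_iff]
  simp only [Pi.sub_apply, sub_eq_zero]

theorem IsUltrapower.matGerm_eq_iff (hπ : IsUltrapower U π) {m n : ℕ}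
    (A B : Ω → Matrix (Fin m) (Fin n) K) :
    matGerm π A = matGerm π B ↔ ∀ᶠ ω in (U : Filter Ω), A ω = B ω := by
  simp only [← Matrix.ext_iff, matGerm, Matrix.of_apply, hπ.eq_iff, Filter.eventually_all]

theorem IsUltrapower.matGerm_congr (hπ : IsUltrapower U π) {m n : ℕ}
    {A B : Ω → Matrix (Fin m) (Fin n) K} (h : ∀ᶠ ω in (U : Filter Ω), A ω = B ω) :
    matGerm π A = matGerm π B :=
  (hπ.matGerm_eq_iff A B).2 h

variable (π)
variable {I : Type u} [Quiver.{v} I] {α α' β γ : I → ℕ}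

/-- The germ of a family of representations. -/
def arrGerm (x : Ω → RArr K α β) : RArr L α β := fun i j e => matGerm π fun ω => x ω i j e

/-- The germ of a family of vertex matrices. -/
def vertGerm (X : Ω → VMat K α β) : VMat L α β := fun i => matGerm π fun ω => X ω i

theorem vertGerm_surjective (hπ : Function.Surjective π) (X : VMat L α β) :
    ∃ Y : Ω → VMat K α β, vertGerm π Y = X := by
  choose Y hY using fun i => matGerm_surjective π hπ (X i)
  exact ⟨fun ω i => Y i ω, funext hY⟩

variable {π} [Fintype I] [∀ i j : I, Fintype (i ⟶ j)]

theorem bimoment_arrGerm (x : Ω → RArr K α γ) (y : Ω → RArr K γ β) (i : I) :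
    bimoment (arrGerm π x) (arrGerm π y) i = matGerm π fun ω => bimoment (x ω) (y ω) i := by
  let x' : RArr (Ω → K) α γ := fun i j e => Matrix.of fun a b ω => x ω i j e a b
  let y' : RArr (Ω → K) γ β := fun i j e => Matrix.of fun a b ω => y ω i j e a b
  have h1 := bimoment_map_ringHom (π : (Ω → K) →+* L) x' y' i
  refine h1.symm.trans ?_
  ext a b
  refine congrArg π (funext fun ω => ?_)
  exact congrFun (congrFun (bimoment_map_ringHom (Pi.evalRingHom (fun _ : Ω => K) ω) x' y' i) a) b

theorem IsUltrapower.isHom_iff (hπ : IsUltrapower U π) (M : Ω → DRep K α) (S : Ω → DRep K β)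
    (X : Ω → VMat K β α) :
    IsHom (arrGerm π M) (arrGerm π S) (vertGerm π X) ↔
      ∀ᶠ ω in (U : Filter Ω), IsHom (M ω) (S ω) (X ω) := by
  simp only [IsHom, arrGerm, vertGerm, ← matGerm_mul, hπ.matGerm_eq_iff, Filter.eventually_all]

/-- Łoś's principle by hand. The matrix identities transfer entrywise; for fullness, a homomorphism
over `L` is written as a germ and its coefficients are chosen pointwise. -/
theorem IsUltrapower.layer (hπ : IsUltrapower U π) {S : Ω → DRep K β} {m : ℕ} {M : Ω → DRep K α}
    {N : Ω → DRep K α'} (h : ∀ᶠ ω in (U : Filter Ω), Nonempty (Layer (S ω) m (M ω) (N ω))) :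
    Nonempty (Layer (arrGerm π S) m (arrGerm π M) (arrGerm π N)) := by
  have h1 : ∀ᶠ ω in (U : Filter Ω), ∃ d : (Fin m → VMat K β α) × VMat K α α' × VMat K α' α ×
      (Fin m → VMat K α β), ∃ Y : Layer (S ω) m (M ω) (N ω),
        Y.proj = d.1 ∧ Y.incl = d.2.1 ∧ Y.retr = d.2.2.1 ∧ Y.sect = d.2.2.2 := by
    filter_upwards [h] with ω ⟨Y⟩
    exact ⟨⟨Y.proj, Y.incl, Y.retr, Y.sect⟩, Y, rfl, rfl, rfl, rfl⟩
  obtain ⟨d, hd⟩ := h1.choice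
  refine ⟨⟨fun k => vertGerm π fun ω => (d ω).1 k, vertGerm π fun ω => (d ω).2.1,
    vertGerm π fun ω => (d ω).2.2.1, fun k => vertGerm π fun ω => (d ω).2.2.2 k, ?_, fun i => ?_,
    fun k i => ?_, fun k i => ?_, fun k l i => ?_, fun i => ?_, ?_, fun k => ?_, fun X hX => ?_⟩⟩
  · obtain ⟨ω, Y, _⟩ := hd.exists
    exact Y.dim_eq
  · rw [vertGerm, vertGerm, ← matGerm_mul, ← matGerm_one π]
    refine hπ.matGerm_congr ?_
    filter_upwards [hd] with ω ⟨Y, h1, h2, h3, h4⟩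
    rw [← h2, ← h3, Y.retr_incl]
  · rw [vertGerm, vertGerm, ← matGerm_mul, ← matGerm_zero π]
    refine hπ.matGerm_congr ?_
    filter_upwards [hd] with ω ⟨Y, h1, h2, h3, h4⟩
    rw [← h1, ← h2, Y.proj_incl]
  · rw [vertGerm, vertGerm, ← matGerm_mul, ← matGerm_zero π]
    refine hπ.matGerm_congr ?_
    filter_upwards [hd] with ω ⟨Y, h1, h2, h3, h4⟩
    rw [← h3, ← h4, Y.retr_sect]
  · have h5 : (if k = l then (1 : Matrix (Fin (β i)) (Fin (β i)) L) else 0) =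
        matGerm π fun _ => if k = l then 1 else 0 := by
      split_ifs
      · rw [matGerm_one]
      · rw [matGerm_zero]
    rw [vertGerm, vertGerm, ← matGerm_mul, h5]
    refine hπ.matGerm_congr ?_
    filter_upwards [hd] with ω ⟨Y, h1, h2, h3, h4⟩
    rw [← h1, ← h4, Y.proj_sect]
  · simp only [vertGerm]
    simp only [← matGerm_mul]
    rw [← matGerm_sum, ← matGerm_add, ← matGerm_one π]
    refine hπ.matGerm_congr ?_
    filter_upwards [hd] with ω ⟨Y, h1, h2, h3, h4⟩
    rw [← h1, ← h2, ← h3, ← h4, Y.sum_eq]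
  · rw [hπ.isHom_iff]
    filter_upwards [hd] with ω ⟨Y, h1, h2, h3, h4⟩
    rw [← h2]
    exact Y.incl_hom
  · rw [hπ.isHom_iff]
    filter_upwards [hd] with ω ⟨Y, h1, h2, h3, h4⟩
    rw [← h1]
    exact Y.proj_hom k
  · obtain ⟨x, rfl⟩ := vertGerm_surjective π hπ.surj X
    rw [hπ.isHom_iff] at hX
    have h5 : ∀ᶠ ω in (U : Filter Ω), ∃ c : Fin m → K, x ω = ∑ k, c k • (d ω).1 k := by
      filter_upwards [hd, hX] with ω ⟨Y, h1, h2, h3, h4⟩ h6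
      rw [← h1]
      exact Y.full _ h6
    obtain ⟨c, hc⟩ := h5.choice
    refine ⟨fun k => π fun ω => c ω k, funext fun i => ?_⟩
    simp only [Finset.sum_apply, Pi.smul_apply, vertGerm]
    simp only [← matGerm_smul]
    rw [← matGerm_sum]
    refine hπ.matGerm_congr ?_
    filter_upwards [hc] with ω h6
    rw [h6]
    simp [Finset.sum_apply]

theorem IsUltrapower.topFilt (hπ : IsUltrapower U π) {r : ℕ} {β : Fin r → I → ℕ}
    {S : Ω → ∀ t, DRep K (β t)} {l : List (Fin r × ℕ)} {α : I → ℕ} {M : Ω → DRep K α}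
    (h : ∀ᶠ ω in (U : Filter Ω), TopFilt (S ω) l α (M ω)) :
    TopFilt (fun t => arrGerm π fun ω => S ω t) l α (arrGerm π M) := by
  induction l generalizing α with
  | nil =>
    obtain ⟨ω, hω⟩ := h.exists
    exact hω
  | cons a l ih =>
    obtain ⟨t, m⟩ := a
    have hm : 0 < m := by
      obtain ⟨ω, hω⟩ := h.exists
      exact hω.1
    -- The dimension vector of the subrepresentation is forced, hence the same for all `ω`, so that
    -- the `N` have a common shape and a germ.
    have h1 : ∀ᶠ ω in (U : Filter Ω), ∃ N : DRep K (fun i => α i - m * β t i),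
        TopFilt (S ω) l _ N ∧ Nonempty (Layer (S ω t) m (M ω) N) := by
      filter_upwards [h] with ω ⟨_, α', N, hN, ⟨Y⟩⟩
      have hα : α' = fun i => α i - m * β t i := by
        funext i
        rw [Y.dim_eq i, Nat.add_sub_cancel]
      subst hα
      exact ⟨N, hN, ⟨Y⟩⟩
    obtain ⟨N, hN⟩ := h1.choice
    exact ⟨hm, _, arrGerm π N, ih (hN.mono fun _ h => h.1), hπ.layer (hN.mono fun _ h => h.2)⟩

theorem IsUltrapower.orthBricks (hπ : IsUltrapower U π) {r : ℕ} {β : Fin r → I → ℕ}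
    {S : Ω → ∀ t, DRep K (β t)} (h : ∀ᶠ ω in (U : Filter Ω), OrthBricks (S ω)) :
    OrthBricks (fun t => arrGerm π fun ω => S ω t) := by
  refine ⟨fun t i => ?_, ?_, fun s t hst X hX => ?_, fun t X hX => ?_⟩
  · rw [moment_eq_bimoment, bimoment_arrGerm, ← matGerm_zero π]
    exact hπ.matGerm_congr (h.mono fun ω hω => hω.moment_eq t i)
  · obtain ⟨ω, hω⟩ := h.exists
    exact hω.ne_zero
  · obtain ⟨x, rfl⟩ := vertGerm_surjective π hπ.surj X
    rw [hπ.isHom_iff] at hX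
    funext i
    rw [Pi.zero_apply, vertGerm, ← matGerm_zero π]
    refine hπ.matGerm_congr ?_
    filter_upwards [h, hX] with ω h1 h2
    rw [h1.hom_ne s t hst _ h2, Pi.zero_apply]
  · obtain ⟨x, rfl⟩ := vertGerm_surjective π hπ.surj X
    rw [hπ.isHom_iff] at hX
    have h5 : ∀ᶠ ω in (U : Filter Ω), ∃ c : K, x ω = fun _ => c • 1 := by
      filter_upwards [h, hX] with ω h1 h2
      exact h1.hom_self t _ h2
    obtain ⟨c, hc⟩ := h5.choice
    refine ⟨π c, funext fun i => ?_⟩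
    rw [vertGerm, ← matGerm_one π, ← matGerm_smul]
    refine hπ.matGerm_congr ?_
    filter_upwards [hc] with ω h6
    rw [h6]

end Germs

/-! ### Replacing the bricks by isomorphic ones -/

section ChangeOfSimples

variable {I : Type u} [Quiver.{v} I] {L : Type w} [Field L]

theorem Layer.changeQuotient {α α' β : I → ℕ} {S S' : DRep L β} {m : ℕ} {M : DRep L α}
    {N : DRep L α'} (Y : Layer S m M N) {G H : VMat L β β} (hHG : ∀ i, H i * G i = 1)
    (hGH : ∀ i, G i * H i = 1) (hG : IsHom S S' G) (hH : IsHom S' S H) :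
    Nonempty (Layer S' m M N) := by
  refine ⟨⟨fun k i => G i * Y.proj k i, Y.incl, Y.retr, fun k i => Y.sect k i * H i, Y.dim_eq,
    Y.retr_incl, fun k i => ?_, fun k i => ?_, fun k l i => ?_, fun i => ?_, Y.incl_hom,
    fun k => hG.comp (Y.proj_hom k), fun X hX => ?_⟩⟩
  · rw [Matrix.mul_assoc, Y.proj_incl, Matrix.mul_zero]
  · rw [← Matrix.mul_assoc, Y.retr_sect, Matrix.zero_mul]
  · rw [Matrix.mul_assoc, ← Matrix.mul_assoc (Y.proj k i), Y.proj_sect]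
    split_ifs
    · rw [Matrix.one_mul, hGH]
    · rw [Matrix.zero_mul, Matrix.mul_zero]
  · rw [← Y.sum_eq i]
    congr 1
    refine Finset.sum_congr rfl fun k _ => ?_
    rw [Matrix.mul_assoc, ← Matrix.mul_assoc (H i), hHG, Matrix.one_mul]
  · obtain ⟨c, hc⟩ := Y.full _ (hH.comp hX)
    refine ⟨c, funext fun i => ?_⟩
    have h1 : X i = G i * (H i * X i) := by rw [← Matrix.mul_assoc, hGH, Matrix.one_mul]
    rw [h1, congrFun hc i]
    simp [Finset.sum_apply, Matrix.mul_sum]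

variable {r : ℕ} {β : Fin r → I → ℕ} {S S' : ∀ t, DRep L (β t)} {G H : ∀ t, VMat L (β t) (β t)}

theorem TopFilt.changeQuotients (hHG : ∀ t i, H t i * G t i = 1) (hGH : ∀ t i, G t i * H t i = 1)
    (hG : ∀ t, IsHom (S t) (S' t) (G t)) (hH : ∀ t, IsHom (S' t) (S t) (H t))
    {l : List (Fin r × ℕ)} {α : I → ℕ} {M : DRep L α} (h : TopFilt S l α M) :
    TopFilt S' l α M := by
  induction l generalizing α with
  | nil => exact h
  | cons a l ih =>
    obtain ⟨hm, α', N, hN, ⟨Y⟩⟩ := h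
    exact ⟨hm, α', N, ih hN, Y.changeQuotient (hHG _) (hGH _) (hG _) (hH _)⟩

variable [Fintype I] [∀ i j : I, Fintype (i ⟶ j)]

theorem OrthBricks.changeQuotients (hGH : ∀ t i, G t i * H t i = 1) (hG : ∀ t, IsHom (S t) (S' t) (G t))
    (hH : ∀ t, IsHom (S' t) (S t) (H t)) (h : OrthBricks S) : OrthBricks S' := by
  have back : ∀ s t (X : VMat L (β t) (β s)) (i : I),
      X i = G t i * (H t i * (X i * G s i)) * H s i := by
    intro s t X i
    rw [← Matrix.mul_assoc (G t i), hGH, Matrix.one_mul, Matrix.mul_assoc, hGH, Matrix.mul_one]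
  refine ⟨fun t i => ?_, h.ne_zero, fun s t hst X hX => ?_, fun t X hX => ?_⟩
  · have e1 : (fun i j e => S' t i j e * G t i : RArr L (β t) (β t)) =
        fun i j e => G t j * S t i j e := by funext i j e; exact (hG t i j e).symm
    have h1 : moment (S' t) i * G t i = 0 := by
      rw [moment_eq_bimoment, ← bimoment_mul_right, e1, ← bimoment_mul_middle, e1,
        bimoment_mul_left, ← moment_eq_bimoment, h.moment_eq, Matrix.mul_zero]
    calc moment (S' t) i = moment (S' t) i * G t i * H t i := by
          rw [Matrix.mul_assoc, hGH, Matrix.mul_one]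
      _ = 0 := by rw [h1, Matrix.zero_mul]
  · have h1 := h.hom_ne s t hst _ ((hH t).comp (hX.comp (hG s)))
    funext i
    rw [back s t X i, congrFun h1 i]
    simp
  · obtain ⟨c, hc⟩ := h.hom_self t _ ((hH t).comp (hX.comp (hG t)))
    refine ⟨c, funext fun i => ?_⟩
    rw [back t t X i, congrFun hc i, Matrix.mul_smul, Matrix.smul_mul, Matrix.mul_one, hGH]

end ChangeOfSimples

/-! ### Nilpotence from traces, and density -/

section Semisimple

/-- In characteristic zero an endomorphism whose positive powers are traceless is nilpotent. -/
theorem isNilpotent_of_trace_pow_eq_zero {F V : Type*} [Field F] [CharZero F] [AddCommGroup V]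
    [Module F V] [Module.Finite F V] (f : Module.End F V)
    (h : ∀ j, LinearMap.trace F V (f ^ (j + 1)) = 0) : IsNilpotent f := by
  classical
  have h0 : minpoly F f ≠ 0 := minpoly.ne_zero (Algebra.IsIntegral.isIntegral f)
  obtain ⟨g, hg, hX⟩ := Polynomial.exists_eq_pow_rootMultiplicity_mul_and_not_dvd _ h0 0
  set n := Polynomial.rootMultiplicity 0 (minpoly F f)
  rw [Polynomial.C_0, sub_zero] at hg hX
  -- `P` will be the projection onto the part where `f` is invertible. It is a polynomial in `f`
  -- divisible by `X`, so its trace vanishes, and an idempotent of trace zero is zero in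
  -- characteristic zero.
  have hcop : IsCoprime ((Polynomial.X : Polynomial F) ^ (n + 1)) g :=
    (Polynomial.irreducible_X.coprime_iff_not_dvd.2 hX).pow_left
  obtain ⟨a, b, hab⟩ := hcop
  let P : Module.End F V := Polynomial.aeval f (a * Polynomial.X ^ (n + 1))
  let R : Module.End F V := Polynomial.aeval f (b * g)
  have hPR : P + R = 1 := by
    simp only [P, R]
    rw [← map_add, hab, map_one]
  have hPR0 : P * R = 0 := by
    simp only [P, R]
    rw [← map_mul, show a * Polynomial.X ^ (n + 1) * (b * g) =
      a * b * Polynomial.X * (Polynomial.X ^ n * g) by ring, ← hg, map_mul, minpoly.aeval,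
      mul_zero]
  have hidem : IsIdempotentElem P := by
    have h1 : P * (P + R) = P := by rw [hPR, mul_one]
    rwa [mul_add, hPR0, add_zero] at h1
  have htr : LinearMap.trace F V P = 0 := by
    simp only [P]
    clear hidem hPR0 hPR R P hab
    induction a using Polynomial.induction_on' with
    | add p q hp hq => rw [add_mul, map_add, map_add, hp, hq, add_zero]
    | monomial m c =>
      rw [← Polynomial.C_mul_X_pow_eq_monomial, mul_assoc, ← pow_add, map_mul,
        Polynomial.aeval_C, map_pow, Polynomial.aeval_X, ← Algebra.smul_def, map_smul,
        ← add_assoc, h, smul_zero]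
  have hP0 : P = 0 := LinearMap.IsIdempotentElem.eq_zero_of_trace_eq_zero hidem htr
  refine ⟨n, ?_⟩
  have h2 : Polynomial.aeval f (Polynomial.X ^ n * (b * g)) = (0 : Module.End F V) := by
    rw [show Polynomial.X ^ n * (b * g) = b * (Polynomial.X ^ n * g) by ring, ← hg, map_mul,
      minpoly.aeval, mul_zero]
  rw [map_mul] at h2
  change _ * R = 0 at h2
  rw [show R = 1 by rw [← hPR, hP0, zero_add], mul_one] at h2
  simpa using h2

/-- Semisimple modules without homomorphisms between them are separated by ring elements. -/
theorem exists_smul_eq_self_and_eq_zero {A P Q : Type*} [Ring A] [AddCommGroup P] [Module A P]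
    [AddCommGroup Q] [Module A Q] [IsSemisimpleModule A P] [IsSemisimpleModule A Q]
    (hPQ : ∀ f : P →ₗ[A] Q, f = 0) (hQP : ∀ f : Q →ₗ[A] P, f = 0) (s : Finset P)
    (s' : Finset Q) : ∃ a : A, (∀ x ∈ s, a • x = x) ∧ ∀ y ∈ s', a • y = 0 := by
  classical
  have hss : IsSemisimpleModule A (P × Q) := by
    refine isSemisimpleModule_of_isSemisimpleModule_submodule' (ι := Bool)
      (p := fun b => cond b (LinearMap.range (LinearMap.inl A P Q))
        (LinearMap.range (LinearMap.inr A P Q))) ?_ ?_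
    · rintro (_ | _)
      · exact IsSemisimpleModule.range _
      · exact IsSemisimpleModule.range _
    · rw [iSup_bool_eq]
      exact LinearMap.sup_range_inl_inr
  -- Without homomorphisms between `P` and `Q`, endomorphisms of `P × Q` are diagonal. So the
  -- projection to `P` commutes with all of them and density applies to it.
  have hcomm : ∀ (g : Module.End A (P × Q)) (z : P × Q), (g (z.1, 0)) = ((g z).1, 0) := by
    intro g z
    have h1 := DFunLike.congr_fun (hPQ (LinearMap.snd A P Q ∘ₗ g ∘ₗ LinearMap.inl A P Q)) z.1
    have h2 := DFunLike.congr_fun (hQP (LinearMap.fst A P Q ∘ₗ g ∘ₗ LinearMap.inr A P Q)) z.2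
    have h3 : g z = g (z.1, 0) + g (0, z.2) := by rw [← map_add]; simp
    simp only [LinearMap.comp_apply, LinearMap.inl_apply, LinearMap.inr_apply, LinearMap.fst_apply,
      LinearMap.snd_apply, LinearMap.zero_apply] at h1 h2
    ext
    · simp [h3, h2]
    · simp [h1]
  let f : Module.End (Module.End A (P × Q)) (P × Q) :=
    { toFun := fun z => (z.1, 0)
      map_add' := fun z z' => by simp
      map_smul' := fun g z => (hcomm g z).symm }
  obtain ⟨a, ha⟩ := jacobson_density f
    (s.image (fun x => (x, (0 : Q))) ∪ s'.image (fun y => ((0 : P), y)))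
  refine ⟨a, fun x hx => ?_, fun y hy => ?_⟩
  · have h1 := ha (x, 0) (Finset.mem_union_left _ (Finset.mem_image_of_mem _ hx))
    exact (congrArg Prod.fst h1).symm
  · have h1 := ha (0, y) (Finset.mem_union_right _ (Finset.mem_image_of_mem _ hy))
    exact (congrArg Prod.snd h1).symm

end Semisimple

/-! ### Representations as modules over a free algebra -/

section Modules

variable {I : Type u} [Quiver.{v} I] {K : Type w} [Field K] {α β γ : I → ℕ}

/-- The free algebra on the idempotents and the arrows of the double, acting through its path
algebra. -/
abbrev FreePathAlgebra (K : Type w) [Field K] (I : Type u) [Quiver.{v} I] : Type (max u v w) :=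
  FreeAlgebra K (I ⊕ Σ (i : I) (j : I), DArrow i j)

/-- The action of a family of vertex matrices on column vectors. -/
def VMat.toLin (X : VMat K β α) : (∀ i, Fin (α i) → K) →ₗ[K] (∀ i, Fin (β i) → K) :=
  LinearMap.pi fun i => (X i).mulVecLin ∘ₗ LinearMap.proj i

@[simp] theorem VMat.toLin_apply (X : VMat K β α) (v : ∀ i, Fin (α i) → K) (i : I) :
    X.toLin v i = Matrix.mulVec (X i) (v i) := rfl

open Classical in
/-- The action of the free path algebra on a representation of the double. -/
noncomputable def repAct (x : DRep K α) :
    FreePathAlgebra K I →ₐ[K] Module.End K (∀ i, Fin (α i) → K) :=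
  FreeAlgebra.lift K <| Sum.elim (fun i => LinearMap.single K _ i ∘ₗ LinearMap.proj i)
    fun e => LinearMap.single K _ e.2.1 ∘ₗ (x e.1 e.2.1 e.2.2).mulVecLin ∘ₗ LinearMap.proj e.1

open Classical in
theorem repAct_inl (x : DRep K α) (i : I) (v : ∀ i, Fin (α i) → K) :
    repAct x (FreeAlgebra.ι K (Sum.inl i)) v = Pi.single i (v i) := by
  simp [repAct]

open Classical in
theorem repAct_inr (x : DRep K α) (i j : I) (e : DArrow i j) (v : ∀ i, Fin (α i) → K) :
    repAct x (FreeAlgebra.ι K (Sum.inr ⟨i, j, e⟩)) v =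
      Pi.single j (Matrix.mulVec (x i j e) (v i)) := by
  simp [repAct]

open Classical in
theorem VMat.toLin_single (X : VMat K β α) (i : I) (v : Fin (α i) → K) :
    X.toLin (Pi.single i v) = Pi.single i (Matrix.mulVec (X i) v) := by
  funext j
  by_cases h : j = i
  · subst h; simp
  · simp [h]

theorem IsHom.toLin_repAct {M : DRep K α} {S : DRep K β} {X : VMat K β α} (hX : IsHom M S X)
    (a : FreePathAlgebra K I) : ∀ v, X.toLin (repAct M a v) = repAct S a (X.toLin v) := by
  classical
  induction a using FreeAlgebra.induction with
  | grade0 c => intro v; simp [AlgHom.commutes, Module.algebraMap_end_apply]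
  | grade1 g =>
    intro v
    rcases g with i | ⟨i, j, e⟩
    · rw [repAct_inl, repAct_inl, VMat.toLin_single]; rfl
    · rw [repAct_inr, repAct_inr, VMat.toLin_single, Matrix.mulVec_mulVec, hX,
        ← Matrix.mulVec_mulVec]; rfl
  | mul a b ha hb => intro v; rw [map_mul, map_mul, Module.End.mul_apply, ha, hb]; rfl
  | add a b ha hb =>
    intro v
    rw [map_add, map_add, LinearMap.add_apply, map_add, ha, hb]; rfl

/-- The space of a representation, as a module over the free path algebra. -/
def RepMod (_ : DRep K α) : Type (max u w) := ∀ i, Fin (α i) → K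

instance (x : DRep K α) : AddCommGroup (RepMod x) :=
  inferInstanceAs (AddCommGroup (∀ i, Fin (α i) → K))

instance (x : DRep K α) : Module K (RepMod x) :=
  inferInstanceAs (Module K (∀ i, Fin (α i) → K))

instance [Finite I] (x : DRep K α) : Module.Finite K (RepMod x) :=
  inferInstanceAs (Module.Finite K (∀ i, Fin (α i) → K))

noncomputable instance (x : DRep K α) : Module (FreePathAlgebra K I) (RepMod x) :=
  Module.compHom (M := ∀ i, Fin (α i) → K) (repAct x).toRingHom

theorem RepMod.smul_def (x : DRep K α) (a : FreePathAlgebra K I) (v : RepMod x) :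
    a • v = (repAct x a v : ∀ i, Fin (α i) → K) := rfl

instance (x : DRep K α) : IsScalarTower K (FreePathAlgebra K I) (RepMod x) where
  smul_assoc c a v := by
    rw [RepMod.smul_def, map_smul]
    rfl

/-- A homomorphism of representations, as a linear map of modules. -/
def IsHom.toLinearMap {M : DRep K α} {S : DRep K β} {X : VMat K β α} (hX : IsHom M S X) :
    RepMod M →ₗ[FreePathAlgebra K I] RepMod S where
  toFun := X.toLin
  map_add' := map_add X.toLin
  map_smul' a v := hX.toLin_repAct a v

/-- Commuting with the idempotent generators makes `f` act vertex by vertex; commuting with the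
arrow generators is then `IsHom`. -/
theorem exists_isHom_of_linearMap {M : DRep K α} {S : DRep K β}
    (f : RepMod M →ₗ[FreePathAlgebra K I] RepMod S) :
    ∃ X : VMat K β α, IsHom M S X ∧ ∀ v, f v = X.toLin v := by
  classical
  let f' : (∀ i, Fin (α i) → K) →ₗ[K] (∀ i, Fin (β i) → K) := f.restrictScalars K
  have hf : ∀ a v, f' (repAct M a v) = repAct S a (f' v) := fun a v => f.map_smul a v
  let X : VMat K β α := fun i =>
    LinearMap.toMatrix'
      (LinearMap.proj i ∘ₗ f' ∘ₗ LinearMap.single K (fun i => Fin (α i) → K) i)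
  have hXi : ∀ i v, Matrix.mulVec (X i) v = f' (Pi.single i v) i := by
    intro i v
    rw [← Matrix.toLin'_apply]
    simp [X]
  have hX : ∀ v i, f' v i = Matrix.mulVec (X i) (v i) := by
    intro v i
    rw [hXi, ← repAct_inl M i v, hf, repAct_inl, Pi.single_eq_same]
  refine ⟨X, fun i j e => ?_, fun v => funext fun i => hX v i⟩
  refine Matrix.toLin'.injective (LinearMap.ext fun v => ?_)
  rw [Matrix.toLin'_apply, Matrix.toLin'_apply, ← Matrix.mulVec_mulVec, ← Matrix.mulVec_mulVec]
  have h1 := congrFun (hf (FreeAlgebra.ι K (Sum.inr ⟨i, j, e⟩)) (Pi.single i v)) j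
  rw [repAct_inr, repAct_inr, hX, hX, Pi.single_eq_same, Pi.single_eq_same, Pi.single_eq_same] at h1
  exact h1

theorem VMat.toLin_injective {X Y : VMat K β α} (h : ∀ v, X.toLin v = Y.toLin v) : X = Y := by
  classical
  funext i
  refine Matrix.toLin'.injective (LinearMap.ext fun v => ?_)
  have h1 := congrFun (h (Pi.single i v)) i
  simpa [VMat.toLin_single] using h1

theorem IsHom.eq_zero_of_linearMap {M : DRep K α} {S : DRep K β}
    (h : ∀ f : RepMod M →ₗ[FreePathAlgebra K I] RepMod S, f = 0) {X : VMat K β α}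
    (hX : IsHom M S X) : X = 0 := by
  refine VMat.toLin_injective fun v => ?_
  have h1 : X.toLin v = 0 := DFunLike.congr_fun (h hX.toLinearMap) v
  rw [h1]
  funext i
  simp

theorem linearMap_eq_zero_of_isHom {M : DRep K α} {S : DRep K β}
    (h : ∀ X, IsHom M S X → X = 0) (f : RepMod M →ₗ[FreePathAlgebra K I] RepMod S) : f = 0 := by
  obtain ⟨X, hX, hf⟩ := exists_isHom_of_linearMap f
  refine LinearMap.ext fun v => ?_
  rw [hf, h X hX]
  funext i
  simp [VMat.toLin]
  rfl

/-- The idempotents split a submodule into vertex components, which form a subrepresentation. -/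
theorem isSimpleModule_of_isSimple [Finite I] {T : DRep K β} (hT : (toLinRep T).IsSimple) :
    IsSimpleModule (FreePathAlgebra K I) (RepMod T) := by
  classical
  cases nonempty_fintype I
  have hsum : ∀ (N : Submodule (FreePathAlgebra K I) (RepMod T)) (w : ∀ i, Fin (β i) → K),
      (∀ i, (Pi.single i (w i) : ∀ i, Fin (β i) → K) ∈ N) → w ∈ N := by
    intro N w h
    have : w = ∑ i, (Pi.single i (w i) : ∀ i, Fin (β i) → K) :=
      (Finset.univ_sum_single w).symm
    rw [this]
    exact Submodule.sum_mem N fun i _ => h i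
  have hsingle : ∀ (N : Submodule (FreePathAlgebra K I) (RepMod T)) (w : ∀ i, Fin (β i) → K),
      w ∈ N → ∀ i, (Pi.single i (w i) : ∀ i, Fin (β i) → K) ∈ N := by
    intro N w h i
    rw [← repAct_inl T i w]
    exact N.smul_mem _ h
  obtain ⟨⟨i0, h0⟩, hU⟩ := hT
  rw [isSimpleModule_iff]
  refine @IsSimpleOrder.mk _ _ _ ?_ ?_
  · obtain ⟨v, hv⟩ := exists_ne (0 : Fin (β i0) → K)
    have : Nontrivial (RepMod T) := by
      refine ⟨⟨(Pi.single i0 v : ∀ i, Fin (β i) → K), 0, fun h => hv ?_⟩⟩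
      have h1 := congrFun h i0
      rw [Pi.single_eq_same] at h1
      exact h1
    infer_instance
  · intro N
    let U : ∀ i, Submodule K (Fin (β i) → K) := fun i =>
      (N.restrictScalars K : Submodule K (RepMod T)).comap
        (LinearMap.single K (fun i => Fin (β i) → K) i)
    have hmem : ∀ i v, v ∈ U i ↔ (Pi.single i v : ∀ i, Fin (β i) → K) ∈ N := fun i v => Iff.rfl
    have hinv : ∀ (i j : I) (e : DArrow i j), ∀ v ∈ U i, toLinRep T i j e v ∈ U j := by
      intro i j e v hv
      have h1 : repAct T (FreeAlgebra.ι K (Sum.inr ⟨i, j, e⟩)) (Pi.single i v) ∈ N :=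
        N.smul_mem _ ((hmem _ _).1 hv)
      rw [repAct_inr, Pi.single_eq_same] at h1
      exact h1
    rcases hU U hinv with h | h
    · left
      rw [eq_bot_iff]
      intro w hw
      refine (funext fun i => ?_ : w = (0 : ∀ i, Fin (β i) → K))
      have h1 : w i ∈ U i := (hmem _ _).2 (hsingle N w hw i)
      rw [h i] at h1
      exact h1
    · right
      rw [eq_top_iff]
      intro w _
      refine hsum N w fun i => (hmem _ _).1 ?_
      rw [h i]
      exact Submodule.mem_top

theorem nontrivial_repMod (M : DRep K α) {i : I} (hi : 0 < α i) : Nontrivial (RepMod M) := by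
  classical
  refine ⟨⟨(Pi.single i (fun _ => 1) : ∀ i, Fin (α i) → K), 0, fun h => ?_⟩⟩
  have h1 := congrFun (congrFun h i) ⟨0, hi⟩
  rw [Pi.single_eq_same] at h1
  exact one_ne_zero h1

/-- Isomorphic modules come from isomorphic representations. -/
theorem iso_of_linearEquiv {S : DRep K α} {T : DRep K β}
    (f : RepMod S ≃ₗ[FreePathAlgebra K I] RepMod T) : (toLinRep S).Iso (toLinRep T) := by
  obtain ⟨X, hX, hfX⟩ := exists_isHom_of_linearMap f.toLinearMap
  obtain ⟨Y, hY, hfY⟩ := exists_isHom_of_linearMap f.symm.toLinearMap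
  have h1 : ∀ i, X i * Y i = 1 := by
    have : (fun i => X i * Y i : VMat K β β) = fun i => 1 := by
      refine VMat.toLin_injective fun v => funext fun i => ?_
      have h2 : f.toLinearMap (f.symm.toLinearMap v) = v := f.apply_symm_apply v
      have h3 := congrFun (((hfX _).trans (congrArg X.toLin (hfY v))).symm.trans h2) i
      rw [VMat.toLin_apply, VMat.toLin_apply] at h3
      rw [VMat.toLin_apply, VMat.toLin_apply, Matrix.one_mulVec, ← Matrix.mulVec_mulVec]
      exact h3
    exact congrFun this
  have h2 : ∀ i, Y i * X i = 1 := by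
    have : (fun i => Y i * X i : VMat K α α) = fun i => 1 := by
      refine VMat.toLin_injective fun v => funext fun i => ?_
      have h2 : f.symm.toLinearMap (f.toLinearMap v) = v := f.symm_apply_apply v
      have h3 := congrFun (((hfY _).trans (congrArg Y.toLin (hfX v))).symm.trans h2) i
      rw [VMat.toLin_apply, VMat.toLin_apply] at h3
      rw [VMat.toLin_apply, VMat.toLin_apply, Matrix.one_mulVec, ← Matrix.mulVec_mulVec]
      exact h3
    exact congrFun this
  refine ⟨fun i => Matrix.toLin'OfInv (h2 i) (h1 i), fun i j e v => ?_⟩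
  change Matrix.mulVec (X j) (Matrix.mulVec (S i j e) v) =
    Matrix.mulVec (T i j e) (Matrix.mulVec (X i) v)
  rw [Matrix.mulVec_mulVec, Matrix.mulVec_mulVec, hX]

variable [Finite I] [IsAlgClosed K]

theorem exists_smul_one_of_isHom_self {T : DRep K β} (hT : (toLinRep T).IsSimple)
    {X : VMat K β β} (hX : IsHom T T X) : ∃ c : K, X = fun _ => c • 1 := by
  have := isSimpleModule_of_isSimple hT
  obtain ⟨c, hc⟩ := (IsSimpleModule.algebraMap_end_bijective_of_isAlgClosed
    (A := FreePathAlgebra K I) (V := RepMod T) K).2 hX.toLinearMap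
  refine ⟨c, VMat.toLin_injective fun v => funext fun i => ?_⟩
  have h1 : c • v = X.toLin v := DFunLike.congr_fun hc v
  rw [← h1, VMat.toLin_apply, Matrix.smul_mulVec, Matrix.one_mulVec]
  rfl

end Modules

/-! ### Simple representations are orthogonal bricks -/

section Bricks

variable {I : Type u} [Fintype I] [Quiver.{v} I] [∀ i j : I, Fintype (i ⟶ j)] {K : Type w}
  [Field K] [IsAlgClosed K]

/-- Pairwise non-isomorphic simple representations are orthogonal bricks. -/
theorem orthBricks_of_isSimple {r : ℕ} {β : Fin r → I → ℕ} {T : ∀ t, DRep K (β t)}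
    (h0 : ∀ t, T t ∈ zeroFibre K (β t)) (hT : ∀ t, (toLinRep (T t)).IsSimple)
    (hne : ∀ s t, s ≠ t → ¬ (toLinRep (T s)).Iso (toLinRep (T t))) : OrthBricks T where
  moment_eq := h0
  ne_zero t := by
    obtain ⟨⟨i, hi⟩, -⟩ := hT t
    refine ⟨i, Nat.pos_of_ne_zero fun h => ?_⟩
    have : IsEmpty (Fin (β t i)) := by rw [h]; infer_instance
    exact not_subsingleton _ (inferInstance : Subsingleton (Fin (β t i) → K))
  hom_ne s t hst X hX := by
    have := isSimpleModule_of_isSimple (hT s)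
    have := isSimpleModule_of_isSimple (hT t)
    refine hX.eq_zero_of_linearMap fun f => ?_
    by_contra hf
    exact hne s t hst (iso_of_linearEquiv
      (LinearEquiv.ofBijective f ((LinearMap.bijective_or_eq_zero f).resolve_right hf)))
  hom_self t X hX := exists_smul_one_of_isHom_self (hT t) hX

end Bricks

/-! ### Trace functions and their additivity -/

section Traces

variable {I : Type u} [Fintype I] [Quiver.{v} I] {K : Type w} [Field K] {α β γ : I → ℕ}

/-- The trace of an element of the free path algebra on a representation. -/
noncomputable def repTrace (x : DRep K α) (a : FreePathAlgebra K I) : K :=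
  LinearMap.trace K (∀ i, Fin (α i) → K) (repAct x a)

theorem VMat.toLin_mul (X : VMat K γ β) (Y : VMat K β α) :
    VMat.toLin (fun i => X i * Y i) = X.toLin ∘ₗ Y.toLin := by
  refine LinearMap.ext fun v => funext fun i => ?_
  simp [Matrix.mulVec_mulVec]

theorem VMat.toLin_one : VMat.toLin (fun i => (1 : Matrix (Fin (α i)) (Fin (α i)) K)) =
    LinearMap.id := by
  refine LinearMap.ext fun v => funext fun i => ?_
  simp

theorem VMat.toLin_add (X Y : VMat K β α) :
    VMat.toLin (fun i => X i + Y i) = X.toLin + Y.toLin := by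
  refine LinearMap.ext fun v => funext fun i => ?_
  simp [Matrix.add_mulVec]

theorem VMat.toLin_sum {ι : Type*} (s : Finset ι) (X : ι → VMat K β α) :
    VMat.toLin (fun i => ∑ k ∈ s, X k i) = ∑ k ∈ s, (X k).toLin := by
  refine LinearMap.ext fun v => funext fun i => ?_
  simp [Matrix.sum_mulVec, LinearMap.sum_apply, Finset.sum_apply]

theorem IsHom.toLin_comp_repAct {M : DRep K α} {S : DRep K β} {X : VMat K β α} (hX : IsHom M S X)
    (a : FreePathAlgebra K I) : X.toLin ∘ₗ repAct M a = repAct S a ∘ₗ X.toLin :=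
  LinearMap.ext (hX.toLin_repAct a)

/-- A homomorphism with a one-sided inverse contributes the trace of its target. -/
theorem IsHom.trace_sect_proj {M : DRep K α} {S : DRep K β} {X : VMat K β α} {Y : VMat K α β}
    (hX : IsHom M S X) (hXY : ∀ i, X i * Y i = 1) (a : FreePathAlgebra K I) :
    LinearMap.trace K (∀ i, Fin (α i) → K) (repAct M a ∘ₗ VMat.toLin (fun i => Y i * X i)) =
      repTrace S a := by
  rw [VMat.toLin_mul, ← LinearMap.comp_assoc, LinearMap.trace_comp_comm', ← LinearMap.comp_assoc,
    hX.toLin_comp_repAct, LinearMap.comp_assoc, ← VMat.toLin_mul]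
  simp only [hXY]
  rw [VMat.toLin_one, LinearMap.comp_id]
  rfl

theorem IsHom.trace_incl_retr {M : DRep K α} {N : DRep K β} {X : VMat K α β} {Y : VMat K β α}
    (hX : IsHom N M X) (hYX : ∀ i, Y i * X i = 1) (a : FreePathAlgebra K I) :
    LinearMap.trace K (∀ i, Fin (α i) → K) (repAct M a ∘ₗ VMat.toLin (fun i => X i * Y i)) =
      repTrace N a := by
  rw [VMat.toLin_mul, ← LinearMap.comp_assoc, ← hX.toLin_comp_repAct, LinearMap.comp_assoc,
    LinearMap.trace_comp_comm', LinearMap.comp_assoc, ← VMat.toLin_mul]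
  simp only [hYX]
  rw [VMat.toLin_one, LinearMap.comp_id]
  rfl

/-- Traces are additive over split families of quotients. -/
theorem repTrace_eq_sum {ι : Type*} [Fintype ι] {M : DRep K α} {b : ι → I → ℕ}
    {S : ∀ k, DRep K (b k)} {X : ∀ k, VMat K (b k) α} {Y : ∀ k, VMat K α (b k)}
    (hX : ∀ k, IsHom M (S k) (X k)) (hXY : ∀ k i, X k i * Y k i = 1)
    (hsum : ∀ i, ∑ k, Y k i * X k i = 1) (a : FreePathAlgebra K I) :
    repTrace M a = ∑ k, repTrace (S k) a := by
  have h1 : repAct M a = ∑ k, repAct M a ∘ₗ VMat.toLin (fun i => Y k i * X k i) := by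
    refine LinearMap.ext fun v => ?_
    have h2 := VMat.toLin_sum Finset.univ fun k i => Y k i * X k i
    simp only [hsum] at h2
    rw [VMat.toLin_one] at h2
    conv_lhs => rw [← LinearMap.id_apply (R := K) v, h2]
    simp [LinearMap.sum_apply, map_sum]
  rw [repTrace, h1, map_sum]
  exact Finset.sum_congr rfl fun k _ => (hX k).trace_sect_proj (hXY k) a

theorem Layer.repTrace_eq {S : DRep K β} {m : ℕ} {M : DRep K α} {N : DRep K γ}
    (Y : Layer S m M N) (a : FreePathAlgebra K I) :
    repTrace M a = repTrace N a + m * repTrace S a := by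
  have h1 : repAct M a = repAct M a ∘ₗ VMat.toLin (fun i => Y.incl i * Y.retr i) +
      ∑ k, repAct M a ∘ₗ VMat.toLin (fun i => Y.sect k i * Y.proj k i) := by
    refine LinearMap.ext fun v => ?_
    have h2 := VMat.toLin_add (fun i => Y.incl i * Y.retr i)
      fun i => ∑ k, Y.sect k i * Y.proj k i
    simp only [Y.sum_eq] at h2
    rw [VMat.toLin_one, VMat.toLin_sum] at h2
    conv_lhs => rw [← LinearMap.id_apply (R := K) v, h2]
    simp [LinearMap.sum_apply, map_sum]
  rw [repTrace, h1, map_add, map_sum, Y.incl_hom.trace_incl_retr Y.retr_incl]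
  congr 1
  rw [Finset.sum_congr rfl fun k _ => (Y.proj_hom k).trace_sect_proj
    (fun i => (Y.proj_sect k k i).trans (if_pos rfl)) a]
  simp

end Traces

/-! ### The largest quotient isotypic for one simple -/

section Composition

variable {I : Type u} [Fintype I] [Quiver.{v} I] {K : Type w} [Field K] {α β : I → ℕ}

/-- A finite set spanning the space of a representation. -/
theorem exists_finset_repMod (M : DRep K α) : ∃ s : Finset (RepMod M),
    ∀ a b : FreePathAlgebra K I, (∀ v ∈ s, a • v = b • v) → repAct M a = repAct M b := by
  obtain ⟨s, hs⟩ := Module.Finite.fg_top (R := K) (M := RepMod M)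
  refine ⟨s, fun a b h => ?_⟩
  refine LinearMap.ext_on hs fun v hv => h v hv

variable [IsAlgClosed K]

/-- Linearly independent homomorphisms to a simple representation have independent rows. -/
theorem eq_zero_of_sum_rows_eq_zero {M : DRep K α} {T : DRep K β} (hT : (toLinRep T).IsSimple)
    {m : ℕ} {P : Fin m → VMat K β α} (hP : ∀ k, IsHom M T (P k)) (hlin : LinearIndependent K P)
    (i : I) (c : Fin m → Fin (β i) → K) (hc : ∀ x, ∑ k, ∑ b, c k b * P k i b x = 0)
    (k : Fin m) (b : Fin (β i)) : c k b = 0 := by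
  classical
  have := isSimpleModule_of_isSimple hT
  let ℓ : Fin m → (∀ i, Fin (β i) → K) → K := fun k v => ∑ b, c k b * v i b
  have hℓ : ∀ v, ∑ k, ℓ k ((P k).toLin v) = 0 := by
    intro v
    have : ∀ k, ℓ k ((P k).toLin v) = ∑ x, (∑ b, c k b * P k i b x) * v i x := by
      intro k
      simp only [ℓ, VMat.toLin_apply, Matrix.mulVec, dotProduct, Finset.mul_sum, Finset.sum_mul]
      rw [Finset.sum_comm]
      exact Finset.sum_congr rfl fun x _ => Finset.sum_congr rfl fun b _ => by ring
    simp only [this]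
    rw [Finset.sum_comm]
    refine Finset.sum_eq_zero fun x _ => ?_
    rw [← Finset.sum_mul, hc, zero_mul]
  -- By density and Schur's lemma every rank one operator on `T` comes from the algebra. Inserted in
  -- the row relation, these operators turn it into a linear relation among the `P k` with
  -- coefficients `ℓ k u`.
  have hop : ∀ (η : Module.Dual K (∀ i, Fin (β i) → K)) (u : ∀ i, Fin (β i) → K),
      ∃ a : FreePathAlgebra K I, ∀ v, repAct T a v = η v • u := by
    intro η u
    let φ : (∀ i, Fin (β i) → K) →ₗ[K] (∀ i, Fin (β i) → K) := η.smulRight u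
    let f : Module.End (Module.End (FreePathAlgebra K I) (RepMod T)) (RepMod T) :=
      { toFun := φ
        map_add' := φ.map_add
        map_smul' := fun g v => by
          obtain ⟨d, rfl⟩ := (IsSimpleModule.algebraMap_end_bijective_of_isAlgClosed K).2 g
          exact φ.map_smul d v }
    obtain ⟨s, hs⟩ := Module.Finite.fg_top (R := K) (M := RepMod T)
    obtain ⟨a, ha⟩ := jacobson_density f s
    refine ⟨a, fun v => ?_⟩
    have h1 : repAct T a = φ := LinearMap.ext_on hs fun v hv => (ha v hv).symm
    rw [h1]; rfl
  have hk : ∀ u k, ℓ k u = 0 := by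
    intro u
    have h1 : ∀ v, ∑ k, ℓ k u • (P k).toLin v = 0 := by
      intro v
      refine (Module.forall_dual_apply_eq_zero_iff K _).1 fun η => ?_
      obtain ⟨a, ha⟩ := hop η u
      have h2 := hℓ (repAct M a v)
      simp only [(hP _).toLin_repAct, ha] at h2
      rw [map_sum, ← h2]
      refine Finset.sum_congr rfl fun k _ => ?_
      simp only [map_smul, ℓ, Pi.smul_apply, smul_eq_mul, Finset.sum_mul]
      exact Finset.sum_congr rfl fun b _ => by ring
    refine Fintype.linearIndependent_iff.1 hlin _ (VMat.toLin_injective fun v => ?_)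
    rw [← show ∑ k, ℓ k u • (P k).toLin v = VMat.toLin (∑ k, ℓ k u • P k) v from ?_, h1]
    · funext i; simp
    · funext i
      simp [Finset.sum_apply, Matrix.sum_mulVec, Matrix.smul_mulVec]
  have h2 := hk (Pi.single i (Pi.single b 1)) k
  simpa [ℓ, Pi.single_apply] using h2


/-- The projections onto the top of a representation isotypic for a simple representation. -/
theorem exists_layer_of_isSimple (M : DRep K α) {T : DRep K β} (hT : (toLinRep T).IsSimple) :
    ∃ (α' : I → ℕ) (N : DRep K α'), Nonempty (Layer T (Module.finrank K (homSpace M T)) M N) := by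
  let b := Module.finBasis K (homSpace M T)
  let P : Fin (Module.finrank K (homSpace M T)) → VMat K β α := fun k => (b k).1
  have hP : ∀ k, IsHom M T (P k) := fun k => mem_homSpace.1 (b k).2
  have hlin : LinearIndependent K P :=
    b.linearIndependent.map' (homSpace M T).subtype (Submodule.ker_subtype _)
  have hind := eq_zero_of_sum_rows_eq_zero hT hP hlin
  have hdim : ∀ i, Module.finrank K (homSpace M T) * β i ≤ α i := by
    intro i
    have h1 : LinearIndependent K fun (kb : Fin (Module.finrank K (homSpace M T)) × Fin (β i)) =>
        P kb.1 i kb.2 := by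
      rw [Fintype.linearIndependent_iff]
      intro g hg kb
      refine hind i (fun k b => g (k, b)) (fun x => ?_) kb.1 kb.2
      have h2 := congrFun hg x
      simpa [Finset.sum_apply, Fintype.sum_prod_type] using h2
    have h2 := h1.fintype_card_le_finrank
    simpa using h2
  obtain ⟨N, Y, -⟩ := Layer.exists_of_independent (K := K) (S := T) (M := M)
    (α' := fun i => α i - Module.finrank K (homSpace M T) * β i) ⊤ (P := P)
    (fun _ _ _ _ => IntermediateField.mem_top)
    (fun i => (Nat.sub_add_cancel (hdim i)).symm) hind hP fun X hX => by
      refine ⟨b.repr ⟨X, mem_homSpace.2 hX⟩, ?_⟩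
      have h1 := congrArg Subtype.val (b.sum_repr ⟨X, mem_homSpace.2 hX⟩)
      refine (h1.symm.trans ?_ : X = _)
      rw [AddSubmonoidClass.coe_finsetSum]
      rfl
  exact ⟨_, N, ⟨Y⟩⟩

end Composition

/-! ### Filtrations obtained from trace functions -/

section Filtration

variable {I : Type u} [Fintype I] [Quiver.{v} I] {K : Type w} [Field K] {α β : I → ℕ}

/-- Density against a finite family of simple representations. -/
theorem exists_smul_eq_self_and_repAct_eq_zero {ι : Type*} [Finite ι] {b : ι → I → ℕ}
    {T : ∀ t, DRep K (b t)} (hT : ∀ t, (toLinRep (T t)).IsSimple) {W : Type*} [AddCommGroup W]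
    [Module (FreePathAlgebra K I) W] [IsSimpleModule (FreePathAlgebra K I) W]
    (hWT : ∀ t (f : W →ₗ[FreePathAlgebra K I] RepMod (T t)), f = 0) (s : Finset W) :
    ∃ a : FreePathAlgebra K I, (∀ x ∈ s, a • x = x) ∧ ∀ t, repAct (T t) a = 0 := by
  classical
  cases nonempty_fintype ι
  have hsimple := fun t => isSimpleModule_of_isSimple (hT t)
  have hTW : ∀ t (f : RepMod (T t) →ₗ[FreePathAlgebra K I] W), f = 0 := by
    intro t f
    by_contra hf
    let e := LinearEquiv.ofBijective f ((LinearMap.bijective_or_eq_zero f).resolve_right hf)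
    have h1 := hWT t e.symm.toLinearMap
    obtain ⟨w, hw⟩ := @exists_ne W (IsSimpleModule.nontrivial (FreePathAlgebra K I) W) 0
    refine hw (e.symm.injective ?_)
    rw [map_zero]
    exact DFunLike.congr_fun h1 w
  choose s' hs' using fun t => exists_finset_repMod (T t)
  obtain ⟨a, ha, ha'⟩ := exists_smul_eq_self_and_eq_zero (A := FreePathAlgebra K I) (P := W)
    (Q := ∀ t, RepMod (T t))
    (fun f => LinearMap.ext fun w => funext fun t =>
      DFunLike.congr_fun (hWT t (LinearMap.proj t ∘ₗ f)) w)
    (fun f => LinearMap.pi_ext' fun t => by rw [hTW t (f ∘ₗ _), LinearMap.zero_comp]) s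
    (Finset.univ.biUnion fun t => (s' t).image fun v => Pi.single t v)
  refine ⟨a, ha, fun t => ?_⟩
  rw [hs' t a 0 fun v hv => ?_, map_zero]
  rw [zero_smul]
  have h1 := congrFun (ha' (Pi.single t v) (Finset.mem_biUnion.2
    ⟨t, Finset.mem_univ _, Finset.mem_image_of_mem _ hv⟩)) t
  rwa [Pi.smul_apply, Pi.single_eq_same] at h1

variable [CharZero K] {r : ℕ} {β : Fin r → I → ℕ} {T : ∀ t, DRep K (β t)}

/-- A nonzero representation whose trace function is a combination of those of simple
representations maps nontrivially to one of them. -/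
theorem exists_isHom_ne_zero (hT : ∀ t, (toLinRep (T t)).IsSimple) {M : DRep K α}
    (hM : ∃ i, 0 < α i) (c : Fin r → ℤ)
    (htr : ∀ a, repTrace M a = ∑ t, (c t : K) * repTrace (T t) a) :
    ∃ t X, IsHom M (T t) X ∧ X ≠ 0 := by
  by_contra! hno
  obtain ⟨i, hi⟩ := hM
  have := nontrivial_repMod M hi
  have : IsNoetherian (FreePathAlgebra K I) (RepMod M) := isNoetherian_of_tower K inferInstance
  -- A simple quotient of `M` now maps to no `T t`, so density gives `a` fixing a nonzero vector `w`
  -- of it and acting as zero on every `T t`. All positive powers of `a` are traceless on `M`, so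
  -- `a` is nilpotent there, which contradicts `a • w = w`.
  obtain ⟨N, hN, -⟩ := (eq_top_or_exists_le_coatom
    (⊥ : Submodule (FreePathAlgebra K I) (RepMod M))).resolve_left bot_ne_top
  have hW : IsSimpleModule (FreePathAlgebra K I) (RepMod M ⧸ N) := isSimpleModule_iff_isCoatom.2 hN
  obtain ⟨w, hw⟩ := @exists_ne (RepMod M ⧸ N) (IsSimpleModule.nontrivial (FreePathAlgebra K I) _) 0
  obtain ⟨a, ha, ha'⟩ := exists_smul_eq_self_and_repAct_eq_zero hT (W := RepMod M ⧸ N)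
    (fun t f => Submodule.linearMap_qext N (by
      rw [LinearMap.zero_comp]
      exact linearMap_eq_zero_of_isHom (hno t) _)) {w}
  obtain ⟨n, hn⟩ := isNilpotent_of_trace_pow_eq_zero (repAct M a) fun j => by
    rw [← map_pow]
    refine (htr _).trans (Finset.sum_eq_zero fun t _ => ?_)
    rw [repTrace, map_pow, ha', zero_pow (Nat.succ_ne_zero j), map_zero, mul_zero]
  obtain ⟨v, rfl⟩ := Submodule.mkQ_surjective N w
  have h1 : ∀ n : ℕ, a ^ n • N.mkQ v = N.mkQ v := by
    intro n
    induction n with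
    | zero => rw [pow_zero, one_smul]
    | succ n ih => rw [pow_succ, mul_smul, ha _ (Finset.mem_singleton_self _), ih]
  apply hw
  rw [← h1 n, ← map_smul]
  have h2 : a ^ n • v = 0 := by
    have h3 : repAct M (a ^ n) v = 0 := by rw [map_pow, hn]; rfl
    exact h3
  rw [h2, map_zero]

theorem repTrace_eq_zero {M : DRep K α} (h : ∀ i, α i = 0) (a : FreePathAlgebra K I) :
    repTrace M a = 0 := by
  have : Subsingleton (∀ i, Fin (α i) → K) := by
    refine ⟨fun v w => funext fun i => funext fun b => ?_⟩
    have : IsEmpty (Fin (α i)) := by rw [h i]; infer_instance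
    exact isEmptyElim b
  rw [repTrace, Subsingleton.elim (repAct M a) 0, map_zero]

/-- Trace functions of non-isomorphic simple representations are linearly independent. -/
theorem eq_zero_of_sum_repTrace (hT : ∀ t, (toLinRep (T t)).IsSimple)
    (hne : ∀ s t, s ≠ t → ∀ X, IsHom (T s) (T t) X → X = 0) (c : Fin r → ℤ)
    (htr : ∀ a, ∑ t, (c t : K) * repTrace (T t) a = 0) (t : Fin r) : c t = 0 := by
  have := isSimpleModule_of_isSimple (hT t)
  obtain ⟨s, hs⟩ := exists_finset_repMod (T t)
  -- Acting as the identity on `T t` and as zero on the others, `a` isolates `c t` times a dimension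
  -- that is nonzero in `K`.
  obtain ⟨a, ha, ha'⟩ := exists_smul_eq_self_and_repAct_eq_zero
    (ι := {s : Fin r // s ≠ t}) (T := fun s => T s.1) (fun s => hT s.1) (W := RepMod (T t))
    (fun s f => linearMap_eq_zero_of_isHom (hne t s.1 s.2.symm) f) s
  have h1 : repAct (T t) a = 1 := by
    rw [hs a 1 fun v hv => by rw [ha v hv, one_smul], map_one]
  have h2 := htr a
  rw [Finset.sum_eq_single t, repTrace, h1, LinearMap.trace_one] at h2
  · rcases mul_eq_zero.1 h2 with h3 | h3
    · exact_mod_cast h3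
    · exfalso
      have h4 : Module.finrank K (RepMod (T t)) = 0 := by exact_mod_cast h3
      have : Nontrivial (RepMod (T t)) := IsSimpleModule.nontrivial (FreePathAlgebra K I) _
      exact Module.finrank_pos.ne' h4
  · intro s _ hst
    rw [repTrace, ha' ⟨s, hst⟩, map_zero, mul_zero]
  · intro h; exact absurd (Finset.mem_univ t) h

/-- A representation whose trace function is a combination of those of non-isomorphic simple
representations has a filtration by them, involving all those with nonzero coefficient. -/
theorem exists_topFilt [IsAlgClosed K] (hT : ∀ t, (toLinRep (T t)).IsSimple)
    (hβ : ∀ t, ∃ i, 0 < β t i) (hne : ∀ s t, s ≠ t → ∀ X, IsHom (T s) (T t) X → X = 0) (n : ℕ) :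
    ∀ (α : I → ℕ) (M : DRep K α) (c : Fin r → ℤ), ∑ i, α i ≤ n →
      (∀ a, repTrace M a = ∑ t, (c t : K) * repTrace (T t) a) →
      ∃ l, TopFilt T l α M ∧ ∀ t, c t ≠ 0 → 0 < firstMult t l := by
  induction n with
  | zero =>
    intro α M c hα htr
    have h0 : ∀ i, α i = 0 := fun i =>
      Finset.sum_eq_zero_iff.1 (Nat.le_zero.1 hα) i (Finset.mem_univ i)
    refine ⟨[], h0, fun t ht => absurd (eq_zero_of_sum_repTrace hT hne c (fun a => ?_) t) ht⟩
    rw [← htr, repTrace_eq_zero h0]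
  | succ n ih =>
    intro α M c hα htr
    by_cases h0 : ∀ i, α i = 0
    · refine ⟨[], h0, fun t ht => absurd (eq_zero_of_sum_repTrace hT hne c (fun a => ?_) t) ht⟩
      rw [← htr, repTrace_eq_zero h0]
    push Not at h0
    obtain ⟨i0, hi0⟩ := h0
    obtain ⟨t, X, hX, hX0⟩ := exists_isHom_ne_zero hT ⟨i0, Nat.pos_of_ne_zero hi0⟩ c htr
    obtain ⟨α', N, ⟨Y⟩⟩ := exists_layer_of_isSimple M (hT t)
    set m := Module.finrank K (homSpace M (T t)) with hm
    have hmpos : 0 < m := by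
      have : Nontrivial (homSpace M (T t)) :=
        ⟨⟨⟨X, mem_homSpace.2 hX⟩, 0, fun h => hX0 (congrArg Subtype.val h)⟩⟩
      exact Module.finrank_pos
    have hlt : ∑ i, α' i < ∑ i, α i := by
      obtain ⟨i, hi⟩ := hβ t
      refine Finset.sum_lt_sum (fun i _ => by rw [Y.dim_eq i]; omega) ⟨i, Finset.mem_univ i, ?_⟩
      have := Nat.mul_pos hmpos hi
      rw [Y.dim_eq i]; omega
    -- The coefficients are integers because nothing yet shows `m ≤ c t`. Independence of the trace
    -- functions forces every nonzero coefficient to be used before dimension zero is reached.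
    obtain ⟨l, hl, hlc⟩ := ih α' N (fun s => c s - if s = t then (m : ℤ) else 0) (by omega) <| by
      intro a
      rw [eq_sub_of_add_eq (Y.repTrace_eq a).symm, htr]
      push_cast
      simp [sub_mul, Finset.sum_sub_distrib, ite_mul]
    refine ⟨(t, m) :: l, ⟨hmpos, α', N, hl, ⟨Y⟩⟩, fun s hs => ?_⟩
    by_cases hst : t = s
    · simpa [firstMult, hst] using hmpos
    · simp only [firstMult, if_neg hst]
      refine hlc s ?_
      rwa [if_neg (Ne.symm hst), sub_zero]

end Filtration

/-! ### Trace invariants on the fibres of the quotient map -/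

section Invariants

variable {I : Type u} [Fintype I] [Quiver.{v} I] [∀ i j : I, Fintype (i ⟶ j)] {K : Type w}
  [Field K] {α : I → ℕ}

/-- The vector `v` varies with the point so that the induction passes through products. -/
theorem repAct_mem_coordRing (a : FreePathAlgebra K I) :
    ∀ v : zeroFibre K α → (∀ i, Fin (α i) → K), (∀ i b, (fun z => v z i b) ∈ coordRing K α) →
      ∀ i b, (fun z : zeroFibre K α => repAct (α := α) z.1 a (v z) i b) ∈ coordRing K α := by
  classical
  induction a using FreeAlgebra.induction with
  | grade0 c =>
    intro v hv i b
    simp only [AlgHom.commutes, Module.algebraMap_end_apply]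
    exact (coordRing K α).smul_mem (hv i b) c
  | grade1 g =>
    intro v hv i b
    rcases g with j | ⟨j, k, e⟩
    · simp only [repAct_inl]
      by_cases h : i = j
      · subst h
        simpa only [Pi.single_eq_same] using hv i b
      · simp only [Pi.single_eq_of_ne h]
        exact (coordRing K α).zero_mem
    · simp only [repAct_inr]
      by_cases h : i = k
      · subst h
        simp only [Pi.single_eq_same, Matrix.mulVec, dotProduct]
        have h1 : (fun z : zeroFibre K α => ∑ x, z.1 j i e b x * v z j x) =
            ∑ x, (fun z : zeroFibre K α => z.1 j i e b x) * fun z => v z j x := by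
          funext z
          simp [Finset.sum_apply]
        rw [h1]
        refine Subalgebra.sum_mem _ fun x _ => Subalgebra.mul_mem _ ?_ (hv j x)
        exact ⟨MvPolynomial.X ⟨j, i, e, b, x⟩, MvPolynomial.aeval_X _ _⟩
      · simp only [Pi.single_eq_of_ne h]
        exact (coordRing K α).zero_mem
  | mul a b ha hb =>
    intro v hv i x
    simp only [map_mul, Module.End.mul_apply]
    exact ha _ (hb v hv) i x
  | add a b ha hb =>
    intro v hv i x
    simp only [map_add, LinearMap.add_apply, Pi.add_apply]
    exact Subalgebra.add_mem _ (ha v hv i x) (hb v hv i x)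

theorem repTrace_mem_invRing (a : FreePathAlgebra K I) :
    (fun z : zeroFibre K α => repTrace z.1 a) ∈ invRing K α := by
  classical
  refine ⟨?_, fun g x y hxy => ?_⟩
  · have h1 : (fun z : zeroFibre K α => repTrace z.1 a) = ∑ c : Σ i, Fin (α i),
        fun z : zeroFibre K α => repAct z.1 a (Pi.single c.1 (Pi.single c.2 1)) c.1 c.2 := by
      funext z
      rw [repTrace, LinearMap.trace_eq_matrix_trace K (Pi.basis fun i => Pi.basisFun K (Fin (α i))),
        Matrix.trace, Finset.sum_apply]
      refine Finset.sum_congr rfl fun c _ => ?_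
      simp [LinearMap.toMatrix_apply, Pi.basis_repr, Pi.basis_apply]
    rw [h1]
    refine Subalgebra.sum_mem _ fun c _ => repAct_mem_coordRing a _ (fun i b => ?_) c.1 c.2
    exact (coordRing K α).algebraMap_mem
      ((Pi.single c.1 (Pi.single c.2 1) : ∀ i, Fin (α i) → K) i b)
  · have h1 := repTrace_eq_sum (ι := Unit) (M := x.1) (S := fun _ => y.1)
      (X := fun _ i => (g i).1) (Y := fun _ i => (g i)⁻¹.1) (fun _ i j e => ?_) (fun _ i => ?_)
      (fun i => ?_) a
    · simpa using h1.symm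
    · rw [hxy, QuiverReduction.conj, Matrix.mul_assoc _ _ (g i).1, ← Units.val_mul,
        inv_mul_cancel, Units.val_one, Matrix.mul_one]
    · exact (g i).mul_inv
    · rw [Finset.sum_const, Finset.card_univ, Fintype.card_unit, one_smul]
      exact (g i).inv_mul

/-- This is all that is needed from the quotient: trace invariants are constant on its fibres. -/
theorem repTrace_eq_of_quotMap_eq {y z : zeroFibre K α} (h : quotMap z = quotMap y)
    (a : FreePathAlgebra K I) : repTrace z.1 a = repTrace y.1 a :=
  DFunLike.congr_fun h ⟨_, repTrace_mem_invRing a⟩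

theorem repTrace_eq_of_iso_sumPow {r : ℕ} {k : Fin r → ℕ} {β : Fin r → I → ℕ} {y : DRep K α}
    {T : ∀ t, DRep K (β t)} (h : (toLinRep y).Iso (LinRep.sumPow k fun t => toLinRep (T t)))
    (a : FreePathAlgebra K I) : repTrace y a = ∑ t, (k t : K) * repTrace (T t) a := by
  classical
  obtain ⟨f, hf⟩ := h
  let X : ∀ ts : Σ t, Fin (k t), VMat K (β ts.1) α := fun ts i => LinearMap.toMatrix'
    (LinearMap.proj ts.2 ∘ₗ LinearMap.proj (φ := fun t => Fin (k t) → Fin (β t i) → K) ts.1 ∘ₗ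
      (f i).toLinearMap)
  let Y : ∀ ts : Σ t, Fin (k t), VMat K α (β ts.1) := fun ts i => LinearMap.toMatrix'
    ((f i).symm.toLinearMap ∘ₗ LinearMap.single K (fun t => Fin (k t) → Fin (β t i) → K) ts.1 ∘ₗ
      LinearMap.single K (fun _ : Fin (k ts.1) => Fin (β ts.1 i) → K) ts.2)
  have hX : ∀ ts i v, Matrix.mulVec (X ts i) v = f i v ts.1 ts.2 := fun ts i v => by
    rw [← Matrix.toLin'_apply]; simp [X]
  have hY : ∀ ts i v, Matrix.mulVec (Y ts i) v =
      (f i).symm (Pi.single ts.1 (Pi.single ts.2 v)) := fun ts i v => by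
    rw [← Matrix.toLin'_apply]; simp [Y]
  rw [repTrace_eq_sum (S := fun ts : Σ t, Fin (k t) => T ts.1) (X := X) (Y := Y), Fintype.sum_sigma]
  · simp
  · intro ts i j e
    refine Matrix.toLin'.injective (LinearMap.ext fun v => ?_)
    rw [Matrix.toLin'_apply, Matrix.toLin'_apply, ← Matrix.mulVec_mulVec, ← Matrix.mulVec_mulVec,
      hX, hX]
    exact congrFun (congrFun (hf i j e v) ts.1) ts.2
  · intro ts i
    refine Matrix.toLin'.injective (LinearMap.ext fun v => ?_)
    rw [Matrix.toLin'_apply, ← Matrix.mulVec_mulVec, hX, hY, LinearEquiv.apply_symm_apply]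
    simp
  · intro i
    refine Matrix.toLin'.injective (LinearMap.ext fun v => (f i).injective ?_)
    rw [Matrix.toLin'_apply, Matrix.sum_mulVec, map_sum]
    simp only [← Matrix.mulVec_mulVec, hX, hY, LinearEquiv.apply_symm_apply]
    rw [Fintype.sum_sigma]
    funext t s
    simp only [Finset.sum_apply, Matrix.toLin'_one, LinearMap.id_apply]
    rw [Finset.sum_eq_single t (fun t' _ ht' => Finset.sum_eq_zero fun s' _ => by
        rw [Pi.single_eq_of_ne (Ne.symm ht')]; rfl)
      (fun h => absurd (Finset.mem_univ t) h)]
    rw [Finset.sum_eq_single s (fun s' _ hs' => by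
        rw [Pi.single_eq_same, Pi.single_eq_of_ne (Ne.symm hs')])
      (fun h => absurd (Finset.mem_univ s) h)]
    simp

/-- The filtration of a point with a given semisimplification. -/
theorem exists_topFilt_of_quotMap_eq [IsAlgClosed K] [CharZero K] {r : ℕ} {k : Fin r → ℕ}
    {β : Fin r → I → ℕ} {T : ∀ t, DRep K (β t)} {y z : zeroFibre K α} (hk : ∀ t, 0 < k t)
    (hS : OrthBricks T) (hT : ∀ t, (toLinRep (T t)).IsSimple)
    (hy : (toLinRep y.1).Iso (LinRep.sumPow k fun t => toLinRep (T t)))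
    (h : quotMap z = quotMap y) : ∃ l, TopFilt T l α z.1 ∧ ∀ t, 0 < firstMult t l := by
  obtain ⟨l, hl, hlt⟩ := exists_topFilt hT hS.ne_zero hS.hom_ne (∑ i, α i) α z.1
    (fun t => (k t : ℤ)) le_rfl fun a => by
      rw [repTrace_eq_of_quotMap_eq h, repTrace_eq_of_iso_sumPow hy]
      push_cast
      rfl
  exact ⟨l, hl, fun t => hlt t (by have := hk t; omega)⟩

end Invariants

/-! ### Finitely many types of filtration -/

section Finiteness

variable {I : Type u} [Fintype I] [Quiver.{v} I] {K : Type w} [Field K] {r : ℕ}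
  {β : Fin r → I → ℕ}

/-- The length is bounded as well, since multiplicities in an arbitrary list may be zero. -/
theorem finite_list_length_add_sum_le (n : ℕ) :
    {l : List (Fin r × ℕ) | l.length + (l.map Prod.snd).sum ≤ n}.Finite := by
  induction n with
  | zero =>
    refine (Set.finite_singleton []).subset fun l hl => ?_
    have h1 : l.length = 0 := by
      have : l.length + (l.map Prod.snd).sum ≤ 0 := hl
      omega
    exact List.length_eq_zero_iff.1 h1
  | succ n ih =>
    refine ((Set.finite_singleton ([] : List (Fin r × ℕ))).union
      (((Set.finite_univ (α := Fin r)).prod (Set.finite_Iic (n + 1))).image2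
        (fun a l => a :: l) ih)).subset fun l hl => ?_
    cases l with
    | nil => exact Or.inl rfl
    | cons a l =>
      right
      have h1 : l.length + 1 + (a.2 + (l.map Prod.snd).sum) ≤ n + 1 := by
        simpa using hl
      refine ⟨a, ⟨Set.mem_univ _, ?_⟩, l, ?_, rfl⟩
      · change a.2 ≤ n + 1
        omega
      · change l.length + (l.map Prod.snd).sum ≤ n
        omega

/-- Positive multiplicities make the length at most their sum, and the sum is at most the total
dimension; hence the factor `2`. -/
theorem TopFilt.length_add_sum_le (hβ : ∀ t, ∃ i, 0 < β t i) {S : ∀ t, DRep K (β t)}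
    {l : List (Fin r × ℕ)} : ∀ {α : I → ℕ} {M : DRep K α}, TopFilt S l α M →
      l.length + (l.map Prod.snd).sum ≤ 2 * ∑ i, α i := by
  induction l with
  | nil => intro α M _; simp
  | cons a l ih =>
    intro α M h
    obtain ⟨hm, α', N, hN, ⟨Y⟩⟩ := h
    have h1 := ih hN
    have h2 : ∑ i, α i = ∑ i, α' i + a.2 * ∑ i, β a.1 i := by
      rw [Finset.mul_sum, ← Finset.sum_add_distrib]
      exact Finset.sum_congr rfl fun i _ => Y.dim_eq i
    have h3 : 0 < ∑ i, β a.1 i := by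
      obtain ⟨i, hi⟩ := hβ a.1
      exact Finset.sum_pos' (fun _ _ => Nat.zero_le _) ⟨i, Finset.mem_univ i, hi⟩
    have h4 : a.2 * 1 ≤ a.2 * ∑ i, β a.1 i := Nat.mul_le_mul_left _ h3
    simp only [List.length_cons, List.map_cons, List.sum_cons]
    have h5 : 0 < a.2 := hm
    omega

/-- Along an ultrafilter, filtrations have eventually the same type. -/
theorem exists_eventually_topFilt {Ω : Type*} (U : Ultrafilter Ω) {α : I → ℕ}
    (hβ : ∀ t, ∃ i, 0 < β t i) {S : Ω → ∀ t, DRep K (β t)} {M : Ω → DRep K α}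
    (h : ∀ ω, ∃ l, TopFilt (S ω) l α (M ω) ∧ ∀ t, 0 < firstMult t l) :
    ∃ l, (∀ᶠ ω in U, TopFilt (S ω) l α (M ω)) ∧ ∀ t, 0 < firstMult t l := by
  obtain ⟨l, -, hl⟩ := (U.eventually_exists_mem_iff (P := fun l ω => TopFilt (S ω) l α (M ω) ∧
    ∀ t, 0 < firstMult t l) (finite_list_length_add_sum_le (r := r) (2 * ∑ i, α i))).1
    (Filter.Eventually.of_forall fun ω => by
      obtain ⟨l, hl, hl'⟩ := h ω
      exact ⟨l, hl.length_add_sum_le hβ, hl, hl'⟩)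
  obtain ⟨ω, hω⟩ := hl.exists
  exact ⟨l, hl.mono fun ω h => h.1, hω.2⟩

end Finiteness

/-! ### Transcendence degree in towers -/

section Towers

variable {K L L' : Type*} [Field K] [Field L] [Field L'] [Algebra K L] [Algebra K L']
  [Algebra L L'] [IsScalarTower K L L']

theorem trRk_le_trRk_image (X : Set L) : trRk K X ≤ trRk K (algebraMap L L' '' X) := by
  obtain ⟨B, hB⟩ := (AlgebraicIndependent.matroid K L).exists_isBasis' X
  have h1 : AlgebraicIndependent K fun b : B => (b : L) :=
    AlgebraicIndependent.matroid_indep_iff.1 hB.indep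
  have hinj : Function.Injective (algebraMap L L') := (algebraMap L L').injective
  have h2 : (AlgebraicIndependent.matroid K L').Indep (algebraMap L L' '' B) := by
    refine AlgebraicIndependent.matroid_indep_iff.2 ?_
    have h3 := (h1.map' (f := IsScalarTower.toAlgHom K L L') hinj).to_subtype_range
    rw [Set.range_comp, Subtype.range_coe] at h3
    exact h3
  rw [trRk, hB.eRk_eq_encard, ← hinj.encard_image, ← h2.eRk_eq_encard]
  exact Matroid.eRk_mono _ (Set.image_mono hB.subset)

/-- A transcendence basis of `X` comes from `L`, so joined to a family independent over `L` it stays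
independent over `K`. -/
theorem trRk_add_card_le {J : Type*} [Fintype J] {y : J → L'} (hy : AlgebraicIndependent L y)
    {X : Set L'} (hX : X ⊆ Set.range (algebraMap L L')) :
    trRk K X + Fintype.card J ≤ trRk K (X ∪ Set.range y) := by
  obtain ⟨B, hB⟩ := (AlgebraicIndependent.matroid K L').exists_isBasis' X
  have h1 : AlgebraicIndependent K fun b : B => (b : L') :=
    AlgebraicIndependent.matroid_indep_iff.1 hB.indep
  have h2 := h1.sumElim_of_tower (S := L) (by
    rw [Subtype.range_coe]
    exact hB.subset.trans hX) hy
  have h3 : (AlgebraicIndependent.matroid K L').Indep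
      (Set.range (Sum.elim y fun b : B => (b : L'))) :=
    AlgebraicIndependent.matroid_indep_iff.2 h2.to_subtype_range
  have h4 : Set.range (Sum.elim y fun b : B => (b : L')) ⊆ X ∪ Set.range y := by
    rw [Set.Sum.elim_range, Subtype.range_coe]
    exact Set.union_subset Set.subset_union_right (hB.subset.trans Set.subset_union_left)
  refine le_trans ?_ (Matroid.eRk_mono _ h4)
  rw [trRk, hB.eRk_eq_encard, h3.eRk_eq_encard, ← Set.image_univ, h2.injective.encard_image,
    Set.encard_univ, ENat.card_sum, add_comm, ENat.card_eq_coe_fintype_card]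
  rfl

theorem trRk_eq_zero_of_subset_range {X : Set L} (hX : X ⊆ Set.range (algebraMap K L)) :
    trRk K X = 0 := by
  refine le_antisymm ?_ bot_le
  have h1 : X ⊆ IntermediateField.adjoin K (∅ : Set L) := by
    rintro _ hx
    obtain ⟨c, rfl⟩ := hX hx
    exact IntermediateField.algebraMap_mem _ c
  refine (trRk_le_of_subset_adjoin h1).trans ?_
  rw [trRk, Matroid.eRk_empty]

end Towers

/-! ### Generic conjugation and varying bricks -/

section Generic

variable {I : Type u} [Fintype I] [Quiver.{v} I] [∀ i j : I, Fintype (i ⟶ j)]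

/-- The coordinates on a product of general linear groups are algebraically independent. -/
theorem algebraicIndependent_glCoord (L : Type w) [Field L] [Infinite L] {r : ℕ}
    (β : Fin r → I → ℕ) :
    AlgebraicIndependent L fun (c : Σ t, VCoord (β t) (β t)) (ω : ∀ t, GLProd L (β t)) =>
      VMat.entries (fun i => (ω c.1 i).1) c.2 := by
  classical
  rw [AlgebraicIndependent, injective_iff_map_eq_zero]
  intro P hP
  let A : ∀ t i, Matrix (Fin (β t i)) (Fin (β t i)) (MvPolynomial (Σ t, VCoord (β t) (β t)) L) :=
    fun t i => Matrix.of fun a b => MvPolynomial.X ⟨t, i, a, b⟩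
  -- Where `D` does not vanish the matrices are invertible, so `P` vanishes. Thus `P * D` is zero
  -- everywhere, hence zero as a polynomial over an infinite field.
  let D : MvPolynomial (Σ t, VCoord (β t) (β t)) L := ∏ t, ∏ i, (A t i).det
  have hev : ∀ x t i, MvPolynomial.eval x (A t i).det =
      (Matrix.of fun a b => x ⟨t, i, a, b⟩ : Matrix (Fin (β t i)) (Fin (β t i)) L).det := by
    intro x t i
    rw [RingHom.map_det]
    congr 1
    ext a b
    simp [A]
  have hD : D ≠ 0 := by
    intro h
    have h1 := congrArg (MvPolynomial.eval fun c : Σ t, VCoord (β t) (β t) =>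
      (1 : Matrix (Fin (β c.1 c.2.1)) (Fin (β c.1 c.2.1)) L) c.2.2.1 c.2.2.2) h
    simp only [D, map_prod, hev, map_zero] at h1
    have h2 : ∀ t i, (Matrix.of fun a b => (1 : Matrix (Fin (β t i)) (Fin (β t i)) L) a b).det =
        1 := fun t i => Matrix.det_one
    simp only [h2, Finset.prod_const_one] at h1
    exact one_ne_zero h1
  have hPD : P * D = 0 := by
    refine MvPolynomial.funext fun x => ?_
    rw [map_zero, map_mul]
    by_cases hx : MvPolynomial.eval x D = 0
    · rw [hx, mul_zero]
    have hdet : ∀ t i, IsUnit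
        (Matrix.of fun a b => x ⟨t, i, a, b⟩ : Matrix (Fin (β t i)) (Fin (β t i)) L).det := by
      intro t i
      rw [isUnit_iff_ne_zero, ← hev]
      simp only [D, map_prod] at hx
      exact Finset.prod_ne_zero_iff.1 (Finset.prod_ne_zero_iff.1 hx t (Finset.mem_univ t)) i
        (Finset.mem_univ i)
    have h1 := congrFun hP fun t i => Matrix.GeneralLinearGroup.mk'' _ (hdet t i)
    have h2 : ∀ ω : ∀ t, GLProd L (β t), MvPolynomial.aeval
        (fun (c : Σ t, VCoord (β t) (β t)) (ω : ∀ t, GLProd L (β t)) =>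
          VMat.entries (fun i => (ω c.1 i).1) c.2) P ω =
        MvPolynomial.aeval (fun c : Σ t, VCoord (β t) (β t) =>
          VMat.entries (fun i => (ω c.1 i).1) c.2) P := fun ω =>
      MvPolynomial.comp_aeval_apply _
        (Pi.evalAlgHom L (fun _ : ∀ t, GLProd L (β t) => L) ω) P
    rw [h2] at h1
    rw [← MvPolynomial.coe_aeval_eq_eval, RingHom.coe_coe]
    have h3 : MvPolynomial.aeval x P = 0 := h1
    rw [h3, zero_mul]
  exact (mul_eq_zero.1 hPD).resolve_right hD

/-- Conjugate bricks have a one-dimensional space of homomorphisms. -/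
theorem OrthBricks.finrank_homSpace_conj_le {L : Type w} [Field L] {r : ℕ} {β : Fin r → I → ℕ}
    {S : ∀ t, DRep L (β t)} (hS : OrthBricks S) (t : Fin r) {S' : DRep L (β t)}
    {G H : VMat L (β t) (β t)} (hGH : ∀ i, G i * H i = 1) (hG : IsHom (S t) S' G)
    (hH : IsHom S' (S t) H) : Module.finrank L (homSpace (S t) S') ≤ 1 := by
  refine finrank_le_one (R := L) ⟨G, mem_homSpace.2 hG⟩ ?_
  rintro ⟨X, hX⟩
  obtain ⟨c, hc⟩ := hS.hom_self t _ (hH.comp (mem_homSpace.1 hX))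
  refine ⟨c, Subtype.ext (funext fun i => ?_)⟩
  have h1 := congrFun hc i
  change c • G i = X i
  have h2 : X i = G i * (H i * X i) := by rw [← Matrix.mul_assoc, hGH, Matrix.one_mul]
  rw [h2, h1, Matrix.mul_smul, Matrix.mul_one]

theorem moment_arrGerm {K : Type w} [Field K] {Ω : Type w'} {L : Type ww} [Field L] [Algebra K L]
    (π : (Ω → K) →ₐ[K] L) {α : I → ℕ} {M : Ω → DRep K α} (h : ∀ ω i, moment (M ω) i = 0) (i : I) :
    moment (arrGerm π M) i = 0 := by
  rw [moment_eq_bimoment, bimoment_arrGerm, ← matGerm_zero π]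
  congr 1
  funext ω
  rw [← moment_eq_bimoment]
  exact h ω i

theorem arrGerm_const_entries_subset {K : Type w} [Field K] {Ω : Type w'} {L : Type ww} [Field L]
    [Algebra K L] (π : (Ω → K) →ₐ[K] L) {α : I → ℕ} (M : DRep K α) :
    Set.range (RArr.entries (arrGerm π fun _ => M)) ⊆ Set.range (algebraMap K L) := by
  rintro _ ⟨c, rfl⟩
  exact ⟨RArr.entries M c, (π.commutes _).symm⟩

/-- The transcendence degree of a filtered representation, when the bricks vary. -/
theorem TopFilt.trRk_le_of_varying {K : Type*} {L : Type w} [Field K] [Field L] [Algebra K L]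
    [CharZero K] {r : ℕ} {β : Fin r → I → ℕ} {S : ∀ t, DRep L (β t)} (hS : OrthBricks S)
    {l : List (Fin r × ℕ)} {α : I → ℕ} {M : DRep L α} (h : TopFilt S l α M)
    (hl : ∀ t, 0 < firstMult t l) (hM : ∀ i, moment M i = 0) {n : ℕ}
    (hn : (n : ℕ∞) ≤ trRk K (Set.range (RArr.entries M))) :
    (n : ℤ) ≤ dotSelf α - 1 + p α + ∑ t, p (β t) := by
  have : CharZero L := charZero_of_injective_algebraMap (algebraMap K L).injective
  obtain ⟨U, L', _, _, π, hπ, hind⟩ :=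
    AlgebraicIndependent.exists_isUltrapower (algebraicIndependent_glCoord L β)
  let _ : Algebra K L' := ((algebraMap L L').comp (algebraMap K L)).toAlgebra
  have : IsScalarTower K L L' := IsScalarTower.of_algebraMap_eq' rfl
  let M' : DRep L' α := arrGerm π fun _ => M
  let S₀ : ∀ t, DRep L' (β t) := fun t => arrGerm π fun _ => S t
  -- Conjugation by a generic group element keeps the filtration of `M` and makes `S'` as
  -- independent of `S₀` as isomorphism allows.
  let S' : ∀ t, DRep L' (β t) := fun t => arrGerm π fun ω => QuiverReduction.conj (ω t) (S t)
  let G : ∀ t, VMat L' (β t) (β t) := fun t => vertGerm π fun ω i => (ω t i).1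
  let H : ∀ t, VMat L' (β t) (β t) := fun t => vertGerm π fun ω i => (ω t i)⁻¹.1
  have hGω : ∀ (ω : ∀ t, GLProd L (β t)) t,
      IsHom (S t) (QuiverReduction.conj (ω t) (S t)) fun i => (ω t i).1 := by
    intro ω t i j e
    rw [QuiverReduction.conj, Matrix.mul_assoc _ _ (ω t i).1, (ω t i).inv_mul, Matrix.mul_one]
  have hHω : ∀ (ω : ∀ t, GLProd L (β t)) t,
      IsHom (QuiverReduction.conj (ω t) (S t)) (S t) fun i => (ω t i)⁻¹.1 := by
    intro ω t i j e
    rw [QuiverReduction.conj, Matrix.mul_assoc (ω t j).1, ← Matrix.mul_assoc, (ω t j).inv_mul,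
      Matrix.one_mul]
  have hG : ∀ t, IsHom (S₀ t) (S' t) (G t) := fun t =>
    (hπ.isHom_iff _ _ _).2 (Filter.Eventually.of_forall fun ω => hGω ω t)
  have hH : ∀ t, IsHom (S' t) (S₀ t) (H t) := fun t =>
    (hπ.isHom_iff _ _ _).2 (Filter.Eventually.of_forall fun ω => hHω ω t)
  have hGH : ∀ t i, G t i * H t i = 1 := by
    intro t i
    simp only [G, H, vertGerm]
    rw [← matGerm_mul, ← matGerm_one π]
    congr 1
    funext ω
    exact (ω t i).mul_inv
  have hS₀ : OrthBricks S₀ := hπ.orthBricks (S := fun _ => S)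
    (Filter.Eventually.of_forall fun _ => hS)
  have hS' : OrthBricks S' := hπ.orthBricks (S := fun ω t => QuiverReduction.conj (ω t) (S t))
    (Filter.Eventually.of_forall fun ω => hS.changeQuotients (fun t i => (ω t i).mul_inv)
      (hGω ω) (hHω ω))
  have hF' : TopFilt S' l α M' := hπ.topFilt (S := fun ω t => QuiverReduction.conj (ω t) (S t))
    (Filter.Eventually.of_forall fun ω => h.changeQuotients (fun t i => (ω t i).inv_mul)
      (fun t i => (ω t i).mul_inv) (hGω ω) (hHω ω))
  have hM' : ∀ i, moment M' i = 0 := moment_arrGerm π fun _ => hM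
  let A := Set.range (RArr.entries M')
  let B := ⋃ t, Set.range (RArr.entries (S₀ t))
  let B' := ⋃ t, Set.range (RArr.entries (S' t))
  let Γ := ⋃ t, Set.range (VMat.entries (G t))
  have hΓ : Γ = Set.range fun c : Σ t, VCoord (β t) (β t) => π fun ω : ∀ t, GLProd L (β t) =>
      VMat.entries (fun i => (ω c.1 i).1) c.2 := by
    ext x
    simp only [Γ, Set.mem_iUnion, Set.mem_range, Sigma.exists]
    rfl
  have hcard : Fintype.card (Σ t, VCoord (β t) (β t)) = ∑ t, vertDim (β t) (β t) := by
    rw [Fintype.card_sigma]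
    refine Finset.sum_congr rfl fun t _ => ?_
    rw [Fintype.card_sigma, vertDim]
    simp
  have h1 : trRk K (A ∪ B) + (∑ t, vertDim (β t) (β t) : ℕ) ≤ trRk K (A ∪ B ∪ Γ) := by
    rw [hΓ, ← hcard]
    refine trRk_add_card_le hind (Set.union_subset (arrGerm_const_entries_subset π M)
      (Set.iUnion_subset fun t => arrGerm_const_entries_subset π (S t)))
  -- Given `S₀ t` and `S' t`, the isomorphism `G t` is unique up to a scalar, so it adds at most one
  -- parameter.
  have h2 : trRk K (A ∪ B ∪ B' ∪ Γ) ≤ trRk K (A ∪ B ∪ B') + (∑ _t : Fin r, 1 : ℕ) := by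
    refine trRk_union_iUnion_le _ _ _ fun t X' hX' => ?_
    refine (trRk_union_isHom_le X' (S₀ t) (S' t) ?_ ?_ (G t) (hG t)).trans ?_
    · exact ((Set.subset_iUnion (fun t => Set.range (RArr.entries (S₀ t))) t).trans
        (Set.subset_union_right.trans Set.subset_union_left)).trans hX'
    · exact ((Set.subset_iUnion (fun t => Set.range (RArr.entries (S' t))) t).trans
        Set.subset_union_right).trans hX'
    · gcongr
      exact hS₀.finrank_homSpace_conj_le t (hGH t) (hG t) (hH t)
  have h12 : trRk K (A ∪ B ∪ Γ) ≤ trRk K (A ∪ B ∪ B' ∪ Γ) :=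
    Matroid.eRk_mono _ (Set.union_subset_union_left _ Set.subset_union_left)
  -- Submodularity. With `h1`, `h12` and `h2` it bounds `trRk K A` plus the sum of `vertDim (β t) (β
  -- t) - 1` by `trRk K (A ∪ B')`, whatever the relation between `A` and `B`; the orbit dimensions
  -- then cancel against those in `h5`.
  have h3 : trRk K A + trRk K (A ∪ B ∪ B') ≤ trRk K (A ∪ B) + trRk K (A ∪ B') := by
    refine le_trans ?_ (Matroid.eRk_inter_add_eRk_union_le _ (A ∪ B) (A ∪ B'))
    refine add_le_add (Matroid.eRk_mono _
      (Set.subset_inter Set.subset_union_left Set.subset_union_left)) (Matroid.eRk_mono _ ?_)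
    exact Set.union_subset Set.subset_union_left
      (Set.subset_union_right.trans Set.subset_union_right)
  obtain ⟨d, hd, hd'⟩ := hF'.trRk_le (K := K) hS' B'
    (Set.subset_iUnion fun t => Set.range (RArr.entries (S' t))) hl hM'
  have h5 : trRk K B' ≤
      (∑ t, Module.finrank L' (LinearMap.ker (dMoment (S' t) (S' t))) : ℕ) := by
    have h6 := trRk_union_iUnion_le (K := K) (∅ : Set L')
      (fun t => Set.range (RArr.entries (S' t))) _ fun t X' _ =>
        trRk_union_moment_le (K := K) X' (S' t) (hS'.moment_eq t)
    rwa [Set.empty_union, trRk, trRk, Matroid.eRk_empty, zero_add] at h6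
  have h7 : (n : ℕ∞) ≤ trRk K A := by
    refine hn.trans ((trRk_le_trRk_image (L' := L') _).trans (Matroid.eRk_mono _ ?_))
    rintro _ ⟨_, ⟨c, rfl⟩, rfl⟩
    exact ⟨c, π.commutes _⟩
  have hfin : ∀ X : Set L', X.Finite → ∃ m : ℕ, trRk K X = m := fun X hX =>
    ⟨_, (ENat.natCast_toNat (ne_top_of_le_ne_top (Set.encard_ne_top_iff.2 hX)
      (Matroid.eRk_le_encard _ X))).symm⟩
  have hA : A.Finite := Set.finite_range _
  have hB : B.Finite := Set.finite_iUnion fun t => Set.finite_range _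
  have hB' : B'.Finite := Set.finite_iUnion fun t => Set.finite_range _
  obtain ⟨rA, hrA⟩ := hfin A hA
  obtain ⟨rAB, hrAB⟩ := hfin _ (hA.union hB)
  obtain ⟨rABB, hrABB⟩ := hfin _ ((hA.union hB).union hB')
  obtain ⟨rB, hrB⟩ := hfin _ hB'
  obtain ⟨rAB', hrAB'⟩ := hfin _ (hA.union hB')
  have hd1 : trRk K (B' ∪ A) ≤ trRk K B' + d := hd
  rw [Set.union_comm, hrAB', hrB] at hd1
  rw [hrB] at h5
  rw [hrA] at h7
  rw [hrA, hrAB, hrABB, hrAB'] at h3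
  have h8 := h1.trans (h12.trans h2)
  rw [hrAB, hrABB] at h8
  norm_cast at hd1 h5 h7 h3 h8
  have h9 : ((∑ t, Module.finrank L' (LinearMap.ker (dMoment (S' t) (S' t))) : ℕ) : ℤ) ≤
      ∑ t, (2 * p (β t) + (vertDim (β t) (β t) : ℤ) - 1) := by
    push_cast
    refine Finset.sum_le_sum fun t _ => ?_
    rw [← dotSelf_eq_vertDim]
    exact hS'.finrank_ker_dMoment_le t
  rw [Finset.sum_sub_distrib, Finset.sum_add_distrib, ← Finset.mul_sum] at h9
  have h10 : (∑ t : Fin r, (1 : ℤ)) = ((∑ _t : Fin r, 1 : ℕ) : ℤ) := by push_cast; rfl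
  rw [h10] at h9
  have h11 : ((∑ t, vertDim (β t) (β t) : ℕ) : ℤ) = ∑ t, (vertDim (β t) (β t) : ℤ) := by
    push_cast; rfl
  omega

end Generic
end QuiverReduction

/-! ### The two dimension bounds -/

theorem theorem6p3 {K : Type w} [Field K] [IsAlgClosed K] [CharZero K]
    {I : Type u} [Fintype I] [Quiver.{v} I] [∀ i j : I, Fintype (i ⟶ j)]
    (α : I → ℕ) {r : ℕ} (k : Fin r → ℕ) (β : Fin r → I → ℕ) :
    (∀ x : QuiverReduction.NQ K α, x ∈ QuiverReduction.stratum α k β →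
      QuiverReduction.DimLE (QuiverReduction.preimage {x})
        (QuiverReduction.dotSelf α - 1 + QuiverReduction.p α
          - ∑ t, QuiverReduction.p (β t))) ∧
    QuiverReduction.DimLE
      (QuiverReduction.preimage (QuiverReduction.stratum (K := K) α k β))
      (QuiverReduction.dotSelf α - 1 + QuiverReduction.p α
        + ∑ t, QuiverReduction.p (β t)) := by
  open QuiverReduction in
  refine ⟨?_, ?_⟩
  · rintro x ⟨y, rfl, hk, T, hT0, hT, hne, hy⟩ n hn
    obtain ⟨U, L, _, _, π, hπ, hrk⟩ := exists_isUltrapower_of_le_dim hn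
    have hS := orthBricks_of_isSimple hT0 hT hne
    have hpt : ∀ s : preimage {quotMap y}, (∀ i, moment s.1 i = 0) ∧
        ∃ l, TopFilt T l α s.1 ∧ ∀ t, 0 < firstMult t l := by
      rintro ⟨_, z, hz, rfl⟩
      exact ⟨z.2, exists_topFilt_of_quotMap_eq hk hS hT hy hz⟩
    obtain ⟨l, hl, hlt⟩ := exists_eventually_topFilt U hS.ne_zero (S := fun _ => T)
      (M := fun s => s.1) fun s => (hpt s).2
    -- Over a single point the simples are fixed and defined over `K`, so they contribute no
    -- parameters.
    have hX : trRk K (⋃ t, Set.range (RArr.entries (arrGerm π fun _ => T t))) = 0 :=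
      trRk_eq_zero_of_subset_range
        (Set.iUnion_subset fun t => arrGerm_const_entries_subset π (T t))
    obtain ⟨d, hd, hd'⟩ := (hπ.topFilt hl).trRk_le (K := K)
      (hπ.orthBricks (S := fun _ => T) (Filter.Eventually.of_forall fun _ => hS)) _
      (Set.subset_iUnion fun t => Set.range (RArr.entries (arrGerm π fun _ => T t))) hlt
      (moment_arrGerm π fun s => (hpt s).1)
    rw [hX, zero_add] at hd
    have h1 : (n : ℕ∞) ≤ d := (hrk.trans (Matroid.eRk_mono _ Set.subset_union_right)).trans hd
    have h2 : n ≤ d := by exact_mod_cast h1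
    omega
  · intro n hn
    obtain ⟨U, L, _, _, π, hπ, hrk⟩ := exists_isUltrapower_of_le_dim hn
    -- Over a stratum the simples depend on the point. They are chosen pointwise, and the germs of
    -- the choice are the bricks over `L`.
    have hpt : ∀ s : preimage (stratum (K := K) α k β), ∃ T : ∀ t, DRep K (β t), OrthBricks T ∧
        (∀ i, moment s.1 i = 0) ∧ ∃ l, TopFilt T l α s.1 ∧ ∀ t, 0 < firstMult t l := by
      rintro ⟨_, z, ⟨y, hz, hk, T, hT0, hT, hne, hy⟩, rfl⟩
      have hS := orthBricks_of_isSimple hT0 hT hne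
      exact ⟨T, hS, z.2, exists_topFilt_of_quotMap_eq hk hS hT hy hz.symm⟩
    choose T hT hmom hfilt using hpt
    -- The ultrafilter guarantees a point in the preimage, and its simples show that the dimension
    -- vectors are nonzero.
    have hβ : ∀ t, ∃ i, 0 < β t i := by
      obtain ⟨s, -⟩ := U.nonempty_of_mem Filter.univ_mem
      exact (hT s).ne_zero
    obtain ⟨l, hl, hlt⟩ := exists_eventually_topFilt U hβ (S := T) (M := fun s => s.1) hfilt
    exact (hπ.topFilt hl).trRk_le_of_varying (K := K)
      (hπ.orthBricks (Filter.Eventually.of_forall hT)) hlt (moment_arrGerm π hmom) hrk
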